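/- Write $e(x)=e^{2\pi i x}$ and $\hat f(\xi)=\int_{\mathbb R} f(x)e(-x\xi)\,dx$. Let $\alpha,\theta,\varepsilon$ be real numbers with $\alpha>0$, $\varepsilon>0$ and $3\varepsilon<\theta<1-3\varepsilon$, and let $f:\mathbb R\to\mathbb C$ be an even, smooth, compactly supported function. Then, as $N\to\infty$ through the positive integers, $$\frac{2}{N^2}\sum_{1\le k\le N^{1+\varepsilon}}\hat f\Big(\frac kN\Big)\Big|\sum_{1\le y\le N}e(\alpha k y^{\theta})\Big|^2 = f(0)+O\Big(N^{-\theta/2+\varepsilon/2}\log N+N^{-1/4+\theta/4+3\varepsilon/4}\log N+S(N)\Big),$$ where the implied constant (and the threshold for $N$) depends on $f,\alpha,\theta,\varepsilon$ only, and $S(N)$ is defined as follows. For $X\ge 1$ let $\mathcal D(X)$ be the set of the numbers $X/2^{j}$ with integer $j\ge1$ and $2\cdot X/2^{j}\ge 1$ (so the intervals $(K,2K]$, $K\in\mathcal D(X)$, are disjoint and cover all positive integers up to $X$). Then $$S(N)=\frac1{N^2}\sum_{K\in\mathcal D(N^{1+\varepsilon})}\ \sum_{Y_1,Y_2\in\mathcal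 D(N)}K^{\frac{2-\theta}{1-\theta}-1}\max_{K\le\tilde K\le 2K}\big|\tilde S(K,\tilde K,Y_1,Y_2)\big|,$$ $$\tilde S(K,\tilde K,Y_1,Y_2)=\sum_{(m_1,m_2)}\Big(\frac1{m_1m_2}\Big)^{\frac{2-\theta}{2-2\theta}}\sum_{L\le\ell<\tilde L}\frac{c_1}{\sqrt\eta}\Big(\frac{\ell}{\eta}\Big)^{\frac1{2\theta}-1}e\big(c_2\,\ell^{1/\theta}\eta^{1-1/\theta}\big),$$ where $(m_1,m_2)$ runs over the pairs of integers with $m_1<m_2$ and $\alpha\theta K(2Y_i)^{\theta-1}\le m_i<2\alpha\theta KY_i^{\theta-1}$ for $i=1,2$; where $\eta=m_1^{-\theta/(1-\theta)}-m_2^{-\theta/(1-\theta)}$; where $\ell$ runs over integers; and where $$L=\frac{c_3\eta}{1-\theta}K_1^{\theta/(1-\theta)},\qquad \tilde L=\frac{c_3\eta}{1-\theta}K_2^{\theta/(1-\theta)},\qquad c_3=(\alpha\theta)^{1/(1-\theta)}\Big(\frac1\theta-1\Big),$$ $$c_1=\frac{1-\theta}{\sqrt{c_3\theta}}\Big(\frac{1-\theta}{c_3}\Big)^{\frac1{2\theta}-1},\qquad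 c_2=-\theta\Big(\frac{1-\theta}{c_3}\Big)^{\frac1\theta-1},$$ $$K_1=\max\Big(K,\frac{m_1}{\alpha\theta Y_1^{\theta-1}},\frac{m_2}{\alpha\theta Y_2^{\theta-1}}\Big),\qquad K_2=\min\Big(\tilde K,\frac{m_1}{\alpha\theta(2Y_1)^{\theta-1}},\frac{m_2}{\alpha\theta(2Y_2)^{\theta-1}}\Big).$$ -/

import Mathlib

open scoped FourierTransform ContDiff
open Filter Asymptotics

namespace DyadicTransform

noncomputable section

/-- The additive character `e(x) = exp(2πix)`. -/
def e (x : ℝ) : ℂ := Complex.exp (2 * Real.pi * Complex.I * x)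

/-- The left ends `X/2, X/4, X/8, …` of the dyadic intervals `(K, 2K]` that decompose `(0, X]`,
kept as long as `2K ≥ 1`. These intervals are disjoint and cover all positive integers up to `X`,
and the intervals dropped contain no positive integer. -/
def dyadic (X : ℝ) : Finset ℝ :=
  (Finset.Icc 1 (Nat.log 2 ⌊X⌋₊ + 1)).image (fun j : ℕ => X / 2 ^ j)

/-- Description of `dyadic X` through its elements. -/
theorem mem_dyadic {X : ℝ} (hX : 1 ≤ X) (K : ℝ) :
    K ∈ dyadic X ↔ ∃ j : ℕ, 1 ≤ j ∧ K = X / 2 ^ j ∧ 1 ≤ 2 * K := by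
  have hfl : ⌊X⌋₊ ≠ 0 := (Nat.floor_pos.2 hX).ne'
  have key : ∀ j : ℕ, 1 ≤ j → (j ≤ Nat.log 2 ⌊X⌋₊ + 1 ↔ 1 ≤ 2 * (X / 2 ^ j)) := by
    intro j hj
    obtain ⟨i, rfl⟩ := Nat.exists_eq_add_of_le' hj
    have h1 : 2 * (X / 2 ^ (i + 1)) = X / 2 ^ i := by
      rw [pow_succ]; field_simp
    rw [h1, le_div_iff₀ (by positivity), one_mul, Nat.add_le_add_iff_right,
      Nat.le_log_iff_pow_le (by norm_num) hfl, Nat.le_floor_iff (by linarith)]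
    push_cast
    rfl
  unfold dyadic
  simp only [Finset.mem_image, Finset.mem_Icc]
  constructor
  · rintro ⟨j, ⟨h1, h2⟩, rfl⟩
    exact ⟨j, h1, rfl, (key j h1).1 h2⟩
  · rintro ⟨j, h1, rfl, h2⟩
    exact ⟨j, ⟨h1, (key j h1).2 h2⟩, rfl⟩

/-- `η(m₁, m₂) = m₁^{-θ/(1-θ)} - m₂^{-θ/(1-θ)}`. -/
def eta (θ : ℝ) (m₁ m₂ : ℕ) : ℝ :=
  (m₁ : ℝ) ^ (-θ / (1 - θ)) - (m₂ : ℝ) ^ (-θ / (1 - θ))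

/-- The integers `m` with `αθK(2Y)^{θ-1} ≤ m < 2αθKY^{θ-1}`. -/
def mRange (α θ K Y : ℝ) : Finset ℕ :=
  Finset.Ico ⌈α * θ * K * (2 * Y) ^ (θ - 1)⌉₊ ⌈2 * α * θ * K * Y ^ (θ - 1)⌉₊

theorem mem_mRange (α θ K Y : ℝ) (m : ℕ) :
    m ∈ mRange α θ K Y ↔
      α * θ * K * (2 * Y) ^ (θ - 1) ≤ m ∧ (m : ℝ) < 2 * α * θ * K * Y ^ (θ - 1) := by
  simp [mRange, Nat.lt_ceil]

/-- The index set of the `η`-sum: the pairs `m₁ < m₂` in the two ranges. (An `η` that comes from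
several pairs is counted once for each of them, since the summand depends on `m₁, m₂`.) -/
def pairs (α θ K Y₁ Y₂ : ℝ) : Finset (ℕ × ℕ) :=
  (mRange α θ K Y₁ ×ˢ mRange α θ K Y₂).filter (fun p => p.1 < p.2)

def c₃ (α θ : ℝ) : ℝ := (α * θ) ^ (1 / (1 - θ)) * (1 / θ - 1)

def c₁ (α θ : ℝ) : ℝ :=
  (1 - θ) / Real.sqrt (c₃ α θ * θ) * ((1 - θ) / c₃ α θ) ^ (1 / (2 * θ) - 1)

def c₂ (α θ : ℝ) : ℝ := -θ * ((1 - θ) / c₃ α θ) ^ (1 / θ - 1)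

/-- Lower end of the `k`-interval attached to `m₁, m₂`: it encodes `K ≤ k` and
`mᵢ ≤ αθkYᵢ^{θ-1}` for `i = 1, 2`. -/
def K₁ (α θ K Y₁ Y₂ : ℝ) (m₁ m₂ : ℕ) : ℝ :=
  max K (max ((m₁ : ℝ) / (α * θ * Y₁ ^ (θ - 1))) ((m₂ : ℝ) / (α * θ * Y₂ ^ (θ - 1))))

/-- Upper end of the `k`-interval attached to `m₁, m₂`: it encodes `k ≤ Kt` and
`αθk(2Yᵢ)^{θ-1} ≤ mᵢ` for `i = 1, 2`. -/
def K₂ (α θ Kt Y₁ Y₂ : ℝ) (m₁ m₂ : ℕ) : ℝ :=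
  min Kt (min ((m₁ : ℝ) / (α * θ * (2 * Y₁) ^ (θ - 1)))
    ((m₂ : ℝ) / (α * θ * (2 * Y₂) ^ (θ - 1))))

/-- `L`, the lower end of the `ℓ`-range. -/
def Llow (α θ K Y₁ Y₂ : ℝ) (m₁ m₂ : ℕ) : ℝ :=
  c₃ α θ * eta θ m₁ m₂ / (1 - θ) * K₁ α θ K Y₁ Y₂ m₁ m₂ ^ (θ / (1 - θ))

/-- `L̃`, the upper end of the `ℓ`-range. -/
def Lup (α θ Kt Y₁ Y₂ : ℝ) (m₁ m₂ : ℕ) : ℝ :=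
  c₃ α θ * eta θ m₁ m₂ / (1 - θ) * K₂ α θ Kt Y₁ Y₂ m₁ m₂ ^ (θ / (1 - θ))

/-- The inner summand over `ℓ`. -/
def innerTerm (α θ : ℝ) (m₁ m₂ ℓ : ℕ) : ℂ :=
  ((c₁ α θ / Real.sqrt (eta θ m₁ m₂)
      * ((ℓ : ℝ) / eta θ m₁ m₂) ^ (1 / (2 * θ) - 1) : ℝ) : ℂ)
    * e (c₂ α θ * (ℓ : ℝ) ^ (1 / θ) * eta θ m₁ m₂ ^ (1 - 1 / θ))

/-- `S̃(K, K̃, Y₁, Y₂)`; the inner sum runs over the integers `ℓ` with `L ≤ ℓ < L̃`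
(here `L > 0`, so these are positive). -/
def Stilde (α θ K Kt Y₁ Y₂ : ℝ) : ℂ :=
  ∑ p ∈ pairs α θ K Y₁ Y₂,
    ((1 / ((p.1 : ℝ) * (p.2 : ℝ))) ^ ((2 - θ) / (2 - 2 * θ)) : ℝ) *
      ∑ ℓ ∈ Finset.Ico ⌈Llow α θ K Y₁ Y₂ p.1 p.2⌉₊ ⌈Lup α θ Kt Y₁ Y₂ p.1 p.2⌉₊,
        innerTerm α θ p.1 p.2 ℓ

/-- `max_{K ≤ K̃ ≤ 2K} |S̃(K, K̃, Y₁, Y₂)|`. -/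
def maxStilde (α θ K Y₁ Y₂ : ℝ) : ℝ :=
  sSup ((fun Kt : ℝ => ‖Stilde α θ K Kt Y₁ Y₂‖) '' Set.Icc K (2 * K))

/-- The maximum in `maxStilde` exists (as `S̃` takes only finitely many values for varying `K̃`). -/
theorem isGreatest_maxStilde {α θ K Y₁ Y₂ : ℝ} (hα : 0 < α) (hθ₀ : 0 < θ) (hθ₁ : θ < 1)
    (hK : 0 < K)
    (hY₁ : 0 < Y₁) (hY₂ : 0 < Y₂) :
    IsGreatest ((fun Kt : ℝ => ‖Stilde α θ K Kt Y₁ Y₂‖) '' Set.Icc K (2 * K))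
      (maxStilde α θ K Y₁ Y₂) := by
  have h1θ : 0 < 1 - θ := by linarith
  have hc : 0 < c₃ α θ := by
    unfold c₃
    have : 1 < 1 / θ := by rw [lt_div_iff₀ hθ₀]; linarith
    have h2 : 0 < 1 / θ - 1 := by linarith
    positivity
  set P := pairs α θ K Y₁ Y₂ with hP
  let B : ℕ × ℕ → ℝ := fun p =>
    c₃ α θ * |eta θ p.1 p.2| / (1 - θ) * (2 * K) ^ (θ / (1 - θ))
  obtain ⟨M, hM⟩ : ∃ M : ℕ, ∀ p ∈ P, ⌈B p⌉₊ ≤ M :=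
    ⟨P.sup (fun p => ⌈B p⌉₊), fun p hp => Finset.le_sup (f := fun p => ⌈B p⌉₊) hp⟩
  have hB : ∀ Kt ∈ Set.Icc K (2 * K), ∀ p ∈ P, ⌈Lup α θ Kt Y₁ Y₂ p.1 p.2⌉₊ ≤ M := by
    intro Kt hKt p hp
    refine le_trans (Nat.ceil_le_ceil ?_) (hM p hp)
    unfold Lup
    have hpow : |K₂ α θ Kt Y₁ Y₂ p.1 p.2 ^ (θ / (1 - θ))| ≤ (2 * K) ^ (θ / (1 - θ)) := by
      have h0 : 0 ≤ K₂ α θ Kt Y₁ Y₂ p.1 p.2 := by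
        have hKt : 0 ≤ Kt := hK.le.trans hKt.1
        unfold K₂
        refine le_min hKt (le_min ?_ ?_) <;> positivity
      rw [abs_of_nonneg (Real.rpow_nonneg h0 _)]
      exact Real.rpow_le_rpow h0 ((min_le_left _ _).trans hKt.2) (by positivity)
    refine (le_abs_self _).trans ?_
    rw [abs_mul, abs_div, abs_mul, abs_of_pos hc, abs_of_pos h1θ]
    exact mul_le_mul_of_nonneg_left hpow (by positivity)
  let G : (P → Fin (M + 1)) → ℝ := fun g =>
    ‖∑ p : P, ((1 / ((p.1.1 : ℝ) * (p.1.2 : ℝ))) ^ ((2 - θ) / (2 - 2 * θ)) : ℝ) *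
      ∑ ℓ ∈ Finset.Ico ⌈Llow α θ K Y₁ Y₂ p.1.1 p.1.2⌉₊ (g p : ℕ), innerTerm α θ p.1.1 p.1.2 ℓ‖
  have hfin : ((fun Kt : ℝ => ‖Stilde α θ K Kt Y₁ Y₂‖) '' Set.Icc K (2 * K)).Finite := by
    refine (Set.finite_range G).subset ?_
    rintro _ ⟨Kt, hKt, rfl⟩
    refine ⟨fun p => ⟨⌈Lup α θ Kt Y₁ Y₂ p.1.1 p.1.2⌉₊, Nat.lt_succ_of_le (hB Kt hKt p.1 p.2)⟩, ?_⟩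
    simp only [G, Stilde]
    congr 1
    exact Finset.sum_coe_sort P (fun p : ℕ × ℕ =>
      (((1 / ((p.1 : ℝ) * (p.2 : ℝ))) ^ ((2 - θ) / (2 - 2 * θ)) : ℝ) : ℂ) *
        ∑ ℓ ∈ Finset.Ico ⌈Llow α θ K Y₁ Y₂ p.1 p.2⌉₊ ⌈Lup α θ Kt Y₁ Y₂ p.1 p.2⌉₊,
          innerTerm α θ p.1 p.2 ℓ)
  have hne : ((fun Kt : ℝ => ‖Stilde α θ K Kt Y₁ Y₂‖) '' Set.Icc K (2 * K)).Nonempty :=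
    ⟨_, K, ⟨le_rfl, by linarith⟩, rfl⟩
  exact ⟨hne.csSup_mem hfin, fun _ hx => le_csSup hfin.bddAbove hx⟩

/-- `S(N)`. -/
def S (α θ ε : ℝ) (N : ℕ) : ℝ :=
  1 / (N : ℝ) ^ 2 *
    ∑ K ∈ dyadic ((N : ℝ) ^ (1 + ε)), ∑ Y₁ ∈ dyadic (N : ℝ), ∑ Y₂ ∈ dyadic (N : ℝ),
      K ^ ((2 - θ) / (1 - θ) - 1) * maxStilde α θ K Y₁ Y₂

end

end DyadicTransform

/-! ### Oscillatory integrals: integration by parts, first and second derivative tests. -/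

namespace DyadicTransform

open MeasureTheory Set intervalIntegral

/-! The van der Corput `B`-process (Poisson summation followed by stationary phase) is applied
twice: in `y`, and then, once the square is expanded, in `k`.

On a block `(Y, 2Y]` the phase `αk y^θ` has derivative `αθk y^(θ-1)`. The block sum becomes, up to a
unimodular constant, a sum over the integers `m` in the range of this derivative, with terms of size
`k^(1/(2(1-θ))) m^(-(2-θ)/(2-2θ))` and phase `c₃ k^(1/(1-θ)) m^(-θ/(1-θ))` (`exists_bprocess`,
`exists_first_transform`). The square of the total error is `O(N^(2-θ)/k + log⁴ N)` for `k ≤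
N^(1+ε)`. An AM-GM inequality with a free parameter sets this against the second moment of the
transformed sum, which is about `N^(2+ε)`, and so gives `N^(-θ/2+ε/2) log N` after division by `N²`.

In the square of the transformed sum, the diagonal `m₁ = m₂` is a Riemann sum of a power of `m`. The
exponents are such that each block contributes its own length `Y`, hence all of them together about
`N` (`exists_diagSum`). What remains is `(2/N) ∑ 𝓕 f (k/N)`, a Riemann sum for the integral of the
even Schwartz function `𝓕 f`, and this integral is `f 0` by Fourier inversion
(`exists_fourier_weights`).

Off the diagonal, the terms `m₁ < m₂` and their conjugates have phase `c₃ η k^(1/(1-θ))` in `k`. The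
second `B`-process, on the `k`-interval where both frequencies are admissible, produces `S̃`
(`exists_norm_sum_offDiag_le`). The weights `𝓕 f (k/N) k^(1/(1-θ))` are removed by Abel summation.
This accounts for the maximum over `K̃` and for the factor `K^((2-θ)/(1-θ)-1) = K^(1/(1-θ))`. The
error here is `N^(3(1+ε)/2+θ/2) log⁶ N`, which divided by `N²` is the square of `N^(-1/4+θ/4+3ε/4)`
up to logarithms. As `θ < 1 - 3ε`, it is absorbed with a power of `N` to spare. -/

theorem norm_e (x : ℝ) : ‖e x‖ = 1 := by
  have : (2 * Real.pi * Complex.I * x : ℂ) = ((2 * Real.pi * x : ℝ) : ℂ) * Complex.I := by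
    push_cast; ring
  rw [e, this, Complex.norm_exp_ofReal_mul_I]

theorem e_add (x y : ℝ) : e (x + y) = e x * e y := by
  simp only [e, ← Complex.exp_add]; congr 1; push_cast; ring

theorem conj_e (x : ℝ) : (starRingEnd ℂ) (e x) = e (-x) := by
  simp only [e, ← Complex.exp_conj]; congr 1; simp [Complex.conj_ofNat]

theorem hasDerivAt_e (x : ℝ) : HasDerivAt e (2 * Real.pi * Complex.I * e x) x := by
  have h1 : HasDerivAt (fun x : ℝ => (2 * Real.pi * Complex.I * x : ℂ)) (2 * Real.pi * Complex.I) x := by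
    simpa using (Complex.ofRealCLM.hasDerivAt (x := x)).const_mul (2 * Real.pi * Complex.I : ℂ)
  exact h1.cexp.congr_deriv (mul_comm _ _)

theorem continuous_e : Continuous e := by unfold e; fun_prop

theorem hasDerivAt_e_comp {F : ℝ → ℝ} {F' x : ℝ} (h : HasDerivAt F F' x) :
    HasDerivAt (fun y => e (F y)) (2 * Real.pi * Complex.I * F' * e (F x)) x := by
  refine (HasDerivAt.scomp x (hasDerivAt_e (F x)) h).congr_deriv ?_
  rw [Complex.real_smul]; ring

/-- Integration by parts for oscillatory integrals. -/
theorem norm_integral_mul_deriv_mul_e_le {a b : ℝ} (hab : a ≤ b) {F F' g g' : ℝ → ℝ}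
    (hF : ∀ x ∈ Icc a b, HasDerivAt F (F' x) x) (hF' : ContinuousOn F' (Icc a b))
    (hg : ∀ x ∈ Icc a b, HasDerivAt g (g' x) x) (hg' : ContinuousOn g' (Icc a b)) :
    ‖∫ x in a..b, ((g x * F' x : ℝ) : ℂ) * e (F x)‖
      ≤ (|g a| + |g b| + ∫ x in a..b, |g' x|) / (2 * Real.pi) := by
  have hFc : ContinuousOn F (Icc a b) := fun x hx => (hF x hx).continuousAt.continuousWithinAt
  have hgc : ContinuousOn g (Icc a b) := fun x hx => (hg x hx).continuousAt.continuousWithinAt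
  have hec : ContinuousOn (fun x => e (F x)) (Icc a b) := continuous_e.comp_continuousOn hFc
  have h1 : ContinuousOn (fun x => ((g' x : ℝ) : ℂ) * e (F x)) (Icc a b) :=
    (Complex.continuous_ofReal.comp_continuousOn hg').mul hec
  have h2 : ContinuousOn (fun x => ((g x * F' x : ℝ) : ℂ) * e (F x)) (Icc a b) :=
    (Complex.continuous_ofReal.comp_continuousOn (hgc.mul hF')).mul hec
  have i1 : IntervalIntegrable (fun x => ((g' x : ℝ) : ℂ) * e (F x)) volume a b :=
    h1.intervalIntegrable_of_Icc hab
  have i2 : IntervalIntegrable (fun x => ((g x * F' x : ℝ) : ℂ) * e (F x)) volume a b :=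
    h2.intervalIntegrable_of_Icc hab
  have key : ∫ x in a..b, (((g' x : ℝ) : ℂ) * e (F x)
      + (2 * Real.pi * Complex.I) * (((g x * F' x : ℝ) : ℂ) * e (F x)))
      = (g b : ℂ) * e (F b) - (g a : ℂ) * e (F a) := by
    refine integral_eq_sub_of_hasDerivAt (f := fun x => (g x : ℂ) * e (F x)) ?_
      (i1.add (i2.const_mul _))
    intro x hx
    rw [uIcc_of_le hab] at hx
    refine (((hg x hx).ofReal_comp).mul (hasDerivAt_e_comp (hF x hx))).congr_deriv ?_
    push_cast; ring
  rw [integral_add i1 (i2.const_mul _), intervalIntegral.integral_const_mul] at key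
  have key2 : (2 * Real.pi * Complex.I) * (∫ x in a..b, ((g x * F' x : ℝ) : ℂ) * e (F x))
      = (g b : ℂ) * e (F b) - (g a : ℂ) * e (F a) - ∫ x in a..b, ((g' x : ℝ) : ℂ) * e (F x) := by
    rw [← key]; ring
  have h3 : ‖∫ x in a..b, ((g' x : ℝ) : ℂ) * e (F x)‖ ≤ ∫ x in a..b, |g' x| := by
    refine (intervalIntegral.norm_integral_le_integral_norm hab).trans (le_of_eq ?_)
    simp [norm_e]
  have h4 := congrArg norm key2
  rw [norm_mul] at h4
  have h5 : ‖(2 * Real.pi * Complex.I : ℂ)‖ = 2 * Real.pi := by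
    simp [abs_of_pos Real.pi_pos]
  rw [h5] at h4
  rw [le_div_iff₀ (by positivity), mul_comm, h4]
  refine (norm_sub_le _ _).trans ?_
  refine add_le_add ((norm_sub_le _ _).trans ?_) h3
  simp [norm_e, add_comm]

/-- A monotone `g` has total variation `|g b - g a| ≤ 2B`, so integration by parts gives at most
`4B/(2π)`, and `π > 2`. -/
theorem norm_integral_mul_deriv_mul_e_le_of_monotone {a b B : ℝ} (hab : a ≤ b) {F F' g g' : ℝ → ℝ}
    (hF : ∀ x ∈ Icc a b, HasDerivAt F (F' x) x) (hF' : ContinuousOn F' (Icc a b))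
    (hg : ∀ x ∈ Icc a b, HasDerivAt g (g' x) x) (hg' : ContinuousOn g' (Icc a b))
    (hs : (∀ x ∈ Icc a b, 0 ≤ g' x) ∨ (∀ x ∈ Icc a b, g' x ≤ 0))
    (ha : |g a| ≤ B) (hb : |g b| ≤ B) :
    ‖∫ x in a..b, ((g x * F' x : ℝ) : ℂ) * e (F x)‖ ≤ B := by
  have h := norm_integral_mul_deriv_mul_e_le hab hF hF' hg hg'
  have hI : ∫ x in a..b, g' x = g b - g a :=
    integral_eq_sub_of_hasDerivAt (fun x hx => hg x (by rwa [uIcc_of_le hab] at hx))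
      (hg'.intervalIntegrable_of_Icc hab)
  have hV : ∫ x in a..b, |g' x| ≤ |g b - g a| := by
    rcases hs with hs | hs
    · have : ∫ x in a..b, |g' x| = ∫ x in a..b, g' x :=
        integral_congr (fun x hx => abs_of_nonneg (hs x (by rwa [uIcc_of_le hab] at hx)))
      rw [this, hI]; exact le_abs_self _
    · have : ∫ x in a..b, |g' x| = ∫ x in a..b, -g' x :=
        integral_congr (fun x hx => abs_of_nonpos (hs x (by rwa [uIcc_of_le hab] at hx)))
      rw [this, intervalIntegral.integral_neg, hI]; exact neg_le_abs _
  have h3 : |g b - g a| ≤ |g b| + |g a| := abs_sub _ _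
  refine h.trans ?_
  have hB : 0 ≤ B := (abs_nonneg _).trans ha
  rw [div_le_iff₀ (by positivity)]
  nlinarith [Real.pi_gt_three]

/-- First derivative test. -/
theorem norm_integral_e_le_of_deriv {a b lam : ℝ} (hab : a ≤ b) (hl : 0 < lam) {F F' F'' : ℝ → ℝ}
    (hF : ∀ x ∈ Icc a b, HasDerivAt F (F' x) x) (hF' : ∀ x ∈ Icc a b, HasDerivAt F' (F'' x) x)
    (hF'' : ContinuousOn F'' (Icc a b)) (hs : ∀ x ∈ Icc a b, 0 ≤ F'' x)
    (hlam : ∀ x ∈ Icc a b, lam ≤ |F' x|) :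
    ‖∫ x in a..b, e (F x)‖ ≤ 1 / lam := by
  have hF'c : ContinuousOn F' (Icc a b) := fun x hx => (hF' x hx).continuousAt.continuousWithinAt
  have hne : ∀ x ∈ Icc a b, F' x ≠ 0 := fun x hx h => by
    have := hlam x hx; rw [h, abs_zero] at this; linarith
  -- Write `e(F) = (1/F') · F' e(F)`; since `F'' ≥ 0` and `F'` has no zero, `1/F'` is decreasing.
  have h := norm_integral_mul_deriv_mul_e_le_of_monotone (B := 1 / lam) hab hF hF'c
    (g := fun x => (F' x)⁻¹) (g' := fun x => -F'' x / F' x ^ 2)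
    (fun x hx => (hF' x hx).inv (hne x hx))
    (hF''.neg.div (hF'c.pow 2) (fun x hx => pow_ne_zero 2 (hne x hx)))
    (Or.inr fun x hx => div_nonpos_of_nonpos_of_nonneg (neg_nonpos.2 (hs x hx)) (sq_nonneg _))
    (by rw [abs_inv, ← one_div]; exact one_div_le_one_div_of_le hl (hlam a ⟨le_rfl, hab⟩))
    (by rw [abs_inv, ← one_div]; exact one_div_le_one_div_of_le hl (hlam b ⟨hab, le_rfl⟩))
  convert h using 2
  refine integral_congr (fun x hx => ?_)
  rw [uIcc_of_le hab] at hx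
  simp [inv_mul_cancel₀ (hne x hx)]

theorem norm_integral_e_le_length {a b : ℝ} (hab : a ≤ b) (F : ℝ → ℝ) :
    ‖∫ x in a..b, e (F x)‖ ≤ b - a := by
  have := intervalIntegral.norm_integral_le_of_norm_le_const (a := a) (b := b) (C := 1)
    (f := fun x => e (F x)) (fun x _ => (norm_e _).le)
  rwa [abs_of_nonneg (sub_nonneg.2 hab), one_mul] at this

theorem intervalIntegrable_e {a b : ℝ} (hab : a ≤ b) {F F' : ℝ → ℝ}
    (hF : ∀ x ∈ Icc a b, HasDerivAt F (F' x) x) :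
    IntervalIntegrable (fun x => e (F x)) volume a b :=
  ContinuousOn.intervalIntegrable_of_Icc hab
    (continuous_e.comp_continuousOn fun x hx => (hF x hx).continuousAt.continuousWithinAt)

theorem add_mul_le_of_deriv_ge {a b lam : ℝ} {F' F'' : ℝ → ℝ}
    (hF' : ∀ x ∈ Icc a b, HasDerivAt F' (F'' x) x)
    (hlam : ∀ x ∈ Icc a b, lam ≤ F'' x) {x y : ℝ} (hx : x ∈ Icc a b) (hy : y ∈ Icc a b)
    (hxy : x ≤ y) : lam * (y - x) ≤ F' y - F' x := by
  refine (convex_Icc a b).mul_sub_le_image_sub_of_le_deriv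
    (fun z hz => (hF' z hz).continuousAt.continuousWithinAt)
    (fun z hz => (hF' z (interior_subset hz)).differentiableAt.differentiableWithinAt)
    (fun z hz => ?_) x hx y hy hxy
  rw [(hF' z (interior_subset hz)).deriv]
  exact hlam z (interior_subset hz)

/-- Cut at distance `1/√lam` from `a`. The first piece is bounded by its length; beyond it `F' ≥ lam
(x - a) ≥ √lam`, so the first derivative test applies. -/
theorem norm_integral_e_le_of_deriv2_nonneg {a b lam : ℝ} (hab : a ≤ b) (hl : 0 < lam)
    {F F' F'' : ℝ → ℝ}
    (hF : ∀ x ∈ Icc a b, HasDerivAt F (F' x) x) (hF' : ∀ x ∈ Icc a b, HasDerivAt F' (F'' x) x)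
    (hF'' : ContinuousOn F'' (Icc a b)) (hlam : ∀ x ∈ Icc a b, lam ≤ F'' x) (h0 : 0 ≤ F' a) :
    ‖∫ x in a..b, e (F x)‖ ≤ 2 / √lam := by
  have hsq : 0 < √lam := Real.sqrt_pos.2 hl
  have h1 : √lam * √lam = lam := Real.mul_self_sqrt hl.le
  rcases le_total b (a + 1 / √lam) with h | h
  · refine (norm_integral_e_le_length hab F).trans ?_
    have : 1 / √lam ≤ 2 / √lam := by gcongr; norm_num
    linarith
  · set d := a + 1 / √lam
    have had : a ≤ d := by simp only [d]; linarith [one_div_pos.2 hsq]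
    have s1 : Icc a d ⊆ Icc a b := Icc_subset_Icc_right h
    have s2 : Icc d b ⊆ Icc a b := Icc_subset_Icc_left had
    rw [← integral_add_adjacent_intervals (intervalIntegrable_e had fun x hx => hF x (s1 hx))
      (intervalIntegrable_e h fun x hx => hF x (s2 hx))]
    refine (norm_add_le _ _).trans ?_
    have e1 := norm_integral_e_le_length had F
    have e2 := norm_integral_e_le_of_deriv (lam := √lam) h hsq (fun x hx => hF x (s2 hx))
      (fun x hx => hF' x (s2 hx)) (hF''.mono s2) (fun x hx => hl.le.trans (hlam x (s2 hx)))
      (fun x hx => by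
        have := add_mul_le_of_deriv_ge hF' hlam ⟨le_rfl, hab⟩ (s2 hx) (had.trans hx.1)
        have h3 : √lam ≤ lam * (x - a) := by
          have : 1 / √lam ≤ x - a := by have := hx.1; simp only [d] at this; linarith
          calc √lam = lam * (1 / √lam) := by rw [← h1]; field_simp; simp
            _ ≤ _ := by gcongr
        exact (by linarith : √lam ≤ F' x).trans (le_abs_self _))
    have : d - a = 1 / √lam := by simp [d]
    rw [this] at e1
    calc _ ≤ 1 / √lam + 1 / √lam := add_le_add e1 e2
      _ = _ := by ring

/-- The reflection `x ↦ -x` preserves the bound on `F''` and reverses the sign of `F'`. -/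
theorem norm_integral_e_le_of_deriv2_nonpos {a b lam : ℝ} (hab : a ≤ b) (hl : 0 < lam)
    {F F' F'' : ℝ → ℝ}
    (hF : ∀ x ∈ Icc a b, HasDerivAt F (F' x) x) (hF' : ∀ x ∈ Icc a b, HasDerivAt F' (F'' x) x)
    (hF'' : ContinuousOn F'' (Icc a b)) (hlam : ∀ x ∈ Icc a b, lam ≤ F'' x) (h0 : F' b ≤ 0) :
    ‖∫ x in a..b, e (F x)‖ ≤ 2 / √lam := by
  have m : ∀ x ∈ Icc (-b) (-a), -x ∈ Icc a b := fun x hx =>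
    ⟨by linarith [hx.2], by linarith [hx.1]⟩
  have := norm_integral_e_le_of_deriv2_nonneg (a := -b) (b := -a) (lam := lam) (by linarith) hl
    (F := fun x => F (-x)) (F' := fun x => -F' (-x)) (F'' := fun x => F'' (-x))
    (fun x hx => by
      have := (hF (-x) (m x hx)).scomp x (hasDerivAt_neg x)
      simpa [Function.comp_def] using this)
    (fun x hx => by
      have := ((hF' (-x) (m x hx)).scomp x (hasDerivAt_neg x)).fun_neg
      simpa [Function.comp_def] using this)
    (hF''.comp continuous_neg.continuousOn m) (fun x hx => hlam _ (m x hx)) (by simpa using h0)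
  rw [intervalIntegral.integral_comp_neg (fun x => e (F x))] at this
  simpa using this

/-- Second derivative test. -/
theorem norm_integral_e_le_of_deriv2 {a b lam : ℝ} (hab : a ≤ b) (hl : 0 < lam)
    {F F' F'' : ℝ → ℝ}
    (hF : ∀ x ∈ Icc a b, HasDerivAt F (F' x) x) (hF' : ∀ x ∈ Icc a b, HasDerivAt F' (F'' x) x)
    (hF'' : ContinuousOn F'' (Icc a b)) (hlam : ∀ x ∈ Icc a b, lam ≤ F'' x) :
    ‖∫ x in a..b, e (F x)‖ ≤ 4 / √lam := by
  have hsq : 0 < √lam := Real.sqrt_pos.2 hl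
  have h24 : 2 / √lam ≤ 4 / √lam := by gcongr; norm_num
  rcases le_total 0 (F' a) with h | h
  · exact (norm_integral_e_le_of_deriv2_nonneg hab hl hF hF' hF'' hlam h).trans h24
  rcases le_total (F' b) 0 with h' | h'
  · exact (norm_integral_e_le_of_deriv2_nonpos hab hl hF hF' hF'' hlam h').trans h24
  -- In the remaining case `F'` changes sign; on either side of a zero `c` one of the two one-sided
  -- bounds holds.
  obtain ⟨c, hc, hc0⟩ := intermediate_value_Icc hab
    (fun x hx => (hF' x hx).continuousAt.continuousWithinAt) ⟨h, h'⟩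
  have s1 : Icc a c ⊆ Icc a b := Icc_subset_Icc_right hc.2
  have s2 : Icc c b ⊆ Icc a b := Icc_subset_Icc_left hc.1
  rw [← integral_add_adjacent_intervals (intervalIntegrable_e hc.1 fun x hx => hF x (s1 hx))
      (intervalIntegrable_e hc.2 fun x hx => hF x (s2 hx))]
  refine (norm_add_le _ _).trans ?_
  have e1 := norm_integral_e_le_of_deriv2_nonpos hc.1 hl (fun x hx => hF x (s1 hx))
      (fun x hx => hF' x (s1 hx)) (hF''.mono s1) (fun x hx => hlam x (s1 hx)) hc0.le
  have e2 := norm_integral_e_le_of_deriv2_nonneg hc.2 hl (fun x hx => hF x (s2 hx))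
      (fun x hx => hF' x (s2 hx)) (hF''.mono s2) (fun x hx => hlam x (s2 hx)) hc0.ge
  calc _ ≤ 2 / √lam + 2 / √lam := add_le_add e1 e2
      _ = _ := by ring

theorem norm_integral_e_neg {a b : ℝ} (F : ℝ → ℝ) :
    (∫ x in a..b, e (-F x)) = (starRingEnd ℂ) (∫ x in a..b, e (F x)) := by
  simp_rw [← conj_e]
  exact intervalIntegral_conj

end DyadicTransform

/-! ### The Fresnel integral with an error term. -/

namespace DyadicTransform

open MeasureTheory Set intervalIntegral

/-- Integration by parts against the decreasing function `exp(-δx²)/(2x)`. The bound depends on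
neither `δ` nor `V`, so that `V → ∞` and then `δ → 0` can be taken. -/
theorem norm_integral_damped_le {δ U V : ℝ} (hδ : 0 ≤ δ) (hU : 0 < U) (hUV : U ≤ V) :
    ‖∫ x in U..V, ((Real.exp (-δ * x ^ 2) : ℝ) : ℂ) * e (x ^ 2)‖ ≤ 1 / (2 * U) := by
  have hpos : ∀ x ∈ Icc U V, 0 < x := fun x hx => hU.trans_le hx.1
  have hbd : ∀ x, U ≤ x → |Real.exp (-δ * x ^ 2) * (2 * x)⁻¹| ≤ 1 / (2 * U) := fun x hx => by
    have h0 : 0 < x := hU.trans_le hx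
    rw [abs_of_pos (by positivity), ← one_div]
    have h1 : Real.exp (-δ * x ^ 2) ≤ 1 := Real.exp_le_one_iff.2 (by nlinarith [sq_nonneg x])
    calc _ ≤ 1 * (1 / (2 * x)) := by gcongr
      _ ≤ 1 / (2 * U) := by rw [one_mul]; gcongr
  have h := norm_integral_mul_deriv_mul_e_le_of_monotone (B := 1 / (2 * U)) hUV
    (F := fun x => x ^ 2) (F' := fun x => 2 * x) (g := fun x => Real.exp (-δ * x ^ 2) * (2 * x)⁻¹)
    (g' := fun x => Real.exp (-δ * x ^ 2) * (-δ * (2 * x)) * (2 * x)⁻¹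
      + Real.exp (-δ * x ^ 2) * (-2 / (2 * x) ^ 2))
    (fun x _ => by simpa using hasDerivAt_pow 2 x) (by fun_prop)
    (fun x hx => by
      have h1 : HasDerivAt (fun x : ℝ => x ^ 2) (2 * x) x := by simpa using hasDerivAt_pow 2 x
      have h2 : HasDerivAt (fun x : ℝ => 2 * x) 2 x := by
        simpa using (hasDerivAt_id x).const_mul (2 : ℝ)
      exact ((h1.const_mul (-δ)).exp).mul (h2.fun_inv (by have := hpos x hx; positivity)))
    (by
      have : ∀ x ∈ Icc U V, 2 * x ≠ 0 := fun x hx => by have := hpos x hx; positivity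
      have h2 : ∀ x ∈ Icc U V, (2 * x) ^ 2 ≠ 0 := fun x hx => pow_ne_zero 2 (this x hx)
      fun_prop (disch := assumption))
    (Or.inr fun x hx => by
      have := hpos x hx
      have h1 : Real.exp (-δ * x ^ 2) * (-δ * (2 * x)) * (2 * x)⁻¹
        + Real.exp (-δ * x ^ 2) * (-2 / (2 * x) ^ 2)
        = -(Real.exp (-δ * x ^ 2) * (δ  + 2 / (2 * x) ^ 2)) := by field_simp; ring
      rw [h1, neg_nonpos]; positivity)
    (hbd U le_rfl) (hbd V hUV)
  convert h using 2
  refine integral_congr (fun x hx => ?_)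
  rw [uIcc_of_le hUV] at hx
  have := hpos x hx
  congr 2
  field_simp

/-- The quantity `I/2` is the value at `δ = 0` of `π/(δ - 2πi)`, whose square root is the Gaussian
integral with parameter `δ - 2πi`. -/
theorem cpow_I_div_two : (Complex.I / 2) ^ (1 / 2 : ℂ) = e (1 / 8) / (√2 : ℝ) := by
  have h2 : Complex.I / 2 = ((1 / 2 : ℝ) : ℂ) * Complex.I := by push_cast; ring
  have h1 : Complex.log (Complex.I / 2) = (Real.log (1 / 2) : ℝ) + Real.pi / 2 * Complex.I := by
    rw [h2, Complex.log_ofReal_mul (by norm_num) Complex.I_ne_zero, Complex.log_I]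
  have h0 : Complex.I / 2 ≠ 0 := by simp
  rw [Complex.cpow_def_of_ne_zero h0, h1, e, add_mul, Complex.exp_add]
  have h3 : Complex.exp ((Real.log (1 / 2) : ℝ) * (1 / 2 : ℂ)) = ((√2 : ℝ) : ℂ)⁻¹ := by
    have : ((Real.log (1 / 2) : ℝ) * (1 / 2 : ℂ)) = ((Real.log (1 / 2) * (1 / 2) : ℝ) : ℂ) := by
      push_cast; ring
    rw [this, ← Complex.ofReal_exp, ← Real.rpow_def_of_pos (by norm_num), ← Real.sqrt_eq_rpow,
      one_div, Real.sqrt_inv]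
    push_cast; rfl
  rw [h3, div_eq_mul_inv, mul_comm]
  congr 2
  push_cast; ring

/-- The factor `exp(-δx²)` makes the integral over `(0, ∞)` an explicit complex Gaussian. The tail
beyond `U` is bounded uniformly in `δ`, and both the truncated integral and the Gaussian value are
continuous as `δ → 0+`. -/
theorem norm_fresnel_sub_le_div {U : ℝ} (hU : 0 < U) :
    ‖(∫ x in (0 : ℝ)..U, e (x ^ 2)) - e (1 / 8) / (2 * √2 : ℝ)‖ ≤ 1 / (2 * U) := by
  let J : ℝ → ℂ := fun δ => ∫ x in (0 : ℝ)..U, ((Real.exp (-δ * x ^ 2) : ℝ) : ℂ) * e (x ^ 2)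
  let G : ℝ → ℂ := fun δ => (Real.pi / (δ - 2 * Real.pi * Complex.I)) ^ (1 / 2 : ℂ) / 2
  have hJ : Tendsto J (nhdsWithin 0 (Ioi 0)) (nhds (J 0)) := by
    have : Continuous J := by
      refine intervalIntegral.continuous_parametric_intervalIntegral_of_continuous' ?_ _ _
      have := continuous_e
      fun_prop
    exact this.continuousAt.tendsto.mono_left nhdsWithin_le_nhds
  have hlim : (Real.pi / (((0 : ℝ) : ℂ) - 2 * Real.pi * Complex.I)) = Complex.I / 2 := by
    have := Complex.I_sq
    have hp : (Real.pi : ℂ) ≠ 0 := by exact_mod_cast Real.pi_ne_zero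
    have hI := Complex.I_ne_zero
    simp only [Complex.ofReal_zero, zero_sub]
    field_simp
    rw [this]
  have hG : Tendsto G (nhdsWithin 0 (Ioi 0)) (nhds (G 0)) := by
    have : ContinuousAt G 0 := by
      refine ContinuousAt.div_const (ContinuousAt.cpow ?_ continuousAt_const ?_) _
      · refine ContinuousAt.div continuousAt_const (by fun_prop) ?_
        simp [Real.pi_ne_zero]
      · rw [hlim]; right; simp
    exact this.tendsto.mono_left nhdsWithin_le_nhds
  have hG0 : G 0 = e (1 / 8) / (2 * √2 : ℝ) := by
    simp only [G]
    rw [hlim, cpow_I_div_two]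
    push_cast; rw [div_div, mul_comm]
  have hJ0 : J 0 = ∫ x in (0 : ℝ)..U, e (x ^ 2) := by simp [J]
  rw [← hG0, ← hJ0]
  refine le_of_tendsto ((hJ.sub hG).norm) ?_
  filter_upwards [self_mem_nhdsWithin] with δ hδ
  have hδ : 0 < δ := hδ
  have hre : 0 < (δ - 2 * Real.pi * Complex.I : ℂ).re := by simpa using hδ
  have hint := integral_gaussian_complex_Ioi hre
  have hfun : ∀ x : ℝ, Complex.exp (-(δ - 2 * Real.pi * Complex.I : ℂ) * (x : ℂ) ^ 2)
      = ((Real.exp (-δ * x ^ 2) : ℝ) : ℂ) * e (x ^ 2) := by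
    intro x
    rw [e, Complex.ofReal_exp, ← Complex.exp_add]; congr 1; push_cast; ring
  simp_rw [hfun] at hint
  have hI : IntegrableOn (fun x : ℝ => ((Real.exp (-δ * x ^ 2) : ℝ) : ℂ) * e (x ^ 2)) (Ioi 0) := by
    have := (integrable_cexp_neg_mul_sq hre).integrableOn (s := Ioi (0 : ℝ))
    simpa only [hfun] using this
  have ht := intervalIntegral_tendsto_integral_Ioi 0 hI tendsto_id
  have hGd : G δ = ∫ x in Ioi (0 : ℝ), ((Real.exp (-δ * x ^ 2) : ℝ) : ℂ) * e (x ^ 2) := hint.symm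
  rw [hGd]
  refine le_of_tendsto ((tendsto_const_nhds.sub ht).norm) ?_
  filter_upwards [eventually_ge_atTop U] with V hV
  have hc : Continuous (fun x : ℝ => ((Real.exp (-δ * x ^ 2) : ℝ) : ℂ) * e (x ^ 2)) := by
    have := continuous_e
    fun_prop
  have := integral_interval_sub_left (μ := volume) (hc.intervalIntegrable 0 V) (hc.intervalIntegrable 0 U)
  simp only [J, id]
  rw [norm_sub_rev, this]
  exact norm_integral_damped_le hδ.le hU hV

/-- The form `4/(1+U)` remains valid down to `U = 0`, where an end point coincides with the
stationary point. -/
theorem norm_fresnel_sub_le {U : ℝ} (hU : 0 ≤ U) :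
    ‖(∫ x in (0 : ℝ)..U, e (x ^ 2)) - e (1 / 8) / (2 * √2 : ℝ)‖ ≤ 4 / (1 + U) := by
  rcases le_total U 1 with h | h
  · have h1 := norm_integral_e_le_length hU (fun x => x ^ 2)
    have h2 : ‖e (1 / 8) / (2 * √2 : ℝ)‖ ≤ 1 := by
      rw [norm_div, norm_e, Complex.norm_real, Real.norm_of_nonneg (by positivity)]
      have : 1 ≤ √2 := by rw [Real.one_le_sqrt]; norm_num
      rw [div_le_one (by positivity)]; linarith
    refine (norm_sub_le _ _).trans ?_
    rw [le_div_iff₀ (by linarith)]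
    nlinarith [norm_nonneg (∫ x in (0 : ℝ)..U, e (x ^ 2)), norm_nonneg (e (1 / 8) / (2 * √2 : ℝ))]
  · refine (norm_fresnel_sub_le_div (by linarith)).trans ?_
    rw [div_le_div_iff₀ (by linarith) (by linarith)]; linarith

end DyadicTransform

/-! ### Stationary phase for an analytic phase. -/

namespace DyadicTransform

open MeasureTheory Set intervalIntegral

/-- A zero can be divided out analytically: at the base point the power series is shifted, elsewhere
the quotient is the ordinary slope. -/
theorem _root_.AnalyticAt.dslope_same {f : ℝ → ℝ} {x₀ x : ℝ} (h₀ : AnalyticAt ℝ f x₀)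
    (h : AnalyticAt ℝ f x) : AnalyticAt ℝ (dslope f x₀) x := by
  rcases eq_or_ne x x₀ with rfl | hne
  · obtain ⟨p, hp⟩ := h₀
    exact ⟨_, hp.has_fpower_series_dslope_fslope⟩
  · have : dslope f x₀ =ᶠ[nhds x] slope f x₀ := by
      filter_upwards [isOpen_ne.mem_nhds hne] with y hy using dslope_of_ne f hy
    refine AnalyticAt.congr ?_ this.symm
    simp only [slope_fun_def_field]
    exact (h.sub analyticAt_const).div (analyticAt_id.sub analyticAt_const) (sub_ne_zero.2 hne)

theorem analyticAt_sqrt {f : ℝ → ℝ} {x : ℝ} (h : AnalyticAt ℝ f x) (hx : f x ≠ 0) :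
    AnalyticAt ℝ (fun y => √(f y)) x :=
  (ContDiffAt.sqrt (n := ω) h.contDiffAt hx).analyticAt

/-- Second-order factorisation of an analytic phase at its critical point, in the form needed for
the stationary phase method: `Q = u²`, and `1 - u'/u'(1) = H Q'`. -/
theorem exists_morse_coordinate {Q Q' : ℝ → ℝ} {κ : ℝ} (hκ : 0 < κ)
    (hQ : ∀ t, 0 < t → AnalyticAt ℝ Q t) (hQ' : ∀ t, 0 < t → HasDerivAt Q (Q' t) t)
    (h1 : Q 1 = 0) (h1' : Q' 1 = 0) (h1'' : HasDerivAt Q' κ 1)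
    (hneg : ∀ t, 0 < t → t < 1 → Q' t < 0) (hpos : ∀ t, 1 < t → 0 < Q' t) :
    ∃ u w H H' : ℝ → ℝ, (∀ t, 0 < t → HasDerivAt u (w t) t) ∧ ContinuousOn w (Ioi 0) ∧
      (∀ t, 0 < t → HasDerivAt H (H' t) t) ∧ ContinuousOn H' (Ioi 0) ∧
      (∀ t, 0 < t → Q t = u t ^ 2) ∧ (∀ t, 0 < t → t ≤ 1 → u t ≤ 0) ∧ (∀ t, 1 ≤ t → 0 ≤ u t) ∧
      w 1 = √(κ / 2) ∧ (∀ t, 0 < t → 1 - w t / w 1 = H t * Q' t) := by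
  -- As `Q` and `Q'` vanish at `1`, two divided differences give `Q = (t-1)² q` with `q` analytic;
  -- `q(1) = κ/2` and `q > 0`.
  set q := dslope (dslope Q 1) 1 with hq
  have hqa : ∀ t, 0 < t → AnalyticAt ℝ q t := fun t ht =>
    ((hQ 1 one_pos).dslope_same (hQ 1 one_pos)).dslope_same ((hQ 1 one_pos).dslope_same (hQ t ht))
  have hd0 : dslope Q 1 1 = 0 := by rw [dslope_same, (hQ' 1 one_pos).deriv, h1']
  have hQq : ∀ t, Q t = (t - 1) ^ 2 * q t := fun t => by
    have e1 := sub_smul_dslope Q 1 t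
    have e2 := sub_smul_dslope (dslope Q 1) 1 t
    rw [h1, smul_eq_mul, sub_zero] at e1
    rw [hd0, smul_eq_mul, sub_zero] at e2
    rw [← e1, ← e2]; ring
  set q' := deriv q with hq'
  have hqd : ∀ t, 0 < t → HasDerivAt q (q' t) t := fun t ht =>
    (hqa t ht).differentiableAt.hasDerivAt
  have hq'a : ∀ t, 0 < t → AnalyticAt ℝ q' t := fun t ht => (hqa t ht).deriv
  have hQ'p : ∀ t, 0 < t → Q' t = (t - 1) * (2 * q t + (t - 1) * q' t) := fun t ht => by
    have : HasDerivAt Q (2 * (t - 1) * q t + (t - 1) ^ 2 * q' t) t := by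
      have h2 : HasDerivAt (fun t : ℝ => (t - 1) ^ 2) (2 * (t - 1)) t := by
        simpa using ((hasDerivAt_id t).sub_const 1).fun_pow 2
      exact (h2.mul (hqd t ht)).congr_of_eventuallyEq (Eventually.of_forall fun t => hQq t)
    rw [(hQ' t ht).unique this]; ring
  have hq1 : q 1 = κ / 2 := by
    have h3 : HasDerivAt (fun t : ℝ => (t - 1) * (2 * q t + (t - 1) * q' t)) (2 * q 1) 1 := by
      have e0 : HasDerivAt (fun t : ℝ => t - 1) 1 1 := (hasDerivAt_id (1 : ℝ)).sub_const 1
      have e1 := e0.mul (((hqd 1 one_pos).const_mul 2).add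
        (e0.mul (hq'a 1 one_pos).differentiableAt.hasDerivAt))
      refine e1.congr_deriv ?_
      simp
    have h4 : Q' =ᶠ[nhds 1] fun t : ℝ => (t - 1) * (2 * q t + (t - 1) * q' t) := by
      filter_upwards [isOpen_Ioi.mem_nhds (Set.mem_Ioi.2 (one_pos (α := ℝ)))] with t ht
      exact hQ'p t ht
    have := h1''.unique (h3.congr_of_eventuallyEq h4)
    linarith
  have hQpos : ∀ t, 0 < t → t ≠ 1 → 0 < Q t := fun t ht hne => by
    rcases lt_or_gt_of_ne hne with h | h
    · have := strictAntiOn_of_deriv_neg (convex_Icc t 1) (f := Q)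
        (fun x hx => (hQ' x (ht.trans_le hx.1)).continuousAt.continuousWithinAt)
        (fun x hx => by
          rw [interior_Icc] at hx
          rw [(hQ' x (ht.trans hx.1)).deriv]; exact hneg x (ht.trans hx.1) hx.2)
        ⟨le_rfl, h.le⟩ ⟨h.le, le_rfl⟩ h
      rwa [h1] at this
    · have := strictMonoOn_of_deriv_pos (convex_Icc 1 t) (f := Q)
        (fun x hx => (hQ' x (one_pos.trans_le hx.1)).continuousAt.continuousWithinAt)
        (fun x hx => by
          rw [interior_Icc] at hx
          rw [(hQ' x (one_pos.trans hx.1)).deriv]; exact hpos x hx.1)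
        ⟨le_rfl, h.le⟩ ⟨h.le, le_rfl⟩ h
      rwa [h1] at this
  have hqpos : ∀ t, 0 < t → 0 < q t := fun t ht => by
    rcases eq_or_ne t 1 with rfl | hne
    · rw [hq1]; positivity
    · have := hQpos t ht hne
      rw [hQq] at this
      exact (mul_pos_iff_of_pos_left (sq_pos_of_ne_zero (sub_ne_zero.2 hne))).1 this
  have hppos : ∀ t, 0 < t → 0 < 2 * q t + (t - 1) * q' t := fun t ht => by
    rcases lt_trichotomy t 1 with h | rfl | h
    · have := hneg t ht h
      rw [hQ'p t ht] at this
      exact pos_of_mul_neg_right this (by linarith)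
    · rw [hq1]; simpa using hκ
    · have := hpos t h
      rw [hQ'p t ht] at this
      exact (mul_pos_iff_of_pos_left (by linarith)).1 this
  -- The Morse coordinate: the square root of `Q` that carries the sign of `t - 1`.
  set u : ℝ → ℝ := fun t => (t - 1) * √(q t) with hu
  have hua : ∀ t, 0 < t → AnalyticAt ℝ u t := fun t ht =>
    (analyticAt_id.sub analyticAt_const).mul (analyticAt_sqrt (hqa t ht) (hqpos t ht).ne')
  set w := deriv u with hw
  have hwa : ∀ t, 0 < t → AnalyticAt ℝ w t := fun t ht => (hua t ht).deriv
  have hw1 : w 1 = √(κ / 2) := by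
    have e0 : HasDerivAt (fun t : ℝ => t - 1) 1 1 := (hasDerivAt_id (1 : ℝ)).sub_const 1
    have : HasDerivAt u (1 * √(q 1) + (1 - 1) * _) 1 := e0.mul (analyticAt_sqrt (hqa 1 one_pos)
      (hqpos 1 one_pos).ne').differentiableAt.hasDerivAt
    rw [← hq1, hw, this.deriv]
    ring
  have hw1pos : 0 < w 1 := by rw [hw1]; positivity
  -- Both `1 - w/w(1)` and `Q' = (t-1)(2q + (t-1)q')` vanish at `1`. Cancelling `t - 1` leaves an
  -- analytic quotient, because the second factor of `Q'` is positive.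
  set H : ℝ → ℝ := fun t => -(dslope w 1 t) / w 1 / (2 * q t + (t - 1) * q' t) with hH
  have hHa : ∀ t, 0 < t → AnalyticAt ℝ H t := fun t ht =>
    ((((hwa 1 one_pos).dslope_same (hwa t ht)).neg).div analyticAt_const hw1pos.ne').div
      ((analyticAt_const.mul (hqa t ht)).add
        ((analyticAt_id.sub analyticAt_const).mul (hq'a t ht))) (hppos t ht).ne'
  refine ⟨u, w, H, deriv H, fun t ht => (hua t ht).differentiableAt.hasDerivAt,
    fun t ht => (hwa t ht).continuousAt.continuousWithinAt,
    fun t ht => (hHa t ht).differentiableAt.hasDerivAt,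
    fun t ht => (hHa t ht).deriv.continuousAt.continuousWithinAt,
    fun t ht => ?_, fun t ht h => ?_, fun t h => ?_, hw1, fun t ht => ?_⟩
  · rw [hQq, hu, mul_pow, Real.sq_sqrt (hqpos t ht).le]
  · exact mul_nonpos_of_nonpos_of_nonneg (by linarith) (Real.sqrt_nonneg _)
  · exact mul_nonneg (by linarith) (Real.sqrt_nonneg _)
  · rw [hQ'p t ht]
    have e1 := sub_smul_dslope w 1 t
    rw [smul_eq_mul] at e1
    have := (hppos t ht).ne'
    have h2 := hw1pos.ne'
    calc 1 - w t / w 1 = -(w t - w 1) / w 1 := by field_simp; ring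
      _ = -((t - 1) * dslope w 1 t) / w 1 := by rw [e1]
      _ = _ := by simp only [hH]; field_simp

theorem norm_integral_e_sq_sub_le {U V : ℝ} (hU : U ≤ 0) (hV : 0 ≤ V) :
    ‖(∫ x in U..V, e (x ^ 2)) - e (1 / 8) / (√2 : ℝ)‖ ≤ 4 / (1 + |U|) + 4 / (1 + |V|) := by
  have hc : Continuous (fun x : ℝ => e (x ^ 2)) := continuous_e.comp (continuous_pow 2)
  have h1 : ∫ x in U..0, e (x ^ 2) = ∫ x in (0 : ℝ)..(-U), e (x ^ 2) := by
    rw [← neg_zero, ← intervalIntegral.integral_comp_neg]; simp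
  have h2 : e (1 / 8) / (√2 : ℝ)
      = e (1 / 8) / (2 * √2 : ℝ) + e (1 / 8) / (2 * √2 : ℝ) := by
    have : ((√2 : ℝ) : ℂ) ≠ 0 := by simp
    push_cast; field_simp; ring
  rw [← integral_add_adjacent_intervals (hc.intervalIntegrable U 0) (hc.intervalIntegrable 0 V),
    h1, h2, add_sub_add_comm, abs_of_nonpos hU, abs_of_nonneg hV]
  exact (norm_add_le _ _).trans
    (add_le_add (norm_fresnel_sub_le (neg_nonneg.2 hU)) (norm_fresnel_sub_le hV))

/-- Stationary phase with explicit dependence on the end points. -/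
theorem exists_stationary_phase {Q Q' : ℝ → ℝ} {κ : ℝ} (hκ : 0 < κ)
    (hQ : ∀ t, 0 < t → AnalyticAt ℝ Q t) (hQ' : ∀ t, 0 < t → HasDerivAt Q (Q' t) t)
    (h1 : Q 1 = 0) (h1' : Q' 1 = 0) (h1'' : HasDerivAt Q' κ 1)
    (hneg : ∀ t, 0 < t → t < 1 → Q' t < 0) (hpos : ∀ t, 1 < t → 0 < Q' t) :
    ∃ C : ℝ, 0 < C ∧ ∀ T a b : ℝ, 0 < T → 1 / 2 ≤ a → a ≤ 1 → 1 ≤ b → b ≤ 2 →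
      ‖(∫ t in a..b, e (T * Q t)) - e (1 / 8) / (√(κ * T) : ℝ)‖
        ≤ C * (1 / T + 1 / (√T + T * |Q' a|) + 1 / (√T + T * |Q' b|)) := by
  obtain ⟨u, w, H, H', hu, hw, hH, hH', hQu, hu0, hu1, hw1, hG⟩ :=
    exists_morse_coordinate hκ hQ hQ' h1 h1' h1'' hneg hpos
  have hw1pos : 0 < w 1 := by rw [hw1]; positivity
  have hsub : Icc (1 / 2 : ℝ) 2 ⊆ Ioi 0 := fun x hx => lt_of_lt_of_le (by norm_num) hx.1
  have hHc : ContinuousOn H (Ioi 0) := fun t ht => (hH t ht).continuousAt.continuousWithinAt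
  obtain ⟨B, hB⟩ := isCompact_Icc.exists_bound_of_continuousOn (hHc.mono hsub)
  obtain ⟨B', hB'⟩ := isCompact_Icc.exists_bound_of_continuousOn (hH'.mono hsub)
  obtain ⟨W, hW⟩ := isCompact_Icc.exists_bound_of_continuousOn (hw.mono hsub)
  have one_mem : (1 : ℝ) ∈ Icc (1 / 2 : ℝ) 2 := by norm_num
  have hB0 : 0 ≤ B := (norm_nonneg _).trans (hB 1 one_mem)
  have hB'0 : 0 ≤ B' := (norm_nonneg _).trans (hB' 1 one_mem)
  have hW0 : 0 ≤ W := (norm_nonneg _).trans (hW 1 one_mem)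
  -- From `Q' = 2uu'`. It turns the Fresnel end point errors, which are in terms of `√T |u|`, into
  -- terms in `T |Q'|`.
  have hQ'u : ∀ t ∈ Icc (1 / 2 : ℝ) 2, |Q' t| ≤ 2 * W * |u t| := fun t ht => by
    have ht0 := hsub ht
    have hd : HasDerivAt Q (2 * u t * w t) t := by
      have := (hu t ht0).fun_pow 2
      refine (this.congr_of_eventuallyEq ?_).congr_deriv (by simp)
      filter_upwards [isOpen_Ioi.mem_nhds ht0] with x hx using hQu x hx
    rw [(hQ' t ht0).unique hd, abs_mul, abs_mul, abs_two]
    nlinarith [hW t ht, abs_nonneg (u t), Real.norm_eq_abs (w t),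
      mul_le_mul_of_nonneg_left (hW t ht) (abs_nonneg (u t))]
  set D := 1 + 2 * W with hD
  refine ⟨(2 * B + 2 * B') + 4 * D / w 1, by positivity, fun T a b hT ha ha1 hb1 hb => ?_⟩
  have hab : a ≤ b := ha1.trans hb1
  have hs : Icc a b ⊆ Icc (1 / 2) 2 := Icc_subset_Icc ha hb
  have hs0 : Icc a b ⊆ Ioi 0 := hs.trans hsub
  have hsT : 0 < √T := Real.sqrt_pos.2 hT
  have hTT : √T ^ 2 = T := Real.sq_sqrt hT.le
  have hQc : ContinuousOn Q (Icc a b) := fun t ht =>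
    (hQ' t (hs0 ht)).continuousAt.continuousWithinAt
  have hec : ContinuousOn (fun t => e (T * Q t)) (Icc a b) :=
    continuous_e.comp_continuousOn (continuousOn_const.mul hQc)
  have huc : ContinuousOn u (Icc a b) := fun t ht => (hu t (hs0 ht)).continuousAt.continuousWithinAt
  have hwc : ContinuousOn w (Icc a b) := hw.mono hs0
  have hQ'c : ContinuousOn Q' (Icc a b) := by
    refine ContinuousOn.congr (f := fun t => 2 * u t * w t)
      ((continuousOn_const.mul huc).mul hwc) fun t ht => ?_
    have := (hu t (hs0 ht)).fun_pow 2
    refine (hQ' t (hs0 ht)).unique ((this.congr_of_eventuallyEq ?_).congr_deriv (by simp))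
    filter_upwards [isOpen_Ioi.mem_nhds (hs0 ht)] with x hx using hQu x hx
  -- the substitution
  have hsubst : ∫ t in a..b, (√T * w t) • e ((√T * u t) ^ 2)
      = ∫ v in (√T * u a)..(√T * u b), e (v ^ 2) := by
    have := integral_deriv_smul_comp (a := a) (b := b) (f := fun t => √T * u t)
      (f' := fun t => √T * w t) (g := fun v => e (v ^ 2))
      (fun t ht => (hu t (hs0 (by rwa [uIcc_of_le hab] at ht))).const_mul _)
      (by rw [uIcc_of_le hab]; exact continuousOn_const.mul hwc)
      (continuous_e.comp (continuous_pow 2))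
    simpa [Function.comp_def] using this
  have i1 : IntervalIntegrable (fun t => ((w t : ℝ) : ℂ) * e (T * Q t)) volume a b :=
    ((Complex.continuous_ofReal.comp_continuousOn hwc).mul hec).intervalIntegrable_of_Icc hab
  have i2 : IntervalIntegrable (fun t => ((H t * (T * Q' t) : ℝ) : ℂ) * e (T * Q t)) volume a b :=
    ((Complex.continuous_ofReal.comp_continuousOn ((hHc.mono hs0).mul
      (continuousOn_const.mul hQ'c))).mul hec).intervalIntegrable_of_Icc hab
  have hsubst' : ∫ t in a..b, (√T * w t) • e ((√T * u t) ^ 2)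
      = (√T : ℂ) * ∫ t in a..b, ((w t : ℝ) : ℂ) * e (T * Q t) := by
    rw [← intervalIntegral.integral_const_mul]
    refine integral_congr fun t ht => ?_
    rw [uIcc_of_le hab] at ht
    simp only [Complex.real_smul]
    rw [mul_pow, hTT, ← hQu t (hs0 ht)]; push_cast; ring
  -- Split `1 = w/w(1) + H Q'`. The first part is a Fresnel integral after `v = √T u`; the second
  -- contains the derivative of the phase, and integration by parts gains `1/T`.
  have hsplit : ∫ t in a..b, e (T * Q t)
      = (w 1 : ℂ)⁻¹ * (∫ t in a..b, ((w t : ℝ) : ℂ) * e (T * Q t))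
        + (T : ℂ)⁻¹ * ∫ t in a..b, ((H t * (T * Q' t) : ℝ) : ℂ) * e (T * Q t) := by
    rw [← intervalIntegral.integral_const_mul, ← intervalIntegral.integral_const_mul,
      ← integral_add (i1.const_mul _) (i2.const_mul _)]
    refine integral_congr fun t ht => ?_
    rw [uIcc_of_le hab] at ht
    have h3 := hG t (hs0 ht)
    have h4 : H t * (T * Q' t) = T * (1 - w t / w 1) := by rw [h3]; ring
    have h5 : (w 1 : ℂ) ≠ 0 := by exact_mod_cast hw1pos.ne'
    have h6 : (T : ℂ) ≠ 0 := by exact_mod_cast hT.ne'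
    simp only [h4]
    push_cast
    field_simp
    ring
  have hrem : ‖∫ t in a..b, ((H t * (T * Q' t) : ℝ) : ℂ) * e (T * Q t)‖ ≤ 2 * B + 2 * B' := by
    have h := norm_integral_mul_deriv_mul_e_le hab (F := fun t => T * Q t)
      (F' := fun t => T * Q' t) (g := H) (g' := H')
      (fun t ht => (hQ' t (hs0 ht)).const_mul T) (continuousOn_const.mul hQ'c)
      (fun t ht => hH t (hs0 ht)) (hH'.mono hs0)
    have h2 : ∫ t in a..b, |H' t| ≤ B' * |b - a| := by
      refine (le_abs_self _).trans ?_
      rw [← Real.norm_eq_abs]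
      refine intervalIntegral.norm_integral_le_of_norm_le_const fun t ht => ?_
      rw [uIoc_of_le hab] at ht
      rw [Real.norm_eq_abs, abs_abs]
      exact hB' t (hs (Ioc_subset_Icc_self ht))
    rw [abs_of_nonneg (by linarith)] at h2
    refine h.trans ?_
    rw [div_le_iff₀ (by positivity)]
    have h3 := hB a (hs ⟨le_rfl, hab⟩)
    have h4 := hB b (hs ⟨hab, le_rfl⟩)
    rw [Real.norm_eq_abs] at h3 h4
    have h5 : B' * (b - a) ≤ B' * 2 := by gcongr; linarith
    nlinarith [Real.pi_gt_three, mul_nonneg hB0 Real.pi_pos.le, mul_nonneg hB'0 Real.pi_pos.le]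
  have hend : ∀ t ∈ Icc (1 / 2 : ℝ) 2,
      (√T)⁻¹ * (4 / (1 + |√T * u t|)) ≤ 4 * D * (1 / (√T + T * |Q' t|)) := fun t ht => by
    have h3 := hQ'u t ht
    rw [abs_mul, abs_of_pos hsT]
    have h4 : (√T)⁻¹ * (4 / (1 + √T * |u t|)) = 4 / (√T + T * |u t|) := by
      have : 1 + √T * |u t| ≠ 0 := by positivity
      rw [← hTT]
      simp only [Real.sqrt_sq hsT.le]
      field_simp
    rw [h4, mul_one_div, div_le_div_iff₀ (by positivity) (by positivity)]
    have h5 : T * |Q' t| ≤ T * (2 * W * |u t|) := by gcongr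
    have h6 : 0 ≤ T * |u t| := by positivity
    rw [hD]
    nlinarith [mul_nonneg hW0 hsT.le]
  have hua : √T * u a ≤ 0 :=
    mul_nonpos_of_nonneg_of_nonpos hsT.le (hu0 a (by linarith) ha1)
  have hub : 0 ≤ √T * u b := mul_nonneg hsT.le (hu1 b hb1)
  have hfr := norm_integral_e_sq_sub_le hua hub
  rw [← hsubst, hsubst'] at hfr
  set I1 := ∫ t in a..b, ((w t : ℝ) : ℂ) * e (T * Q t)
  set I2 := ∫ t in a..b, ((H t * (T * Q' t) : ℝ) : ℂ) * e (T * Q t)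
  have hmain : e (1 / 8) / (√(κ * T) : ℝ)
      = (w 1 : ℂ)⁻¹ * ((√T : ℂ)⁻¹ * (e (1 / 8) / (√2 : ℝ))) := by
    have : √(κ * T) = w 1 * (√T * √2) := by
      rw [hw1, ← Real.sqrt_mul hT.le, ← Real.sqrt_mul (by positivity)]
      congr 1; ring
    rw [this]; push_cast
    rw [div_eq_mul_inv, div_eq_mul_inv, mul_inv, mul_inv]; ring
  have hsT' : (√T : ℂ) ≠ 0 := by exact_mod_cast hsT.ne'
  have hdiff : (∫ t in a..b, e (T * Q t)) - e (1 / 8) / (√(κ * T) : ℝ)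
      = (w 1 : ℂ)⁻¹ * ((√T : ℂ)⁻¹ * ((√T : ℂ) * I1 - e (1 / 8) / (√2 : ℝ))) + (T : ℂ)⁻¹ * I2 := by
    rw [hsplit, hmain]; field_simp; ring
  rw [hdiff]
  refine (norm_add_le _ _).trans ?_
  rw [norm_mul, norm_mul, norm_mul, norm_inv, norm_inv, norm_inv, Complex.norm_real,
    Complex.norm_real, Complex.norm_real, Real.norm_of_nonneg hw1pos.le, Real.norm_of_nonneg hsT.le,
    Real.norm_of_nonneg hT.le]
  have ha2 := hend a ⟨ha, by linarith⟩
  have hb2 := hend b ⟨by linarith, hb⟩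
  set Ea := 1 / (√T + T * |Q' a|)
  set Eb := 1 / (√T + T * |Q' b|)
  have hEa : 0 ≤ Ea := by positivity
  have hEb : 0 ≤ Eb := by positivity
  have p1 : (w 1)⁻¹ * ((√T)⁻¹ * ‖(√T : ℂ) * I1 - e (1 / 8) / (√2 : ℝ)‖)
      ≤ (w 1)⁻¹ * (4 * D * Ea + 4 * D * Eb) := by
    gcongr
    refine (mul_le_mul_of_nonneg_left hfr (inv_nonneg.2 hsT.le)).trans ?_
    rw [mul_add]; linarith
  have p2 : T⁻¹ * ‖I2‖ ≤ T⁻¹ * (2 * B + 2 * B') := by gcongr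
  refine (add_le_add p1 p2).trans ?_
  rw [one_div]
  have q1 : 0 ≤ (2 * B + 2 * B') * (Ea + Eb) := by positivity
  have q2 : 0 ≤ 4 * D / w 1 * T⁻¹ := by positivity
  have q3 : (w 1)⁻¹ * (4 * D * Ea + 4 * D * Eb) = 4 * D / w 1 * (Ea + Eb) := by
    rw [div_eq_mul_inv]; ring
  rw [q3]; linarith

end DyadicTransform

/-! ### Truncated Poisson summation from the Fourier series of the sawtooth. -/

namespace DyadicTransform

open MeasureTheory Set intervalIntegral

/-- The remainder of the Fourier expansion of the sawtooth function `1/2 - {t}`. -/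
noncomputable def sawRem (M : ℕ) (t : ℝ) : ℝ :=
  1 / 2 - Int.fract t
    - ∑ m ∈ Finset.range M, Real.sin (2 * Real.pi * (m + 1) * t) / (Real.pi * (m + 1))

/-- The remainder of the Fourier expansion of the periodic quadratic Bernoulli function. -/
noncomputable def bernRem (M : ℕ) (t : ℝ) : ℝ :=
  (Int.fract t ^ 2 - Int.fract t + 6⁻¹) / 2
    - ∑ m ∈ Finset.range M, Real.cos (2 * Real.pi * (m + 1) * t) / (2 * Real.pi ^ 2 * (m + 1) ^ 2)

theorem hasDerivAt_fract {t : ℝ} (ht : t ∉ range ((↑) : ℤ → ℝ)) : HasDerivAt Int.fract 1 t := by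
  have h1 : (⌊t⌋ : ℝ) < t := lt_of_le_of_ne (Int.floor_le t) fun h => ht ⟨_, h⟩
  have h2 : Int.fract =ᶠ[nhds t] fun y => y - ⌊t⌋ := by
    filter_upwards [Ioo_mem_nhds h1 (Int.lt_floor_add_one t)] with y hy
    have : ⌊y⌋ = ⌊t⌋ := Int.floor_eq_iff.2 ⟨hy.1.le, hy.2⟩
    rw [Int.fract, this]
  exact ((hasDerivAt_id t).sub_const _).congr_of_eventuallyEq h2

/-- The integers, where the derivative fails, form a countable set. As `bernRem` is continuous, they
do not affect integration by parts. -/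
theorem hasDerivAt_bernRem (M : ℕ) {t : ℝ} (ht : t ∉ range ((↑) : ℤ → ℝ)) :
    HasDerivAt (bernRem M) (-sawRem M t) t := by
  have h1 := hasDerivAt_fract ht
  have h2 : HasDerivAt (fun t => (Int.fract t ^ 2 - Int.fract t + 6⁻¹) / 2)
      (Int.fract t - 1 / 2) t := by
    refine ((((h1.fun_pow 2).sub h1).add_const _).div_const 2).congr_deriv ?_
    simp; ring
  have h3 : ∀ m ∈ Finset.range M, HasDerivAt
      (fun t : ℝ => Real.cos (2 * Real.pi * (m + 1) * t) / (2 * Real.pi ^ 2 * ((m : ℝ) + 1) ^ 2))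
      (-(Real.sin (2 * Real.pi * (m + 1) * t) / (Real.pi * (m + 1)))) t := fun m _ => by
    have h4 : HasDerivAt (fun t : ℝ => 2 * Real.pi * ((m : ℝ) + 1) * t)
        (2 * Real.pi * (m + 1)) t := by
      simpa using (hasDerivAt_id t).const_mul (2 * Real.pi * ((m : ℝ) + 1))
    refine (h4.cos.div_const _).congr_deriv ?_
    have := Real.pi_pos.ne'
    have : (m : ℝ) + 1 ≠ 0 := by positivity
    field_simp
  refine (h2.sub (HasDerivAt.fun_sum h3)).congr_deriv ?_
  rw [sawRem, Finset.sum_neg_distrib]; ring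

theorem continuous_bernRem (M : ℕ) : Continuous (bernRem M) := by
  have h1 : Continuous fun t : ℝ => (Int.fract t ^ 2 - Int.fract t + 6⁻¹) / 2 := by
    have := ContinuousOn.comp_fract'' (α := ℝ) (f := fun x : ℝ => (x ^ 2 - x + 6⁻¹) / 2)
      (by fun_prop) (by norm_num)
    exact this
  unfold bernRem
  fun_prop

/-- The cosine series of the quadratic Bernoulli function converges absolutely, so its remainder is
bounded by a tail of `∑ 1/(2π²m²)`, uniformly in `t`. -/
theorem abs_bernRem_le (M : ℕ) (t : ℝ) :
    |bernRem M t| ≤ ∑' m : ℕ, 1 / (2 * Real.pi ^ 2 * (((m + M : ℕ) : ℝ) + 1) ^ 2) := by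
  have hpi := Real.pi_pos
  have hx : Int.fract t ∈ Icc (0 : ℝ) 1 := ⟨Int.fract_nonneg t, (Int.fract_lt_one t).le⟩
  have h := hasSum_one_div_nat_pow_mul_cos one_ne_zero hx
  have hB : (Polynomial.map (algebraMap ℚ ℝ) (Polynomial.bernoulli (2 * 1))).eval (Int.fract t)
      = Int.fract t ^ 2 - Int.fract t + 6⁻¹ := bernoulliFun_two _
  rw [hB] at h
  have h2 := (hasSum_nat_add_iff' 1).2 h
  have hs : HasSum (fun m : ℕ => Real.cos (2 * Real.pi * (m + 1) * t)
      / (2 * Real.pi ^ 2 * ((m : ℝ) + 1) ^ 2)) ((Int.fract t ^ 2 - Int.fract t + 6⁻¹) / 2) := by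
    have h3 := h2.div_const (2 * Real.pi ^ 2)
    convert! h3 using 1
    · funext m
      have : Real.cos (2 * Real.pi * ((m + 1 : ℕ) : ℝ) * Int.fract t)
          = Real.cos (2 * Real.pi * (m + 1) * t) := by
        rw [← Real.cos_sub_int_mul_two_pi (2 * Real.pi * (m + 1) * t) ((m + 1) * ⌊t⌋), Int.fract]
        congr 1; push_cast; ring
      rw [this]; push_cast
      field_simp
    · simp [Nat.factorial]; field_simp
  have hsum : Summable fun m : ℕ => 1 / (2 * Real.pi ^ 2 * ((m : ℝ) + 1) ^ 2) := by
    have := ((summable_nat_add_iff 1).2 (Real.summable_one_div_nat_pow.2 one_lt_two)).mul_left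
      (1 / (2 * Real.pi ^ 2))
    refine this.congr fun m => ?_
    push_cast; rw [one_div_mul_one_div]
  have hb := (hasSum_nat_add_iff' M).2 hs
  rw [bernRem, ← hb.tsum_eq, ← Real.norm_eq_abs]
  refine tsum_of_norm_bounded ((summable_nat_add_iff M).2 hsum).hasSum fun m => ?_
  rw [norm_div, Real.norm_eq_abs, Real.norm_of_nonneg (by positivity)]
  gcongr
  exact Real.abs_cos_le_one _

theorem continuous_sawRem_add_fract (M : ℕ) : Continuous fun t => sawRem M t + Int.fract t := by
  have : (fun t => sawRem M t + Int.fract t) = fun t : ℝ => 1 / 2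
    - ∑ m ∈ Finset.range M, Real.sin (2 * Real.pi * (m + 1) * t) / (Real.pi * (m + 1)) := by
    funext t; rw [sawRem]; ring
  rw [this]; fun_prop

theorem intervalIntegrable_fract (a b : ℝ) :
    IntervalIntegrable (fun t : ℝ => Int.fract t) volume a b := by
  refine (intervalIntegrable_const (c := (1 : ℝ))).mono_fun
    (measurable_fract.aestronglyMeasurable) (Eventually.of_forall fun t => ?_)
  simp only [Real.norm_eq_abs]
  rw [abs_of_nonneg (Int.fract_nonneg t), abs_one]; exact (Int.fract_lt_one t).le

theorem intervalIntegrable_sawRem (M : ℕ) (a b : ℝ) :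
    IntervalIntegrable (sawRem M) volume a b := by
  have := ((continuous_sawRem_add_fract M).intervalIntegrable a b).sub (intervalIntegrable_fract a b)
  convert this using 1
  funext t; simp

theorem intervalIntegrable_mul_sawRem (M : ℕ) {a b : ℝ} (hab : a ≤ b) {h : ℝ → ℂ}
    (hh : ContinuousOn h (Icc a b)) :
    IntervalIntegrable (fun t => h t * sawRem M t) volume a b := by
  have h0 := intervalIntegrable_sawRem M a b
  have : IntervalIntegrable (fun t => ((sawRem M t : ℝ) : ℂ)) volume a b :=
    ⟨h0.1.ofReal, h0.2.ofReal⟩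
  exact this.continuousOn_mul (by rwa [uIcc_of_le hab])

/-- The sawtooth series does not converge uniformly, but one integration by parts replaces `sawRem`
by `bernRem`, which tends to `0` uniformly. -/
theorem tendsto_integral_mul_sawRem {a b : ℝ} (hab : a ≤ b) {h h' : ℝ → ℂ}
    (hh : ∀ x ∈ Icc a b, HasDerivAt h (h' x) x) (hh' : ContinuousOn h' (Icc a b)) :
    Tendsto (fun M : ℕ => ∫ t in a..b, h t * sawRem M t) atTop (nhds 0) := by
  have hhc : ContinuousOn h (Icc a b) := fun x hx => (hh x hx).continuousAt.continuousWithinAt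
  set τ : ℕ → ℝ := fun M => ∑' m : ℕ, 1 / (2 * Real.pi ^ 2 * (((m + M : ℕ) : ℝ) + 1) ^ 2) with hτ
  have hτ0 : Tendsto τ atTop (nhds 0) :=
    tendsto_sum_nat_add fun m : ℕ => 1 / (2 * Real.pi ^ 2 * ((m : ℝ) + 1) ^ 2)
  set A := ‖h a‖ + ‖h b‖ + ∫ t in a..b, ‖h' t‖
  have hpc : ∀ M, ContinuousOn (fun t => ((bernRem M t : ℝ) : ℂ)) (Icc a b) := fun M =>
    (Complex.continuous_ofReal.comp (continuous_bernRem M)).continuousOn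
  have key : ∀ M : ℕ, ‖∫ t in a..b, h t * sawRem M t‖ ≤ A * τ M := fun M => by
    have i1 : IntervalIntegrable (fun t => h' t * bernRem M t) volume a b :=
      (hh'.mul (hpc M)).intervalIntegrable_of_Icc hab
    have i2 : IntervalIntegrable (fun t => h t * sawRem M t) volume a b :=
      intervalIntegrable_mul_sawRem M hab hhc
    have e1 := MeasureTheory.integral_eq_of_hasDerivAt_off_countable
      (fun t => h t * (bernRem M t : ℂ))
      (fun t => h' t * bernRem M t - h t * sawRem M t) (a := a) (b := b)
      (countable_range ((↑) : ℤ → ℝ)) (by rw [uIcc_of_le hab]; exact hhc.mul (hpc M))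
      (fun x hx => by
        rw [min_eq_left hab, max_eq_right hab] at hx
        refine ((hh x (Ioo_subset_Icc_self hx.1)).mul
          ((hasDerivAt_bernRem M hx.2).ofReal_comp)).congr_deriv ?_
        push_cast; ring)
      (i1.sub i2)
    rw [integral_sub i1 i2] at e1
    have e2 : ∫ t in a..b, h t * sawRem M t
        = h a * bernRem M a - h b * bernRem M b + ∫ t in a..b, h' t * bernRem M t := by
      linear_combination -e1
    rw [e2]
    have hb := abs_bernRem_le M
    have e3 : ‖∫ t in a..b, h' t * bernRem M t‖ ≤ ∫ t in a..b, ‖h' t‖ * τ M := by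
      refine (intervalIntegral.norm_integral_le_integral_norm hab).trans ?_
      refine integral_mono_on hab (i1.norm) ?_ fun t _ => ?_
      · exact (hh'.norm.mul continuousOn_const).intervalIntegrable_of_Icc hab
      · rw [norm_mul, Complex.norm_real]
        gcongr; exact hb t
    rw [intervalIntegral.integral_mul_const] at e3
    refine (norm_add_le _ _).trans ((add_le_add (norm_sub_le _ _) e3).trans ?_)
    rw [norm_mul, norm_mul, Complex.norm_real, Complex.norm_real]
    have e4 : ‖h a‖ * ‖bernRem M a‖ ≤ ‖h a‖ * τ M := by gcongr; exact hb a
    have e5 : ‖h b‖ * ‖bernRem M b‖ ≤ ‖h b‖ * τ M := by gcongr; exact hb b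
    simp only [A]; linarith
  refine squeeze_zero_norm key ?_
  simpa using hτ0.const_mul A

/-- The sum over integers as an integral against the Dirichlet kernel. -/
theorem sum_eq_integral_dirichlet {a b : ℝ} (ha : 0 ≤ a) (hab : a ≤ b) (M : ℕ) {g g' : ℝ → ℂ}
    (hg : ∀ x ∈ Icc a b, HasDerivAt g (g' x) x) (hg' : ContinuousOn g' (Icc a b)) :
    ∑ n ∈ Finset.Ioc ⌊a⌋₊ ⌊b⌋₊, g n
      = (∫ t in a..b, g t * (1 + ∑ m ∈ Finset.range M,
          2 * Real.cos (2 * Real.pi * (m + 1) * t) : ℝ))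
        + g b * sawRem M b - g a * sawRem M a - ∫ t in a..b, g' t * sawRem M t := by
  have hgc : ContinuousOn g (Icc a b) := fun x hx => (hg x hx).continuousAt.continuousWithinAt
  have hder : ∀ x ∈ Icc a b, deriv g x = g' x := fun x hx => (hg x hx).deriv
  have habel := sum_mul_eq_sub_sub_integral_mul (fun _ => (1 : ℂ)) ha hab (f := g)
    (fun t ht => (hg t ht).differentiableAt)
    ((hg'.integrableOn_Icc).congr_fun (fun x hx => (hder x hx).symm) measurableSet_Icc)
  -- The summatory function starts at `0`, hence the `+ 1`.
  have hfl : ∀ t : ℝ, 0 ≤ t → (∑ k ∈ Finset.Icc 0 ⌊t⌋₊, (1 : ℂ)) = ((t - Int.fract t + 1 : ℝ) : ℂ) :=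
    fun t ht => by
    have : ((⌊t⌋₊ : ℕ) : ℝ) = t - Int.fract t := by
      rw [natCast_floor_eq_intCast_floor ht, Int.self_sub_fract]
    rw [← this]; simp
  rw [hfl a ha, hfl b (ha.trans hab), ← integral_of_le hab] at habel
  -- A smooth antiderivative of the Dirichlet kernel; its constant is chosen so that the counting
  -- function is `W + sawRem M`.
  set W : ℝ → ℝ := fun t => t + 1 / 2 +
    ∑ m ∈ Finset.range M, Real.sin (2 * Real.pi * (m + 1) * t) / (Real.pi * (m + 1)) with hW
  have hWs : ∀ t, t - Int.fract t + 1 = W t + sawRem M t := fun t => by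
    simp only [hW, sawRem]; ring
  have hWd : ∀ t, HasDerivAt W (1 + ∑ m ∈ Finset.range M,
      2 * Real.cos (2 * Real.pi * (m + 1) * t)) t := fun t => by
    have h3 : ∀ m ∈ Finset.range M, HasDerivAt
        (fun t : ℝ => Real.sin (2 * Real.pi * (m + 1) * t) / (Real.pi * ((m : ℝ) + 1)))
        (2 * Real.cos (2 * Real.pi * (m + 1) * t)) t := fun m _ => by
      have h4 : HasDerivAt (fun t : ℝ => 2 * Real.pi * ((m : ℝ) + 1) * t)
          (2 * Real.pi * (m + 1)) t := by
        simpa using (hasDerivAt_id t).const_mul (2 * Real.pi * ((m : ℝ) + 1))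
      refine (h4.sin.div_const _).congr_deriv ?_
      have := Real.pi_pos.ne'
      have : (m : ℝ) + 1 ≠ 0 := by positivity
      field_simp
    exact ((hasDerivAt_id t).add_const _).add (HasDerivAt.fun_sum h3)
  have hWc : Continuous W := continuous_iff_continuousAt.2 fun t => (hWd t).continuousAt
  set D : ℝ → ℝ := fun t => 1 + ∑ m ∈ Finset.range M, 2 * Real.cos (2 * Real.pi * (m + 1) * t)
  have hDc : Continuous D := by fun_prop
  have i1 : IntervalIntegrable (fun t => g t * (D t : ℂ)) volume a b :=
    (hgc.mul (Complex.continuous_ofReal.comp hDc).continuousOn).intervalIntegrable_of_Icc hab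
  have i2 : IntervalIntegrable (fun t => g' t * (W t : ℂ)) volume a b :=
    (hg'.mul (Complex.continuous_ofReal.comp hWc).continuousOn).intervalIntegrable_of_Icc hab
  have i3 : IntervalIntegrable (fun t => g' t * sawRem M t) volume a b :=
    intervalIntegrable_mul_sawRem M hab hg'
  have e1 := integral_eq_sub_of_hasDerivAt (f := fun t => g t * (W t : ℂ))
    (f' := fun t => g' t * (W t : ℂ) + g t * (D t : ℂ)) (a := a) (b := b)
    (fun t ht => (hg t (by rwa [uIcc_of_le hab] at ht)).mul ((hWd t).ofReal_comp)) (i2.add i1)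
  rw [integral_add i2 i1] at e1
  have e2 : ∫ t in a..b, deriv g t * ∑ k ∈ Finset.Icc 0 ⌊t⌋₊, (1 : ℂ)
      = (∫ t in a..b, g' t * (W t : ℂ)) + ∫ t in a..b, g' t * sawRem M t := by
    rw [← integral_add i2 i3]
    refine integral_congr fun t ht => ?_
    rw [uIcc_of_le hab] at ht
    simp only [hder t ht]
    rw [hfl t (ha.trans ht.1), hWs]; push_cast; ring
  rw [e2, hWs, hWs] at habel
  simp only [mul_one] at habel
  rw [habel, Complex.ofReal_add (W b), Complex.ofReal_add (W a)]
  linear_combination -e1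

theorem abs_sawRem_le (M : ℕ) (t : ℝ) :
    |sawRem M t| ≤ 1 / 2 + ∑ m ∈ Finset.range M, 1 / ((m : ℝ) + 1) := by
  rw [sawRem]
  refine (abs_sub _ _).trans (add_le_add ?_ ((Finset.abs_sum_le_sum_abs _ _).trans
    (Finset.sum_le_sum fun m _ => ?_)))
  · rw [abs_le]; constructor <;> linarith [Int.fract_nonneg t, (Int.fract_lt_one t).le]
  · rw [abs_div, abs_of_pos (by positivity : 0 < Real.pi * ((m : ℝ) + 1))]
    have : (m : ℝ) + 1 ≤ Real.pi * (m + 1) := by nlinarith [Real.pi_gt_three]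
    gcongr
    exact Real.abs_sin_le_one _

/-- Truncated Poisson summation. -/
theorem norm_sum_e_sub_poisson_le {a b D : ℝ} (ha : 0 ≤ a) (hab : a ≤ b) (hD : 0 < D) {M : ℕ}
    (hM : 2 * D ≤ M) {φ φ' φ'' : ℝ → ℝ}
    (hφ : ∀ x ∈ Icc a b, HasDerivAt φ (φ' x) x) (hφ' : ∀ x ∈ Icc a b, HasDerivAt φ' (φ'' x) x)
    (hφ'' : ContinuousOn φ'' (Icc a b))
    (hs : (∀ x ∈ Icc a b, 0 ≤ φ'' x) ∨ (∀ x ∈ Icc a b, φ'' x ≤ 0))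
    (h0 : ∀ x ∈ Icc a b, 0 ≤ φ' x) (hDφ : ∀ x ∈ Icc a b, φ' x ≤ D) :
    ‖(∑ n ∈ Finset.Ioc ⌊a⌋₊ ⌊b⌋₊, e (φ n)) - ((∫ x in a..b, e (φ x))
        + ∑ m ∈ Finset.range M, ((∫ x in a..b, e (φ x - (m + 1) * x))
          + ∫ x in a..b, e (φ x + (m + 1) * x)))‖
      ≤ 3 + 2 * ∑ m ∈ Finset.range M, 1 / ((m : ℝ) + 1) := by
  have hφc : ContinuousOn φ (Icc a b) := fun x hx => (hφ x hx).continuousAt.continuousWithinAt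
  have hφ'c : ContinuousOn φ' (Icc a b) := fun x hx => (hφ' x hx).continuousAt.continuousWithinAt
  set g : ℝ → ℂ := fun x => e (φ x) with hgdef
  set g' : ℝ → ℂ := fun x => 2 * Real.pi * Complex.I * φ' x * e (φ x) with hg'def
  have hg : ∀ x ∈ Icc a b, HasDerivAt g (g' x) x := fun x hx => hasDerivAt_e_comp (hφ x hx)
  have hgc : ContinuousOn g (Icc a b) := continuous_e.comp_continuousOn hφc
  have hφ'C : ContinuousOn (fun x => (φ' x : ℂ)) (Icc a b) :=
    Complex.continuous_ofReal.comp_continuousOn hφ'c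
  have hφ''C : ContinuousOn (fun x => (φ'' x : ℂ)) (Icc a b) :=
    Complex.continuous_ofReal.comp_continuousOn hφ''
  have hg'c : ContinuousOn g' (Icc a b) := (continuousOn_const.mul hφ'C).mul hgc
  have hg'' : ∀ x ∈ Icc a b, HasDerivAt g'
      (2 * Real.pi * Complex.I * φ'' x * e (φ x) + 2 * Real.pi * Complex.I * φ' x * g' x) x :=
    fun x hx => (((hφ' x hx).ofReal_comp).const_mul _).mul (hg x hx)
  have hg''c : ContinuousOn (fun x => 2 * Real.pi * Complex.I * φ'' x * e (φ x)
      + 2 * Real.pi * Complex.I * φ' x * g' x) (Icc a b) :=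
    ((continuousOn_const.mul hφ''C).mul hgc).add ((continuousOn_const.mul hφ'C).mul hg'c)
  have hiE : ∀ c : ℝ, IntervalIntegrable (fun x => e (φ x + c * x)) volume a b := fun c =>
    (continuous_e.comp_continuousOn
      (hφc.add (continuous_const.mul continuous_id).continuousOn)).intervalIntegrable_of_Icc hab
  have hcos : ∀ (m : ℕ) (x : ℝ), ((2 * Real.cos (2 * Real.pi * (m + 1) * x) : ℝ) : ℂ)
      = e (-((m + 1) * x)) + e ((m + 1) * x) := fun m x => by
    rw [e, e]; push_cast
    rw [Complex.two_cos, add_comm]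
    congr 2 <;> ring
  have hdir : ∫ t in a..b, g t * (1 + ∑ m ∈ Finset.range M,
          2 * Real.cos (2 * Real.pi * (m + 1) * t) : ℝ)
      = (∫ x in a..b, e (φ x))
        + ∑ m ∈ Finset.range M, ((∫ x in a..b, e (φ x - (m + 1) * x))
          + ∫ x in a..b, e (φ x + (m + 1) * x)) := by
    have i0 : IntervalIntegrable (fun x => e (φ x)) volume a b := by simpa using hiE 0
    have ip : ∀ m : ℕ, IntervalIntegrable (fun x => e (φ x + (m + 1) * x)) volume a b :=
      fun m => hiE _
    have im : ∀ m : ℕ, IntervalIntegrable (fun x => e (φ x - (m + 1) * x)) volume a b :=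
      fun m => by simp only [sub_eq_add_neg, ← neg_mul]; exact hiE _
    have isum : IntervalIntegrable (fun x => ∑ m ∈ Finset.range M,
        (e (φ x - (m + 1) * x) + e (φ x + (m + 1) * x))) volume a b := by
      convert! IntervalIntegrable.sum (Finset.range M)
        (f := fun (m : ℕ) x => e (φ x - (m + 1) * x) + e (φ x + (m + 1) * x))
        fun m _ => (im m).add (ip m) using 1
      funext x; simp
    have : ∀ m ∈ Finset.range M, (∫ x in a..b, e (φ x - (m + 1) * x))
          + ∫ x in a..b, e (φ x + (m + 1) * x)
        = ∫ x in a..b, (e (φ x - (m + 1) * x) + e (φ x + (m + 1) * x)) := fun m _ =>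
      (integral_add (im m) (ip m)).symm
    rw [Finset.sum_congr rfl this, ← integral_finsetSum fun m _ => (im m).add (ip m),
      ← integral_add i0 isum]
    refine integral_congr fun x _ => ?_
    simp only [hgdef]
    rw [Complex.ofReal_add, Complex.ofReal_sum, mul_add, Complex.ofReal_one, mul_one,
      Finset.mul_sum]
    congr 1
    refine Finset.sum_congr rfl fun m _ => ?_
    rw [hcos, mul_add, ← e_add, ← e_add, sub_eq_add_neg]
  have hmain := sum_eq_integral_dirichlet ha hab M hg hg'c
  rw [hdir] at hmain
  -- the individual frequencies beyond `M`
  have hfreq : ∀ m : ℕ, M ≤ m →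
      ‖∫ t in a..b, g' t * (Real.sin (2 * Real.pi * (m + 1) * t) / (Real.pi * (m + 1)) : ℝ)‖
        ≤ 3 * D / ((m : ℝ) + 1) ^ 2 := fun m hm => by
    set j : ℝ := (m : ℝ) + 1 with hj
    have hjM : 2 * D ≤ j := by
      have : (M : ℝ) ≤ m := by exact_mod_cast hm
      linarith
    have hj0 : 0 < j := by linarith
    have hnem : ∀ x ∈ Icc a b, φ' x - j < 0 := fun x hx => by linarith [hDφ x hx]
    have hnep : ∀ x ∈ Icc a b, 0 < φ' x + j := fun x hx => by linarith [h0 x hx]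
    -- The function `φ'/(φ' - j)` has derivative `-jφ''/(φ' - j)²`, of constant sign. As `j ≥ 2D`,
    -- also `|φ' - j| ≥ j/2`, whence the bound `2D/j`.
    have bm := norm_integral_mul_deriv_mul_e_le_of_monotone (B := 2 * D / j) hab
      (F := fun x => φ x - j * x) (F' := fun x => φ' x - j)
      (g := fun x => φ' x / (φ' x - j))
      (g' := fun x => (φ'' x * (φ' x - j) - φ' x * φ'' x) / (φ' x - j) ^ 2)
      (fun x hx => by
        simpa using (hφ x hx).fun_sub ((hasDerivAt_id x).const_mul j))
      (hφ'c.sub continuousOn_const)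
      (fun x hx => (hφ' x hx).fun_div ((hφ' x hx).sub_const j) (hnem x hx).ne)
      (((hφ''.mul (hφ'c.sub continuousOn_const)).sub (hφ'c.mul hφ'')).div
        ((hφ'c.sub continuousOn_const).pow 2) fun x hx => pow_ne_zero 2 (hnem x hx).ne)
      (by
        rcases hs with hs | hs
        · right; intro x hx
          refine div_nonpos_of_nonpos_of_nonneg ?_ (sq_nonneg _)
          nlinarith [hs x hx]
        · left; intro x hx
          refine div_nonneg ?_ (sq_nonneg _)
          nlinarith [hs x hx])
      (by
        rw [abs_div, abs_of_nonneg (h0 a ⟨le_rfl, hab⟩), abs_of_neg (hnem a ⟨le_rfl, hab⟩),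
          div_le_div_iff₀ (by linarith [hnem a ⟨le_rfl, hab⟩]) hj0]
        nlinarith [hDφ a ⟨le_rfl, hab⟩, h0 a ⟨le_rfl, hab⟩])
      (by
        rw [abs_div, abs_of_nonneg (h0 b ⟨hab, le_rfl⟩), abs_of_neg (hnem b ⟨hab, le_rfl⟩),
          div_le_div_iff₀ (by linarith [hnem b ⟨hab, le_rfl⟩]) hj0]
        nlinarith [hDφ b ⟨hab, le_rfl⟩, h0 b ⟨hab, le_rfl⟩])
    have bp := norm_integral_mul_deriv_mul_e_le_of_monotone (B := D / j) hab
      (F := fun x => φ x + j * x) (F' := fun x => φ' x + j)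
      (g := fun x => φ' x / (φ' x + j))
      (g' := fun x => (φ'' x * (φ' x + j) - φ' x * φ'' x) / (φ' x + j) ^ 2)
      (fun x hx => by
        simpa using (hφ x hx).fun_add ((hasDerivAt_id x).const_mul j))
      (hφ'c.add continuousOn_const)
      (fun x hx => (hφ' x hx).fun_div ((hφ' x hx).add_const j) (hnep x hx).ne')
      (((hφ''.mul (hφ'c.add continuousOn_const)).sub (hφ'c.mul hφ'')).div
        ((hφ'c.add continuousOn_const).pow 2) fun x hx => pow_ne_zero 2 (hnep x hx).ne')
      (by
        rcases hs with hs | hs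
        · left; intro x hx
          refine div_nonneg ?_ (sq_nonneg _)
          nlinarith [hs x hx]
        · right; intro x hx
          refine div_nonpos_of_nonpos_of_nonneg ?_ (sq_nonneg _)
          nlinarith [hs x hx])
      (by
        rw [abs_div, abs_of_nonneg (h0 a ⟨le_rfl, hab⟩), abs_of_pos (hnep a ⟨le_rfl, hab⟩),
          div_le_div_iff₀ (hnep a ⟨le_rfl, hab⟩) hj0]
        nlinarith [hDφ a ⟨le_rfl, hab⟩, h0 a ⟨le_rfl, hab⟩])
      (by
        rw [abs_div, abs_of_nonneg (h0 b ⟨hab, le_rfl⟩), abs_of_pos (hnep b ⟨hab, le_rfl⟩),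
          div_le_div_iff₀ (hnep b ⟨hab, le_rfl⟩) hj0]
        nlinarith [hDφ b ⟨hab, le_rfl⟩, h0 b ⟨hab, le_rfl⟩])
    have hicE : ∀ c : ℝ, IntervalIntegrable (fun x => (φ' x : ℂ) * e (φ x + c * x)) volume a b :=
      fun c => (hφ'C.mul (continuous_e.comp_continuousOn
        (hφc.add (continuous_const.mul continuous_id).continuousOn))).intervalIntegrable_of_Icc hab
    have i2 : IntervalIntegrable (fun x => (φ' x : ℂ) * e (φ x - j * x)) volume a b := by
      simpa [← sub_eq_add_neg, neg_mul] using hicE (-j)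
    have hsplit : ∫ t in a..b, g' t * (Real.sin (2 * Real.pi * j * t) / (Real.pi * j) : ℝ)
        = (j : ℂ)⁻¹ * ((∫ x in a..b, (φ' x : ℂ) * e (φ x + j * x))
          - ∫ x in a..b, (φ' x : ℂ) * e (φ x - j * x)) := by
      rw [← integral_sub (hicE j) i2, ← intervalIntegral.integral_const_mul]
      refine integral_congr fun x _ => ?_
      simp only [hg'def]
      rw [sub_eq_add_neg (φ x), e_add, e_add (φ x)]
      have h1 : ((Real.sin (2 * Real.pi * j * x) : ℝ) : ℂ)
          = (e (j * x) - e (-(j * x))) / (2 * Complex.I) := by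
        have h2 := Complex.two_sin (2 * Real.pi * j * x : ℝ)
        have hm : e (-(j * x)) = Complex.exp (-((2 * Real.pi * j * x : ℝ) : ℂ) * Complex.I) := by
          rw [e]; congr 1; push_cast; ring
        have hp : e (j * x) = Complex.exp (((2 * Real.pi * j * x : ℝ) : ℂ) * Complex.I) := by
          rw [e]; congr 1; push_cast; ring
        rw [← hm, ← hp] at h2
        rw [Complex.ofReal_sin, eq_div_iff (by simp)]
        linear_combination Complex.I * h2 + (e (-(j * x)) - e (j * x)) * Complex.I_sq
      rw [Complex.ofReal_div, h1]
      have hpi : (Real.pi : ℂ) ≠ 0 := by exact_mod_cast Real.pi_ne_zero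
      have hjc : (j : ℂ) ≠ 0 := by exact_mod_cast hj0.ne'
      have hI := Complex.I_ne_zero
      push_cast
      field_simp
    rw [hsplit, norm_mul, norm_inv, Complex.norm_real, Real.norm_of_nonneg hj0.le]
    have bm' : ‖∫ x in a..b, (φ' x : ℂ) * e (φ x - j * x)‖ ≤ 2 * D / j := by
      convert bm using 2
      refine integral_congr fun x hx => ?_
      rw [uIcc_of_le hab] at hx
      simp only [div_mul_cancel₀ _ (hnem x hx).ne]
    have bp' : ‖∫ x in a..b, (φ' x : ℂ) * e (φ x + j * x)‖ ≤ D / j := by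
      convert bp using 2
      refine integral_congr fun x hx => ?_
      rw [uIcc_of_le hab] at hx
      simp only [div_mul_cancel₀ _ (hnep x hx).ne']
    calc _ ≤ j⁻¹ * (D / j + 2 * D / j) := by
          gcongr; exact (norm_sub_le _ _).trans (add_le_add bp' bm')
      _ = _ := by field_simp; ring
  set I : ℕ → ℂ := fun M => ∫ t in a..b, g' t * sawRem M t with hI
  have hiS : ∀ M, IntervalIntegrable (fun t => g' t * sawRem M t) volume a b :=
    fun M => intervalIntegrable_mul_sawRem M hab hg'c
  have hstep : ∀ m, I m = I (m + 1)
      + ∫ t in a..b, g' t * (Real.sin (2 * Real.pi * (m + 1) * t) / (Real.pi * (m + 1)) : ℝ) :=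
    fun m => by
    simp only [hI]
    rw [← integral_add (hiS _)]
    · refine integral_congr fun t _ => ?_
      simp only [sawRem]
      rw [Finset.sum_range_succ]; push_cast; ring
    · refine (hg'c.mul ?_).intervalIntegrable_of_Icc hab
      exact (Complex.continuous_ofReal.comp (by fun_prop)).continuousOn
  have hM0 : (0 : ℝ) < M := by linarith
  -- Telescoping with `1/(y+1)² ≤ 1/y - 1/(y+1)`. Since `I (M + k) → 0`, letting `k → ∞` leaves
  -- `3D/M ≤ 3/2`.
  have htel : ∀ k : ℕ, ‖I M‖ ≤ ‖I (M + k)‖ + 3 * D * (1 / (M : ℝ) - 1 / ((M + k : ℕ) : ℝ)) := by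
    intro k
    induction k with
    | zero => simp
    | succ k ih =>
      refine ih.trans ?_
      have h1 := congrArg norm (hstep (M + k))
      have h2 := (norm_add_le _ _).trans (add_le_add_right (hfreq (M + k) (by omega)) ‖I (M + k + 1)‖)
      rw [← h1] at h2
      have hk : (0 : ℝ) < ((M + k : ℕ) : ℝ) := by push_cast; positivity
      have h3 : 3 * D / (((M + k : ℕ) : ℝ) + 1) ^ 2
          ≤ 3 * D * (1 / ((M + k : ℕ) : ℝ) - 1 / ((M + (k + 1) : ℕ) : ℝ)) := by
        have : ((M + (k + 1) : ℕ) : ℝ) = ((M + k : ℕ) : ℝ) + 1 := by push_cast; ring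
        rw [this]
        set y := ((M + k : ℕ) : ℝ)
        have : 1 / y - 1 / (y + 1) = 1 / (y * (y + 1)) := by field_simp; ring
        rw [this, mul_one_div]
        gcongr
        nlinarith
      have : M + k + 1 = M + (k + 1) := by ring
      rw [this] at h2
      linarith
  have hlim : ‖I M‖ ≤ 3 / 2 := by
    have h1 : Tendsto (fun k => ‖I (M + k)‖ + 3 / 2) atTop (nhds (0 + 3 / 2)) := by
      refine Tendsto.add_const _ ?_
      have := (tendsto_integral_mul_sawRem hab hg'' hg''c).norm
      rw [norm_zero] at this
      have h2 := this.comp (tendsto_add_atTop_nat M)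
      simpa [add_comm, Function.comp_def] using h2
    rw [zero_add] at h1
    refine ge_of_tendsto h1 (Eventually.of_forall fun k => (htel k).trans ?_)
    have : 3 * D * (1 / (M : ℝ) - 1 / ((M + k : ℕ) : ℝ)) ≤ 3 * D * (1 / (M : ℝ)) := by
      gcongr; simp only [sub_le_self_iff]; positivity
    have h3 : 3 * D * (1 / (M : ℝ)) ≤ 3 / 2 := by
      rw [mul_one_div, div_le_iff₀ hM0]; linarith
    linarith
  have hna : ‖g a * sawRem M a‖ ≤ 1 / 2 + ∑ m ∈ Finset.range M, 1 / ((m : ℝ) + 1) := by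
    rw [norm_mul, norm_e, one_mul, Complex.norm_real]; exact abs_sawRem_le M a
  have hnb : ‖g b * sawRem M b‖ ≤ 1 / 2 + ∑ m ∈ Finset.range M, 1 / ((m : ℝ) + 1) := by
    rw [norm_mul, norm_e, one_mul, Complex.norm_real]; exact abs_sawRem_le M b
  have hfin : (∑ n ∈ Finset.Ioc ⌊a⌋₊ ⌊b⌋₊, e (φ n)) - ((∫ x in a..b, e (φ x))
        + ∑ m ∈ Finset.range M, ((∫ x in a..b, e (φ x - (m + 1) * x))
          + ∫ x in a..b, e (φ x + (m + 1) * x))) = g b * sawRem M b - g a * sawRem M a - I M := by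
    simp only [hI]
    linear_combination hmain
  rw [hfin]
  refine (norm_sub_le _ _).trans ((add_le_add (norm_sub_le _ _) hlim).trans ?_)
  linarith

end DyadicTransform

/-! ### Power phases `A x^β - m x`, with and without a stationary point. -/

namespace DyadicTransform

open MeasureTheory Set intervalIntegral

/-- Conjugation changes the sign of the phase, so the tests for `F'' ≥ 0` serve `β < 1` and `β > 1`
alike. -/
theorem norm_integral_e_sign {a b s : ℝ} (hs : s = 1 ∨ s = -1) (F : ℝ → ℝ) :
    ‖∫ x in a..b, e (s * F x)‖ = ‖∫ x in a..b, e (F x)‖ := by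
  rcases hs with rfl | rfl
  · simp
  · simp only [neg_mul, one_mul]
    rw [norm_integral_e_neg, RCLike.norm_conj]

theorem norm_integral_e_sign_sub {a b s r : ℝ} (hs : s = 1 ∨ s = -1) (F : ℝ → ℝ) :
    ‖(∫ x in a..b, e (s * F x)) - e (s / 8) / (r : ℝ)‖
      = ‖(∫ x in a..b, e (F x)) - e (1 / 8) / (r : ℝ)‖ := by
  rcases hs with rfl | rfl
  · simp
  · simp only [neg_mul, one_mul]
    rw [norm_integral_e_neg, ← RCLike.norm_conj, map_sub, Complex.conj_conj, map_div₀, conj_e,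
      Complex.conj_ofReal]
    congr 4; ring

theorem exists_sign {x : ℝ} (hx : x ≠ 0) : ∃ s : ℝ, (s = 1 ∨ s = -1) ∧ s * x = |x| := by
  rcases lt_or_gt_of_ne hx with h | h
  · exact ⟨-1, Or.inr rfl, by rw [abs_of_neg h]; ring⟩
  · exact ⟨1, Or.inl rfl, by rw [abs_of_pos h]; ring⟩

theorem analyticAt_rpow {t : ℝ} (ht : 0 < t) (p : ℝ) : AnalyticAt ℝ (fun x : ℝ => x ^ p) t :=
  (Real.contDiffAt_rpow_const_of_ne (n := ω) ht.ne').analyticAt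

theorem exists_rpow_bounds (p : ℝ) : ∃ l u : ℝ, 0 < l ∧ 0 < u ∧ ∀ X x : ℝ, 0 < X → X ≤ x →
    x ≤ 2 * X → l * X ^ p ≤ x ^ p ∧ x ^ p ≤ u * X ^ p := by
  refine ⟨min 1 (2 ^ p), max 1 (2 ^ p), by positivity, by positivity, fun X x hX h1 h2 => ?_⟩
  have hx : 0 < x := hX.trans_le h1
  have hp : 0 < X ^ p := Real.rpow_pos_of_pos hX p
  have h2p : (2 * X) ^ p = 2 ^ p * X ^ p := Real.mul_rpow (by norm_num) hX.le
  rcases le_total 0 p with h | h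
  · have a1 := Real.rpow_le_rpow hX.le h1 h
    have a2 := Real.rpow_le_rpow hx.le h2 h
    rw [h2p] at a2
    exact ⟨(mul_le_of_le_one_left hp.le (min_le_left _ _)).trans a1,
      a2.trans (mul_le_mul_of_nonneg_right (le_max_right _ _) hp.le)⟩
  · have a1 := Real.rpow_le_rpow_of_nonpos hX h1 h
    have a2 := Real.rpow_le_rpow_of_nonpos hx h2 h
    rw [h2p] at a2
    exact ⟨(mul_le_mul_of_nonneg_right (min_le_right _ _) hp.le).trans a2,
      a1.trans (le_mul_of_one_le_left hp.le (le_max_left _ _))⟩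

theorem rpow_mem_uIcc {a b x : ℝ} (ha : 0 < a) (hx : x ∈ Icc a b) (p : ℝ) :
    min (a ^ p) (b ^ p) ≤ x ^ p ∧ x ^ p ≤ max (a ^ p) (b ^ p) := by
  have hx0 : 0 < x := ha.trans_le hx.1
  rcases le_total 0 p with h | h
  · exact ⟨(min_le_left _ _).trans (Real.rpow_le_rpow ha.le hx.1 h),
      (Real.rpow_le_rpow hx0.le hx.2 h).trans (le_max_right _ _)⟩
  · exact ⟨(min_le_right _ _).trans (Real.rpow_le_rpow_of_nonpos hx0 hx.2 h),
      (Real.rpow_le_rpow_of_nonpos ha hx.1 h).trans (le_max_left _ _)⟩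

/-- The point where the derivative of `A x^β` is `m`. -/
noncomputable def statPt (A β m : ℝ) : ℝ := (m / (A * β)) ^ (1 / (β - 1))

/-- The contribution of the stationary point of `A x^β - m x`, up to a constant phase. -/
noncomputable def statTerm (A β m : ℝ) : ℂ :=
  (√(statPt A β m / (m * |β - 1|)) : ℝ) * e ((1 / β - 1) * (m * statPt A β m))

theorem statPt_pos {A β m : ℝ} (hA : 0 < A) (hβ : 0 < β) (hm : 0 < m) : 0 < statPt A β m := by
  unfold statPt; positivity

theorem mul_statPt_rpow {A β m : ℝ} (hA : 0 < A) (hβ : 0 < β) (hβ1 : β ≠ 1) (hm : 0 < m) :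
    A * β * statPt A β m ^ (β - 1) = m := by
  have : β - 1 ≠ 0 := sub_ne_zero.2 hβ1
  rw [statPt, ← Real.rpow_mul (by positivity), one_div_mul_cancel this, Real.rpow_one]
  field_simp

/-- The scaling `x = c t`, with `c` the stationary point, gives the fixed phase `(t^β - 1)/β - (t -
1)` with parameter `T = mc` and `κ = |β - 1|`, plus the constant `(1/β - 1)mc` seen in `statTerm`.
The condition `b ≤ 2a` keeps `t` in `[1/2, 2]`, where the constants are uniform. -/
theorem exists_stationary_phase_rpow {β : ℝ} (hβ : 0 < β) (hβ1 : β ≠ 1) :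
    ∃ C : ℝ, 0 < C ∧ ∀ s : ℝ, (s = 1 ∨ s = -1) → s * (β - 1) = |β - 1| →
      ∀ A a b m : ℝ, 0 < A → 0 < a → 0 < m → b ≤ 2 * a →
      a ≤ statPt A β m → statPt A β m ≤ b →
      ‖(∫ x in a..b, e (A * x ^ β - m * x)) - e (s / 8) * statTerm A β m‖
        ≤ C * (1 / m + 1 / (√(m / statPt A β m) + |A * β * a ^ (β - 1) - m|)
          + 1 / (√(m / statPt A β m) + |A * β * b ^ (β - 1) - m|)) := by
  have hβ1' : β - 1 ≠ 0 := sub_ne_zero.2 hβ1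
  obtain ⟨s, hs, hsβ⟩ := exists_sign hβ1'
  have hsq : s * s = 1 := by rcases hs with rfl | rfl <;> norm_num
  have habs : |s| = 1 := by rcases hs with rfl | rfl <;> norm_num
  have hκ : 0 < |β - 1| := abs_pos.2 hβ1'
  have hd : ∀ (p t : ℝ), 0 < t → HasDerivAt (fun x : ℝ => x ^ p) (p * t ^ (p - 1)) t :=
    fun p t ht => Real.hasDerivAt_rpow_const (Or.inl ht.ne')
  have hmono : ∀ t, 0 < t → t ≠ 1 → 0 < s * (t ^ (β - 1) - 1) * (t - 1) := by
    intro t ht hne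
    have key : 0 < (β - 1) * ((t ^ (β - 1) - 1) * (t - 1)) := by
      rcases lt_or_gt_of_ne hβ1' with h | h <;> rcases lt_or_gt_of_ne hne with h' | h'
      · have := Real.one_lt_rpow_of_pos_of_lt_one_of_neg ht h' h
        exact mul_pos_of_neg_of_neg h (mul_neg_of_pos_of_neg (by linarith) (by linarith))
      · have := Real.rpow_lt_one_of_one_lt_of_neg h' h
        exact mul_pos_of_neg_of_neg h (mul_neg_of_neg_of_pos (by linarith) (by linarith))
      · have := Real.rpow_lt_one ht.le h' h
        exact mul_pos h (mul_pos_of_neg_of_neg (by linarith) (by linarith))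
      · have := Real.one_lt_rpow h' h
        exact mul_pos h (mul_pos (by linarith) (by linarith))
    have h2 : 0 < |β - 1| * (s * (t ^ (β - 1) - 1) * (t - 1)) := by
      rw [← hsβ]
      calc 0 < (β - 1) * ((t ^ (β - 1) - 1) * (t - 1)) := key
        _ = s * s * ((β - 1) * ((t ^ (β - 1) - 1) * (t - 1))) := by rw [hsq, one_mul]
        _ = _ := by ring
    exact (mul_pos_iff_of_pos_left hκ).1 h2
  obtain ⟨C, hC, hmain⟩ := exists_stationary_phase (κ := |β - 1|)
    (Q := fun t => s * ((t ^ β - 1) / β - (t - 1))) (Q' := fun t => s * (t ^ (β - 1) - 1)) hκ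
    (fun t ht => analyticAt_const.mul ((((analyticAt_rpow ht β).sub analyticAt_const).div
      analyticAt_const hβ.ne').sub (analyticAt_id.sub analyticAt_const)))
    (fun t ht => by
      have := ((((hd β t ht).sub_const 1).div_const β).sub
        ((hasDerivAt_id t).sub_const 1)).const_mul s
      refine this.congr_deriv ?_
      rw [mul_div_cancel_left₀ _ hβ.ne'])
    (by simp) (by simp)
    (by
      have := ((hd (β - 1) 1 one_pos).sub_const 1).const_mul s
      refine this.congr_deriv ?_
      rw [Real.one_rpow, mul_one, hsβ])
    (fun t ht h => by
      have := hmono t ht h.ne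
      exact neg_of_mul_pos_left this (by linarith))
    (fun t h => by
      have := hmono t (by linarith) h.ne'
      exact (mul_pos_iff_of_pos_right (by linarith)).1 this)
  refine ⟨C, hC, fun s' hs' hsβ' A a b m hA ha hm hba hca hcb => ?_⟩
  obtain rfl : s' = s := mul_right_cancel₀ hβ1' (hsβ'.trans hsβ.symm)
  set c := statPt A β m with hc
  have hc0 : 0 < c := statPt_pos hA hβ hm
  have hcm : A * β * c ^ (β - 1) = m := mul_statPt_rpow hA hβ hβ1 hm
  have hcβ : A * c ^ β = m * c / β := by
    rw [← hcm, mul_assoc _ (c ^ (β - 1)), Real.rpow_sub_one hc0.ne']; field_simp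
  have h := hmain (m * c) (a / c) (b / c) (by positivity)
    (by rw [le_div_iff₀ hc0]; linarith) ((div_le_one hc0).2 hca) ((one_le_div hc0).2 hcb)
    (by rw [div_le_iff₀ hc0]; linarith)
  rw [← norm_integral_e_sign_sub hs] at h
  have hcov : ∫ x in a..b, e (A * x ^ β - m * x)
      = (c : ℂ) * (e ((1 / β - 1) * (m * c)) * ∫ t in (a / c)..(b / c),
          e (s' * (m * c * (s' * ((t ^ β - 1) / β - (t - 1)))))) := by
    have h1 := intervalIntegral.smul_integral_comp_mul_left (a := a / c) (b := b / c)
      (fun x => e (A * x ^ β - m * x)) c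
    rw [mul_div_cancel₀ _ hc0.ne', mul_div_cancel₀ _ hc0.ne'] at h1
    rw [← h1, ← intervalIntegral.integral_const_mul, Complex.real_smul]
    congr 1
    refine integral_congr fun t ht => ?_
    rw [uIcc_of_le (by gcongr; linarith)] at ht
    have ht0 : 0 < t := lt_of_lt_of_le (by positivity) ht.1
    simp only [← e_add]
    congr 1
    rw [Real.mul_rpow hc0.le ht0.le, ← mul_assoc, hcβ]
    have : s' * (m * c * (s' * ((t ^ β - 1) / β - (t - 1))))
      = (s' * s') * (m * c * ((t ^ β - 1) / β - (t - 1))) := by ring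
    rw [this, hsq]
    field_simp
    ring
  have hstat : e (s' / 8) * statTerm A β m
      = (c : ℂ) * (e ((1 / β - 1) * (m * c)) * (e (s' / 8) / (√(|β - 1| * (m * c)) : ℝ))) := by
    rw [statTerm, ← hc]
    have : √(c / (m * |β - 1|)) = c / √(|β - 1| * (m * c)) := by
      rw [← Real.sqrt_sq hc0.le, ← Real.sqrt_div (sq_nonneg c), Real.sqrt_sq hc0.le]
      congr 1; field_simp
    rw [this]; push_cast; ring
  rw [hcov, hstat, ← mul_sub, ← mul_sub, norm_mul, norm_mul, norm_e, one_mul, Complex.norm_real,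
    Real.norm_of_nonneg hc0.le]
  refine (mul_le_mul_of_nonneg_left h hc0.le).trans (le_of_eq ?_)
  have hend : ∀ y, 0 < y → c * (1 / (√(m * c) + m * c * |s' * ((y / c) ^ (β - 1) - 1)|))
      = 1 / (√(m / c) + |A * β * y ^ (β - 1) - m|) := fun y hy => by
    have e1 : √(m * c) = c * √(m / c) := by
      rw [← Real.sqrt_sq hc0.le, ← Real.sqrt_mul (sq_nonneg c), Real.sqrt_sq hc0.le]
      congr 1; field_simp
    have e2 : m * c * |s' * ((y / c) ^ (β - 1) - 1)| = c * |A * β * y ^ (β - 1) - m| := by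
      rw [abs_mul, habs, one_mul]
      have : A * β * y ^ (β - 1) - m = m * ((y / c) ^ (β - 1) - 1) := by
        have hcp : c ^ (β - 1) ≠ 0 := (Real.rpow_pos_of_pos hc0 _).ne'
        rw [Real.div_rpow hy.le hc0.le, mul_sub, mul_one]
        congr 1
        rw [← hcm]; field_simp
      rw [this, abs_mul, abs_of_pos hm]; ring
    rw [e1, e2, ← mul_add]
    have : 0 < √(m / c) + |A * β * y ^ (β - 1) - m| := by positivity
    field_simp
  rw [← hend a ha, ← hend b (by linarith)]
  field_simp

/-- Here `y` is not interior to the range of the monotone derivative, so the derivative of the full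
phase is at least `d` in absolute value, `d` being the smaller of its two end point values. The
first derivative test is used when `d ≥ √lam`, the second derivative test otherwise; together they
give about `1/(√lam + d)`. -/
theorem exists_integral_bound_rpow {β : ℝ} (hβ : 0 < β) (hβ1 : β ≠ 1) :
    ∃ C : ℝ, 0 < C ∧ ∀ A X a b y : ℝ, 0 < A → 0 < X → X ≤ a → a ≤ b → b ≤ 2 * X →
      (y ≤ min (A * β * a ^ (β - 1)) (A * β * b ^ (β - 1)) ∨
        max (A * β * a ^ (β - 1)) (A * β * b ^ (β - 1)) ≤ y) →
      ‖∫ x in a..b, e (A * x ^ β - y * x)‖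
        ≤ C * (1 / (√(A * X ^ (β - 2)) + |A * β * a ^ (β - 1) - y|)
          + 1 / (√(A * X ^ (β - 2)) + |A * β * b ^ (β - 1) - y|)) := by
  have hβ1' : β - 1 ≠ 0 := sub_ne_zero.2 hβ1
  obtain ⟨s, hs, hsβ⟩ := exists_sign hβ1'
  have habs : |s| = 1 := by rcases hs with rfl | rfl <;> norm_num
  obtain ⟨l, u, hl, hu, hlu⟩ := exists_rpow_bounds (β - 2)
  have hκ : 0 < |β - 1| := abs_pos.2 hβ1'
  set q := β * |β - 1| * l with hq
  have hq0 : 0 < q := by positivity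
  refine ⟨8 / √q + 2, by positivity, fun A X a b y hA hX hXa hab hbX hy => ?_⟩
  have ha : 0 < a := hX.trans_le hXa
  have hpos : ∀ x ∈ Icc a b, 0 < x := fun x hx => ha.trans_le hx.1
  have hd : ∀ (p t : ℝ), 0 < t → HasDerivAt (fun x : ℝ => x ^ p) (p * t ^ (p - 1)) t :=
    fun p t ht => Real.hasDerivAt_rpow_const (Or.inl ht.ne')
  set F : ℝ → ℝ := fun x => s * (A * x ^ β - y * x)
  set F' : ℝ → ℝ := fun x => s * (A * β * x ^ (β - 1) - y)
  set F'' : ℝ → ℝ := fun x => A * β * |β - 1| * x ^ (β - 2)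
  have hF : ∀ x ∈ Icc a b, HasDerivAt F (F' x) x := fun x hx => by
    refine ((((hd β x (hpos x hx)).const_mul A).sub
      ((hasDerivAt_id x).const_mul y)).const_mul s).congr_deriv ?_
    simp only [F']; ring
  have hF' : ∀ x ∈ Icc a b, HasDerivAt F' (F'' x) x := fun x hx => by
    refine ((((hd (β - 1) x (hpos x hx)).const_mul (A * β)).sub_const y).const_mul s).congr_deriv ?_
    simp only [F'']; rw [← hsβ]
    have : β - 1 - 1 = β - 2 := by ring
    rw [this]; ring
  have hF''c : ContinuousOn F'' (Icc a b) :=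
    continuousOn_const.mul (continuousOn_id.rpow_const fun x hx => Or.inl (hpos x hx).ne')
  set lam := A * X ^ (β - 2) with hlam
  have hlam0 : 0 < lam := by positivity
  have hge : ∀ x ∈ Icc a b, q * lam ≤ F'' x := fun x hx => by
    have := (hlu X x hX (hXa.trans hx.1) (hx.2.trans hbX)).1
    calc q * lam = A * β * |β - 1| * (l * X ^ (β - 2)) := by rw [hq, hlam]; ring
      _ ≤ _ := by simp only [F'']; gcongr
  rw [← norm_integral_e_sign hs]
  have h2 := norm_integral_e_le_of_deriv2 hab (by positivity : 0 < q * lam) hF hF' hF''c hge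
  set ua := A * β * a ^ (β - 1)
  set ub := A * β * b ^ (β - 1)
  set d := min |ua - y| |ub - y| with hdd
  have hsl : 0 < √lam := Real.sqrt_pos.2 hlam0
  have hsq0 : 0 < √q := Real.sqrt_pos.2 hq0
  have hd0 : 0 ≤ d := le_min (abs_nonneg _) (abs_nonneg _)
  have hle : 1 / (√lam + d) ≤ 1 / (√lam + |ua - y|) + 1 / (√lam + |ub - y|) := by
    rcases min_choice |ua - y| |ub - y| with h | h <;> rw [hdd, h]
    · exact le_add_of_nonneg_right (by positivity)
    · exact le_add_of_nonneg_left (by positivity)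
  refine le_trans ?_ (mul_le_mul_of_nonneg_left hle (by positivity))
  rcases le_or_gt (√lam) d with h | h
  · have hd1 : 0 < d := hsl.trans_le h
    have h1 := norm_integral_e_le_of_deriv hab hd1 hF hF' hF''c
      (fun x hx => (by positivity : 0 ≤ q * lam).trans (hge x hx))
      (fun x hx => by
        simp only [F']
        rw [abs_mul, habs, one_mul]
        obtain ⟨r1, r2⟩ := rpow_mem_uIcc ha hx (β - 1)
        have hAβ : 0 ≤ A * β := by positivity
        have r1' : min ua ub ≤ A * β * x ^ (β - 1) := by
          have := mul_le_mul_of_nonneg_left r1 hAβ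
          rwa [mul_min_of_nonneg _ _ hAβ] at this
        have r2' : A * β * x ^ (β - 1) ≤ max ua ub := by
          have := mul_le_mul_of_nonneg_left r2 hAβ
          rwa [mul_max_of_nonneg _ _ hAβ] at this
        rcases hy with hy | hy
        · have y1 : y ≤ ua := hy.trans (min_le_left _ _)
          have y2 : y ≤ ub := hy.trans (min_le_right _ _)
          rw [abs_of_nonneg (by linarith), hdd, abs_of_nonneg (by linarith),
            abs_of_nonneg (by linarith), min_sub_sub_right]
          linarith
        · have y1 : ua ≤ y := (le_max_left _ _).trans hy
          have y2 : ub ≤ y := (le_max_right _ _).trans hy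
          rw [abs_of_nonpos (by linarith), hdd, abs_of_nonpos (by linarith),
            abs_of_nonpos (by linarith), neg_sub, neg_sub, neg_sub, min_sub_sub_left]
          linarith)
    refine h1.trans ?_
    rw [mul_one_div, div_le_div_iff₀ hd1 (by positivity)]
    have : 0 ≤ 8 / √q * d := by positivity
    nlinarith
  · refine h2.trans ?_
    rw [Real.sqrt_mul hq0.le, mul_one_div, div_le_div_iff₀ (by positivity) (by positivity)]
    have : (8 / √q + 2) * (√q * √lam) = 8 * √lam + 2 * √q * √lam := by field_simp
    rw [this]
    have : 0 < √q * √lam := by positivity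
    nlinarith

/-- Harmonic sums. -/
noncomputable def harm (n : ℕ) : ℝ := ∑ m ∈ Finset.range n, 1 / ((m : ℝ) + 1)

theorem harm_mono {m n : ℕ} (h : m ≤ n) : harm m ≤ harm n :=
  Finset.sum_le_sum_of_subset_of_nonneg (Finset.range_mono h) fun _ _ _ => by positivity

theorem harm_nonneg (n : ℕ) : 0 ≤ harm n := Finset.sum_nonneg fun _ _ => by positivity

theorem harm_le (n : ℕ) : harm n ≤ 1 + Real.log n := by
  have := harmonic_le_one_add_log n
  rw [harmonic] at this
  push_cast at this
  simpa [harm] using this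

/-- The integers `⌊u⌋` and `⌊u⌋ + 1` may be arbitrarily near `u` and cost `1/q` each. On each side
the others are at distance at least `1, 2, 3, …`. -/
theorem sum_inv_add_abs_sub_le {q u : ℝ} (hq : 0 < q) (hu : 0 ≤ u) {n : ℕ} (hun : u ≤ n) :
    ∑ m ∈ Finset.range n, 1 / (q + |u - m|) ≤ 2 / q + 2 * harm n := by
  set k := ⌊u⌋₊ with hk
  have hk1 : (k : ℝ) ≤ u := Nat.floor_le hu
  have hk2 : u < k + 1 := Nat.lt_floor_add_one u
  have hkn : k ≤ n := by exact_mod_cast hk1.trans hun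
  have hpt : ∀ m ∈ Finset.range n, 1 / (q + |u - m|) ≤ (if m = k then 1 / q else 0)
      + (if m = k + 1 then 1 / q else 0) + (if m < k then 1 / ((k : ℝ) - m) else 0)
      + (if k + 2 ≤ m then 1 / ((m : ℝ) - k - 1) else 0) := by
    intro m _
    rcases lt_trichotomy m k with h | h | h
    · have h' : (m : ℝ) + 1 ≤ k := by exact_mod_cast h
      rw [if_neg (by omega), if_neg (by omega), if_pos h, if_neg (by omega), zero_add, zero_add,
        add_zero]
      refine one_div_le_one_div_of_le (by linarith) ?_
      have := le_abs_self (u - m)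
      linarith
    · subst h
      rw [if_pos rfl, if_neg (by omega), if_neg (by omega), if_neg (by omega)]
      simp only [add_zero]
      exact one_div_le_one_div_of_le hq (by linarith [abs_nonneg (u - (k : ℝ))])
    · rcases Nat.lt_or_ge m (k + 2) with h2 | h2
      · obtain rfl : m = k + 1 := by omega
        rw [if_neg (by omega), if_pos rfl, if_neg (by omega), if_neg (by omega)]
        simp only [zero_add, add_zero]
        exact one_div_le_one_div_of_le hq (by linarith [abs_nonneg (u - (k + 1 : ℕ))])
      · have h' : (k : ℝ) + 2 ≤ m := by exact_mod_cast h2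
        rw [if_neg (by omega), if_neg (by omega), if_neg (by omega), if_pos h2, zero_add, zero_add,
          zero_add]
        refine one_div_le_one_div_of_le (by linarith) ?_
        have := neg_le_abs (u - m)
        linarith
  refine (Finset.sum_le_sum hpt).trans ?_
  rw [Finset.sum_add_distrib, Finset.sum_add_distrib, Finset.sum_add_distrib]
  have s1 : ∀ j : ℕ, ∑ m ∈ Finset.range n, (if m = j then 1 / q else 0) ≤ 1 / q := fun j => by
    rw [Finset.sum_ite_eq']
    split_ifs
    · exact le_rfl
    · positivity
  have s2 : ∑ m ∈ Finset.range n, (if m < k then 1 / ((k : ℝ) - m) else 0) ≤ harm n := by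
    rw [← Finset.sum_filter]
    have : (Finset.range n).filter (fun m => m < k) = Finset.range k := by
      ext m; simp only [Finset.mem_filter, Finset.mem_range]; omega
    rw [this, ← Finset.sum_range_reflect]
    refine le_trans (le_of_eq ?_) (harm_mono hkn)
    refine Finset.sum_congr rfl fun m hm => ?_
    have hm := Finset.mem_range.1 hm
    have : ((k - 1 - m : ℕ) : ℝ) = k - 1 - m := by
      rw [Nat.cast_sub (by omega), Nat.cast_sub (by omega)]; simp
    rw [this]; congr 1; ring
  have s3 : ∑ m ∈ Finset.range n, (if k + 2 ≤ m then 1 / ((m : ℝ) - k - 1) else 0) ≤ harm n := by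
    rw [← Finset.sum_filter]
    have : (Finset.range n).filter (fun m => k + 2 ≤ m) = Finset.Ico (k + 2) n := by
      ext m; simp only [Finset.mem_filter, Finset.mem_range, Finset.mem_Ico]; omega
    rw [this, Finset.sum_Ico_eq_sum_range]
    refine le_trans (le_of_eq ?_) (harm_mono (by omega : n - (k + 2) ≤ n))
    refine Finset.sum_congr rfl fun m _ => ?_
    congr 1; push_cast; ring
  have e1 : 2 / q = 1 / q + 1 / q := by ring
  linarith [s1 k, s1 (k + 1)]

end DyadicTransform

/-! ### The `B`-process for a power phase. -/

namespace DyadicTransform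

open MeasureTheory Set intervalIntegral

/-- The truncated stationary phase contribution of one integer frequency. -/
theorem exists_frequency_bound {β : ℝ} (hβ : 0 < β) (hβ1 : β ≠ 1) :
    ∃ C : ℝ, 0 < C ∧ ∃ ζ : ℂ, ‖ζ‖ = 1 ∧ ∀ (A X a b : ℝ) (m : ℕ), 0 < A → 0 < X → X ≤ a → a ≤ b →
      b ≤ 2 * X → 1 ≤ m →
      ‖(∫ x in a..b, e (A * x ^ β - m * x))
          - (if m ∈ Finset.Ico ⌈min (A * β * a ^ (β - 1)) (A * β * b ^ (β - 1))⌉₊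
              ⌈max (A * β * a ^ (β - 1)) (A * β * b ^ (β - 1))⌉₊
            then ζ * statTerm A β m else 0)‖
        ≤ C * (1 / m + 1 / (√(A * X ^ (β - 2)) + |A * β * a ^ (β - 1) - m|)
          + 1 / (√(A * X ^ (β - 2)) + |A * β * b ^ (β - 1) - m|)) := by
  have hβ1' : β - 1 ≠ 0 := sub_ne_zero.2 hβ1
  obtain ⟨s, hs, hsβ⟩ := exists_sign hβ1'
  obtain ⟨C₁, hC₁, h₁⟩ := exists_stationary_phase_rpow hβ hβ1
  obtain ⟨C₂, hC₂, h₂⟩ := exists_integral_bound_rpow hβ hβ1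
  obtain ⟨l, u, hl, hu, hlu⟩ := exists_rpow_bounds (β - 2)
  -- Since `m/c = Aβ c^(β-2) ≥ βl · A X^(β-2)` at the stationary point `c`, the local width `√(m/c)`
  -- can be replaced by `√lam` at the cost of `1/r`.
  set r := min 1 √(β * l) with hr
  have hr0 : 0 < r := by positivity
  have hr1 : r ≤ 1 := min_le_left _ _
  refine ⟨C₁ / r + C₂, by positivity, e (s / 8), norm_e _,
    fun A X a b m hA hX hXa hab hbX hm => ?_⟩
  have ha : 0 < a := hX.trans_le hXa
  have hb : 0 < b := ha.trans_le hab
  have hm0 : (0 : ℝ) < m := by exact_mod_cast hm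
  set ua := A * β * a ^ (β - 1) with hua
  set ub := A * β * b ^ (β - 1) with hub
  set lam := A * X ^ (β - 2) with hlam
  have hlam0 : 0 < lam := by positivity
  have hsl : 0 < √lam := Real.sqrt_pos.2 hlam0
  split_ifs with hmem
  · rw [Finset.mem_Ico, Nat.ceil_le, Nat.lt_ceil] at hmem
    -- `statPt` inverts `x ↦ Aβ x^(β-1)`, in a direction depending on the sign of `β - 1`.
    have hc : a ≤ statPt A β m ∧ statPt A β m ≤ b := by
      have hAβ : 0 < A * β := by positivity
      have key : ∀ x, 0 < x → statPt (A := A) (β := β) (A * β * x ^ (β - 1)) = x := fun x hx => by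
        rw [statPt, mul_div_cancel_left₀ _ hAβ.ne', ← Real.rpow_mul hx.le,
          mul_one_div_cancel hβ1', Real.rpow_one]
      rcases lt_or_gt_of_ne hβ1' with h | h
      · have hba : ub ≤ ua := by
          rw [hua, hub]; gcongr ?_ * ?_
          exact Real.rpow_le_rpow_of_nonpos ha hab h.le
        rw [min_eq_right hba, max_eq_left hba] at hmem
        have hp : 1 / (β - 1) ≤ 0 := by rw [one_div]; exact inv_nonpos.2 h.le
        constructor
        · rw [← key a ha]
          exact Real.rpow_le_rpow_of_nonpos (by positivity)
            (by gcongr; exact hmem.2.le) hp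
        · rw [← key b hb]
          exact Real.rpow_le_rpow_of_nonpos (by positivity)
            (by gcongr; exact hmem.1) hp
      · have hba : ua ≤ ub := by
          rw [hua, hub]; gcongr ?_ * ?_
          exact Real.rpow_le_rpow ha.le hab h.le
        rw [min_eq_left hba, max_eq_right hba] at hmem
        have hp : 0 ≤ 1 / (β - 1) := by positivity
        constructor
        · rw [← key a ha]
          exact Real.rpow_le_rpow (by positivity) (by gcongr; exact hmem.1) hp
        · rw [← key b hb]
          exact Real.rpow_le_rpow (by positivity) (by gcongr; exact hmem.2.le) hp
    have h := h₁ s hs hsβ A a b m hA ha hm0 (by linarith) hc.1 hc.2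
    refine h.trans ?_
    have hmc : (m : ℝ) / statPt A β m = A * β * statPt A β m ^ (β - 2) := by
      have hc0 := statPt_pos hA hβ hm0
      nth_rewrite 1 [← mul_statPt_rpow hA hβ hβ1 hm0]
      have : β - 2 = β - 1 - 1 := by ring
      rw [this, Real.rpow_sub_one hc0.ne' (β - 1), mul_div_assoc]
    have hsq : r * √lam ≤ √(m / statPt A β m) := by
      have h3 := (hlu X (statPt A β m) hX (hXa.trans hc.1) (hc.2.trans hbX)).1
      calc r * √lam ≤ √(β * l) * √lam := by gcongr; exact min_le_right _ _
        _ = √(A * β * (l * X ^ (β - 2))) := by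
          rw [← Real.sqrt_mul (by positivity), hlam]; congr 1; ring
        _ ≤ _ := by rw [hmc]; gcongr
    have hend : ∀ v : ℝ, 1 / (√(m / statPt A β m) + |v|) ≤ 1 / r * (1 / (√lam + |v|)) := fun v => by
      rw [one_div_mul_one_div]
      refine one_div_le_one_div_of_le (by positivity) ?_
      nlinarith [abs_nonneg v]
    have hm1 : 1 / (m : ℝ) ≤ 1 / r * (1 / m) :=
      le_mul_of_one_le_left (by positivity) ((one_le_div hr0).2 hr1)
    calc _ ≤ C₁ * (1 / r * (1 / m) + 1 / r * (1 / (√lam + |ua - m|))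
          + 1 / r * (1 / (√lam + |ub - m|))) := by
          gcongr
          · exact hend _
          · exact hend _
      _ = C₁ / r * (1 / m + 1 / (√lam + |ua - m|) + 1 / (√lam + |ub - m|)) := by ring
      _ ≤ _ := by gcongr; linarith
  · rw [sub_zero]
    have hy : (m : ℝ) ≤ min ua ub ∨ max ua ub ≤ m := by
      rw [Finset.mem_Ico, Nat.ceil_le, Nat.lt_ceil] at hmem
      by_contra hcon
      push Not at hcon
      exact hmem ⟨hcon.1.le, hcon.2⟩
    refine (h₂ A X a b m hA hX hXa hab hbX hy).trans ?_
    have : 0 ≤ 1 / (m : ℝ) := by positivity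
    have h4 : 0 ≤ C₁ / r := by positivity
    gcongr <;> linarith

/-- The van der Corput transform (`B`-process) of an exponential sum with a power phase. -/
theorem exists_bprocess {β : ℝ} (hβ : 0 < β) (hβ1 : β ≠ 1) :
    ∃ C : ℝ, 0 < C ∧ ∃ ζ : ℂ, ‖ζ‖ = 1 ∧ ∀ A X a b : ℝ, 0 < A → 0 < X → X ≤ a → a ≤ b →
      b ≤ 2 * X →
      ‖(∑ n ∈ Finset.Ioc ⌊a⌋₊ ⌊b⌋₊, e (A * (n : ℝ) ^ β))
          - ζ * ∑ m ∈ Finset.Ico ⌈min (A * β * a ^ (β - 1)) (A * β * b ^ (β - 1))⌉₊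
              ⌈max (A * β * a ^ (β - 1)) (A * β * b ^ (β - 1))⌉₊, statTerm A β m‖
        ≤ C * ((√(A * X ^ (β - 2)))⁻¹ + Real.log (2 + A * X ^ (β - 1))) := by
  have hβ1' : β - 1 ≠ 0 := sub_ne_zero.2 hβ1
  obtain ⟨C₁, hC₁, ζ, hζ, h₁⟩ := exists_frequency_bound hβ hβ1
  obtain ⟨C₂, hC₂, h₂⟩ := exists_integral_bound_rpow hβ hβ1
  obtain ⟨l, u, hl, hu, hlu⟩ := exists_rpow_bounds (β - 1)
  -- Chosen so that `M + 2 ≤ B (2 + Z)` below, which bounds `harm (M + 2)` by `K log(2 + Z)`.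
  set B := 2 * β * u + 4 with hB
  have hB0 : 0 < B := by positivity
  -- the number of harmonic sums
  set K := 1 + Real.log B / Real.log 2 + 1 / Real.log 2 with hK
  have hlog2 : 0 < Real.log 2 := Real.log_pos (by norm_num)
  have hlogB : 0 ≤ Real.log B := Real.log_nonneg (by nlinarith [mul_pos hβ hu])
  have hK0 : 0 < K := by positivity
  refine ⟨(6 * C₁ + 4 * C₂ + 4 * C₁ + 8 * C₂) + (5 * C₁ + 2 * C₂ + 5 + 3 / Real.log 2) * K,
    by positivity, ζ, hζ, fun A X a b hA hX hXa hab hbX => ?_⟩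
  have ha : 0 < a := hX.trans_le hXa
  have hb : 0 < b := ha.trans_le hab
  have hpos : ∀ x ∈ Icc a b, 0 < x := fun x hx => ha.trans_le hx.1
  have hd : ∀ (p t : ℝ), 0 < t → HasDerivAt (fun x : ℝ => x ^ p) (p * t ^ (p - 1)) t :=
    fun p t ht => Real.hasDerivAt_rpow_const (Or.inl ht.ne')
  set ua := A * β * a ^ (β - 1) with hua
  set ub := A * β * b ^ (β - 1) with hub
  set lam := A * X ^ (β - 2) with hlam
  have hlam0 : 0 < lam := by positivity
  have hsl : 0 < √lam := Real.sqrt_pos.2 hlam0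
  set Z := A * X ^ (β - 1) with hZ
  have hZ0 : 0 < Z := by positivity
  set D := β * u * Z with hD
  have hD0 : 0 < D := by positivity
  have hφ'D : ∀ x ∈ Icc a b, A * β * x ^ (β - 1) ≤ D := fun x hx => by
    have := (hlu X x hX (hXa.trans hx.1) (hx.2.trans hbX)).2
    calc A * β * x ^ (β - 1) ≤ A * β * (u * X ^ (β - 1)) := by gcongr
      _ = D := by rw [hD, hZ]; ring
  have huaD : ua ≤ D := hφ'D a ⟨le_rfl, hab⟩
  have hubD : ub ≤ D := hφ'D b ⟨hab, le_rfl⟩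
  have hua0 : 0 < ua := by positivity
  have hub0 : 0 < ub := by positivity
  set M := ⌈2 * D⌉₊ with hM
  have hM2 : 2 * D ≤ M := Nat.le_ceil _
  have hMlt : (M : ℝ) < 2 * D + 1 := Nat.ceil_lt_add_one (by positivity)
  set H := harm (M + 2) with hH
  have hH0 : 0 ≤ H := harm_nonneg _
  have hpois := norm_sum_e_sub_poisson_le ha.le hab hD0 hM2 (φ := fun x => A * x ^ β)
    (φ' := fun x => A * β * x ^ (β - 1)) (φ'' := fun x => A * β * (β - 1) * x ^ (β - 2))
    (fun x hx => ((hd β x (hpos x hx)).const_mul A).congr_deriv (by ring))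
    (fun x hx => ((hd (β - 1) x (hpos x hx)).const_mul (A * β)).congr_deriv (by
      have : β - 1 - 1 = β - 2 := by ring
      rw [this]; ring))
    (continuousOn_const.mul (continuousOn_id.rpow_const fun x hx => Or.inl (hpos x hx).ne'))
    (by
      rcases lt_or_gt_of_ne hβ1' with h | h
      · right; intro x hx
        have := Real.rpow_pos_of_pos (hpos x hx) (β - 2)
        exact mul_nonpos_of_nonpos_of_nonneg
          (mul_nonpos_of_nonneg_of_nonpos (by positivity) h.le) this.le
      · left; intro x hx
        have := Real.rpow_pos_of_pos (hpos x hx) (β - 2)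
        positivity)
    (fun x hx => by have := hpos x hx; positivity) hφ'D
  set R := Finset.Ico ⌈min ua ub⌉₊ ⌈max ua ub⌉₊ with hR
  -- All frequencies with a stationary point survive the truncation of the Poisson formula.
  have hRM : R ⊆ Finset.Ico 1 (M + 1) := by
    intro m hm
    rw [hR, Finset.mem_Ico] at hm
    rw [Finset.mem_Ico]
    have h0 : 0 < ⌈min ua ub⌉₊ := Nat.ceil_pos.2 (lt_min hua0 hub0)
    have h3 : ⌈max ua ub⌉₊ ≤ M := Nat.ceil_le_ceil ((max_le huaD hubD).trans (by linarith))
    omega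
  have hsumR : ζ * ∑ m ∈ R, statTerm A β m
      = ∑ m ∈ Finset.range M,
        (if m + 1 ∈ R then ζ * statTerm A β ((m + 1 : ℕ) : ℝ) else 0) := by
    rw [Finset.range_eq_Ico, Finset.sum_Ico_add' (fun m : ℕ =>
      if m ∈ R then ζ * statTerm A β (m : ℝ) else 0) 0 M 1, zero_add, Finset.sum_ite_mem,
      Finset.inter_eq_right.2 hRM, Finset.mul_sum]
  have hfreq : ‖(∑ m ∈ Finset.range M, ∫ x in a..b, e (A * x ^ β - (m + 1) * x))
      - ζ * ∑ m ∈ R, statTerm A β m‖ ≤ C₁ * (H + 2 * (2 / √lam + 2 * H)) := by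
    rw [hsumR, ← Finset.sum_sub_distrib]
    refine (norm_sum_le _ _).trans ?_
    have hterm : ∀ m ∈ Finset.range M, ‖(∫ x in a..b, e (A * x ^ β - (m + 1) * x))
        - (if m + 1 ∈ R then ζ * statTerm A β ((m + 1 : ℕ) : ℝ) else 0)‖
        ≤ C₁ * (1 / ((m : ℝ) + 1) + 1 / (√lam + |ua - ((m + 1 : ℕ) : ℝ)|)
          + 1 / (√lam + |ub - ((m + 1 : ℕ) : ℝ)|)) := fun m _ => by
      have := h₁ A X a b (m + 1) hA hX hXa hab hbX (by omega)
      push_cast at this ⊢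
      exact this
    refine (Finset.sum_le_sum hterm).trans ?_
    rw [← Finset.mul_sum, Finset.sum_add_distrib, Finset.sum_add_distrib]
    have hshift : ∀ v, 0 ≤ v → v ≤ D →
        ∑ m ∈ Finset.range M, 1 / (√lam + |v - ((m + 1 : ℕ) : ℝ)|) ≤ 2 / √lam + 2 * H := by
      intro v hv hvD
      have h5 := sum_inv_add_abs_sub_le hsl hv (n := M + 1) (by push_cast; linarith)
      rw [Finset.sum_range_succ'] at h5
      have h6 : harm (M + 1) ≤ H := harm_mono (by omega)
      have h7 : 0 ≤ 1 / (√lam + |v - ((0 : ℕ) : ℝ)|) := by positivity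
      linarith
    have h8 : ∑ m ∈ Finset.range M, 1 / ((m : ℝ) + 1) ≤ H := harm_mono (by omega)
    have := hshift ua hua0.le huaD
    have := hshift ub hub0.le hubD
    refine mul_le_mul_of_nonneg_left ?_ hC₁.le
    linarith
  -- Zero and, further below, the negative frequencies lie under the positive derivative of the
  -- phase, so they have no stationary point. Frequency `-(m+1)` costs `O(1/(m+1))`.
  have hzero : ‖∫ x in a..b, e (A * x ^ β)‖ ≤ C₂ * (2 * (1 / √lam)) := by
    have := h₂ A X a b 0 hA hX hXa hab hbX (Or.inl (le_min hua0.le hub0.le))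
    simp only [zero_mul, sub_zero] at this
    refine this.trans ?_
    rw [two_mul]
    gcongr
    · linarith [abs_nonneg ua]
    · linarith [abs_nonneg ub]
  have hneg : ‖∑ m ∈ Finset.range M, ∫ x in a..b, e (A * x ^ β + (m + 1) * x)‖
      ≤ C₂ * (2 * H) := by
    refine (norm_sum_le _ _).trans ?_
    have hterm : ∀ m ∈ Finset.range M, ‖∫ x in a..b, e (A * x ^ β + (m + 1) * x)‖
        ≤ C₂ * (2 * (1 / ((m : ℝ) + 1))) := fun m _ => by
      have := h₂ A X a b (-(m + 1)) hA hX hXa hab hbX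
        (Or.inl (le_trans (by linarith [(Nat.cast_nonneg m : (0 : ℝ) ≤ m)]) (le_min hua0.le hub0.le)))
      simp only [neg_mul, sub_neg_eq_add] at this
      refine this.trans ?_
      rw [two_mul]
      have hm : (0 : ℝ) ≤ m := Nat.cast_nonneg m
      refine mul_le_mul_of_nonneg_left (add_le_add
        (one_div_le_one_div_of_le (by linarith) ?_) (one_div_le_one_div_of_le (by linarith) ?_)) hC₂.le
      · have := le_abs_self (ua + ((m : ℝ) + 1)); linarith
      · have := le_abs_self (ub + ((m : ℝ) + 1)); linarith
    refine (Finset.sum_le_sum hterm).trans ?_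
    rw [← Finset.mul_sum, ← Finset.mul_sum]
    have h8 : ∑ m ∈ Finset.range M, 1 / ((m : ℝ) + 1) ≤ H := harm_mono (by omega)
    gcongr
  rw [Finset.sum_add_distrib] at hpois
  set J0 := ∫ x in a..b, e (A * x ^ β)
  set Jp := ∑ m ∈ Finset.range M, ∫ x in a..b, e (A * x ^ β - (m + 1) * x)
  set Jm := ∑ m ∈ Finset.range M, ∫ x in a..b, e (A * x ^ β + (m + 1) * x)
  set T := ζ * ∑ m ∈ R, statTerm A β m
  set SS := ∑ n ∈ Finset.Ioc ⌊a⌋₊ ⌊b⌋₊, e (A * (n : ℝ) ^ β)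
  have hdec : SS - T = (SS - (J0 + (Jp + Jm))) + J0 + Jm + (Jp - T) := by ring
  have h8 : ∑ m ∈ Finset.range M, 1 / ((m : ℝ) + 1) ≤ H := harm_mono (by omega)
  have htot : ‖SS - T‖ ≤ (3 + 2 * H) + C₂ * (2 * (1 / √lam)) + C₂ * (2 * H)
      + C₁ * (H + 2 * (2 / √lam + 2 * H)) := by
    rw [hdec]
    refine (norm_add_le _ _).trans (add_le_add ((norm_add_le _ _).trans (add_le_add
      ((norm_add_le _ _).trans (add_le_add (hpois.trans ?_) hzero)) hneg)) hfreq)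
    linarith
  set Lg := Real.log (2 + Z) with hLg
  have hLg2 : Real.log 2 ≤ Lg := Real.log_le_log (by norm_num) (by linarith)
  have hHL : H ≤ K * Lg := by
    have e1 : ((M + 2 : ℕ) : ℝ) ≤ B * (2 + Z) := by
      push_cast
      have e0 : B * (2 + Z) = 2 * D + 4 * (β * u) + 4 * Z + 8 := by rw [hB, hD]; ring
      have e00 : 0 < β * u := mul_pos hβ hu
      rw [e0]
      linarith only [hMlt, e00, hZ0]
    have e2 : Real.log ((M + 2 : ℕ) : ℝ) ≤ Real.log B + Lg := by
      rw [hLg, ← Real.log_mul hB0.ne' (by positivity)]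
      exact Real.log_le_log (by positivity) e1
    have e3 : Real.log B ≤ Real.log B / Real.log 2 * Lg := by
      rw [div_mul_eq_mul_div, le_div_iff₀ hlog2]; gcongr
    have e4 : 1 ≤ 1 / Real.log 2 * Lg := by
      rw [one_div_mul_eq_div, le_div_iff₀ hlog2]; linarith
    have := harm_le (M + 2)
    rw [hK]
    calc H ≤ 1 + Real.log ((M + 2 : ℕ) : ℝ) := this
      _ ≤ 1 / Real.log 2 * Lg + (Real.log B / Real.log 2 * Lg + Lg) := by linarith
      _ = _ := by ring
  have h3L : 3 ≤ 3 / Real.log 2 * K * Lg := by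
    have k1 : 1 ≤ K := by
      have : 0 ≤ Real.log B / Real.log 2 + 1 / Real.log 2 := by positivity
      rw [hK]; linarith
    have e4 : 3 ≤ 3 / Real.log 2 * Lg := by
      rw [div_mul_eq_mul_div, le_div_iff₀ hlog2]; linarith
    have : 0 ≤ 3 / Real.log 2 * Lg := by linarith
    nlinarith
  have hil : 0 < (√lam)⁻¹ := inv_pos.2 hsl
  have hLg0 : 0 < Lg := hlog2.trans_le hLg2
  have f1 : 0 ≤ (5 * C₁ + 2 * C₂ + 2) * (K * Lg - H) :=
    mul_nonneg (by positivity) (by linarith)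
  have f3 : 0 ≤ C₂ * Lg := by positivity
  have f4 : 0 ≤ C₁ * Lg := by positivity
  have f5 : 0 ≤ C₂ * (√lam)⁻¹ := by positivity
  have f6 : 0 ≤ C₁ * (√lam)⁻¹ := by positivity
  have f7 : 0 ≤ K * Lg := by positivity
  have f8 : 0 ≤ K * (√lam)⁻¹ * (5 * C₁ + 2 * C₂ + 5 + 3 / Real.log 2) := by positivity
  rw [one_div, div_eq_mul_inv 2] at htot
  refine htot.trans ?_
  linarith only [f1, f3, f4, f5, f6, f7, f8, h3L, hC₁, hC₂, hil, hLg0]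

end DyadicTransform

namespace DyadicTransform

/-! ### Dyadic decompositions -/

theorem sum_dyadic {M : Type*} [AddCommMonoid M] {X : ℝ} (hX : 1 ≤ X) (g : ℝ → M) :
    ∑ K ∈ dyadic X, g K = ∑ j ∈ Finset.range (Nat.log 2 ⌊X⌋₊ + 1), g (X / 2 ^ (j + 1)) := by
  have hX0 : 0 < X := by linarith
  rw [dyadic, Finset.sum_image]
  · rw [Finset.range_eq_Ico, Finset.sum_Ico_add' (fun j : ℕ => g (X / 2 ^ j)) 0 _ 1]
    rfl
  · intro i _ j _ hij
    have h2 : (2 : ℝ) ^ i = 2 ^ j := by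
      have := hij
      field_simp at this
      exact this.symm
    exact (pow_right_injective₀ (by norm_num) (by norm_num)) h2

theorem le_of_mem_dyadic {X K : ℝ} (hX : 1 ≤ X) (hK : K ∈ dyadic X) : 2 * K ≤ X := by
  obtain ⟨j, hj, rfl, _⟩ := (mem_dyadic hX K).1 hK
  have : (2 : ℝ) ≤ 2 ^ j := by
    calc (2 : ℝ) = 2 ^ 1 := by norm_num
      _ ≤ 2 ^ j := pow_le_pow_right₀ (by norm_num) hj
  rw [mul_div_assoc', div_le_iff₀ (by positivity)]
  nlinarith

theorem half_le_of_mem_dyadic {X K : ℝ} (hX : 1 ≤ X) (hK : K ∈ dyadic X) : 1 / 2 ≤ K := by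
  obtain ⟨j, hj, _, h⟩ := (mem_dyadic hX K).1 hK
  linarith

/-- Adjacent blocks share an end point, and after `log₂ ⌊X⌋ + 1` halvings the lower end is below
`1`, so nothing is missed. -/
theorem sum_sum_dyadic {M : Type*} [AddCommMonoid M] {X : ℝ} (hX : 1 ≤ X) (f : ℕ → M) :
    ∑ K ∈ dyadic X, ∑ n ∈ Finset.Ioc ⌊K⌋₊ ⌊2 * K⌋₊, f n = ∑ n ∈ Finset.Icc 1 ⌊X⌋₊, f n := by
  have hX0 : 0 < X := by linarith
  rw [sum_dyadic hX]
  have key : ∀ J : ℕ, ∑ j ∈ Finset.range J, ∑ n ∈ Finset.Ioc ⌊X / 2 ^ (j + 1)⌋₊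
      ⌊2 * (X / 2 ^ (j + 1))⌋₊, f n = ∑ n ∈ Finset.Ioc ⌊X / 2 ^ J⌋₊ ⌊X⌋₊, f n := by
    intro J
    induction J with
    | zero => simp
    | succ J ih =>
      rw [Finset.sum_range_succ, ih]
      have h1 : 2 * (X / 2 ^ (J + 1)) = X / 2 ^ J := by rw [pow_succ]; field_simp
      rw [h1, add_comm]
      refine Finset.sum_Ioc_consecutive f (Nat.floor_le_floor ?_) (Nat.floor_le_floor ?_)
      · gcongr
        · norm_num
        · omega
      · exact div_le_self hX0.le (one_le_pow₀ (by norm_num))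
  rw [key]
  have h0 : ⌊X / 2 ^ (Nat.log 2 ⌊X⌋₊ + 1)⌋₊ = 0 := by
    rw [Nat.floor_eq_zero, div_lt_one (by positivity)]
    have := Nat.lt_pow_succ_log_self (b := 2) (by norm_num) ⌊X⌋₊
    have h2 : ⌊X⌋₊ < 2 ^ (Nat.log 2 ⌊X⌋₊ + 1) := this
    have h3 := (Nat.floor_lt hX0.le).1 h2
    exact_mod_cast h3
  rw [h0]
  rfl

/-- A geometric series dominated by the largest block: block errors with a positive power cost no
logarithm when summed. -/
theorem exists_sum_dyadic_rpow_le {s : ℝ} (hs : 0 < s) :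
    ∃ C : ℝ, 0 < C ∧ ∀ X : ℝ, 1 ≤ X → ∑ K ∈ dyadic X, K ^ s ≤ C * X ^ s := by
  set r : ℝ := (1 / 2) ^ s with hr
  have hr0 : 0 < r := by positivity
  have hr1 : r < 1 := Real.rpow_lt_one (by norm_num) (by norm_num) hs
  refine ⟨(1 - r)⁻¹, inv_pos.2 (by linarith), fun X hX => ?_⟩
  have hX0 : 0 < X := by linarith
  rw [sum_dyadic hX]
  have : ∀ j ∈ Finset.range (Nat.log 2 ⌊X⌋₊ + 1), (X / 2 ^ (j + 1)) ^ s ≤ X ^ s * r ^ j := by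
    intro j _
    have e1 : X / 2 ^ (j + 1) = X * (1 / 2) ^ (j + 1) := by
      rw [one_div, inv_pow, div_eq_mul_inv]
    rw [e1, Real.mul_rpow hX0.le (by positivity), ← Real.rpow_natCast, ← Real.rpow_mul (by norm_num),
      mul_comm ((j + 1 : ℕ) : ℝ) s, Real.rpow_mul (by norm_num), Real.rpow_natCast, pow_succ]
    have : r ^ j * r ≤ r ^ j := mul_le_of_le_one_right (by positivity) hr1.le
    gcongr
  refine (Finset.sum_le_sum this).trans ?_
  rw [← Finset.mul_sum, mul_comm]
  gcongr
  have hg := (summable_geometric_of_lt_one hr0.le hr1).sum_le_tsum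
    (Finset.range (Nat.log 2 ⌊X⌋₊ + 1)) (fun j _ => by positivity)
  rwa [tsum_geometric_of_lt_one hr0.le hr1] at hg

theorem card_dyadic_le {X : ℝ} (hX : 1 ≤ X) : ((dyadic X).card : ℝ) ≤ 3 * (1 + Real.log X) := by
  have hX0 : 0 < X := by linarith
  have h1 : (dyadic X).card ≤ Nat.log 2 ⌊X⌋₊ + 1 := by
    refine Finset.card_image_le.trans ?_
    simp
  have hfl : ⌊X⌋₊ ≠ 0 := (Nat.floor_pos.2 hX).ne'
  have h2 : (2 : ℝ) ^ Nat.log 2 ⌊X⌋₊ ≤ X := by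
    have := Nat.pow_log_le_self 2 hfl
    calc (2 : ℝ) ^ Nat.log 2 ⌊X⌋₊ ≤ ⌊X⌋₊ := by exact_mod_cast this
      _ ≤ X := Nat.floor_le hX0.le
  have h3 := Real.log_le_log (by positivity) h2
  rw [Real.log_pow] at h3
  have h4 : (1 / 2 : ℝ) < Real.log 2 := by linarith [Real.log_two_gt_d9]
  have h5 : ((dyadic X).card : ℝ) ≤ Nat.log 2 ⌊X⌋₊ + 1 := by exact_mod_cast h1
  have h6 : (0 : ℝ) ≤ Nat.log 2 ⌊X⌋₊ := Nat.cast_nonneg _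
  nlinarith [Real.log_nonneg hX]

theorem two_mul_le_of_mem_dyadic_of_lt {X K K' : ℝ} (hX : 1 ≤ X) (hK : K ∈ dyadic X)
    (hK' : K' ∈ dyadic X) (h : K < K') : 2 * K ≤ K' := by
  have hX0 : 0 < X := by linarith
  obtain ⟨j, hj, rfl, _⟩ := (mem_dyadic hX K).1 hK
  obtain ⟨i, hi, rfl, _⟩ := (mem_dyadic hX K').1 hK'
  have hij : i < j := by
    by_contra hcon
    push Not at hcon
    have : X / 2 ^ i ≤ X / 2 ^ j := by gcongr; norm_num
    linarith
  have h2 : (2 : ℝ) ^ (i + 1) ≤ 2 ^ j := pow_le_pow_right₀ (by norm_num) hij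
  calc 2 * (X / 2 ^ j) ≤ 2 * (X / 2 ^ (i + 1)) := by gcongr
    _ = X / 2 ^ i := by rw [pow_succ]; field_simp

/-! ### The first transform -/

/-- The frequencies of the transformed sum over `(Y, 2Y]`. -/
noncomputable def freqRange (α θ k Y : ℝ) : Finset ℕ :=
  Finset.Ico ⌈α * k * θ * (2 * Y) ^ (θ - 1)⌉₊ ⌈α * k * θ * Y ^ (θ - 1)⌉₊

theorem mem_freqRange {α θ k Y : ℝ} {m : ℕ} : m ∈ freqRange α θ k Y ↔
    α * k * θ * (2 * Y) ^ (θ - 1) ≤ m ∧ (m : ℝ) < α * k * θ * Y ^ (θ - 1) := by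
  simp [freqRange, Nat.lt_ceil]

/-- The normalised terms of the transformed sum. -/
noncomputable def dualTerm (α θ k : ℝ) (m : ℕ) : ℂ :=
  ((m : ℝ) ^ (-((2 - θ) / (2 - 2 * θ))) : ℝ)
    * e (c₃ α θ * k ^ (1 / (1 - θ)) * (m : ℝ) ^ (-θ / (1 - θ)))

/-- The constant factor of the transformed sum. -/
noncomputable def ampConst (α θ : ℝ) : ℝ := √((α * θ) ^ (1 / (1 - θ)) / (1 - θ))

/-- The stationary point is `c = (αθk/m)^(1/(1-θ))`. The amplitude `√(c/(m(1-θ)))` and the phase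
`(1/θ - 1)mc` then separate into powers of `k` and of `m`. -/
theorem statTerm_eq_dualTerm {α θ k : ℝ} (hα : 0 < α) (hθ₀ : 0 < θ) (hθ₁ : θ < 1) (hk : 0 < k)
    {m : ℕ} (hm : 0 < m) :
    statTerm (α * k) θ m
      = ((ampConst α θ * k ^ (1 / (2 * (1 - θ))) : ℝ) : ℂ) * dualTerm α θ k m := by
  have h1 : 0 < 1 - θ := by linarith
  have hm0 : (0 : ℝ) < m := by exact_mod_cast hm
  have hαθ : 0 < α * θ := by positivity
  have hpt : statPt (α * k) θ m
      = (α * θ) ^ (1 / (1 - θ)) * k ^ (1 / (1 - θ)) * (m : ℝ) ^ (-(1 / (1 - θ))) := by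
    have e1 : 1 / (θ - 1) = -(1 / (1 - θ)) := by rw [← neg_sub, one_div_neg_eq_neg_one_div]
    have e2 : α * k * θ = α * θ * k := by ring
    rw [statPt, e1, e2, Real.div_rpow hm0.le (by positivity), Real.mul_rpow hαθ.le hk.le,
      Real.rpow_neg hαθ.le, Real.rpow_neg hk.le]
    have := Real.rpow_pos_of_pos hαθ (1 / (1 - θ))
    have := Real.rpow_pos_of_pos hk (1 / (1 - θ))
    field_simp
  have habs : |θ - 1| = 1 - θ := by rw [abs_sub_comm, abs_of_pos h1]
  rw [statTerm, dualTerm, habs, hpt,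
    ← mul_assoc ((ampConst α θ * k ^ (1 / (2 * (1 - θ))) : ℝ) : ℂ), ← Complex.ofReal_mul]
  congr 2
  · have e3 : (α * θ) ^ (1 / (1 - θ)) * k ^ (1 / (1 - θ)) * (m : ℝ) ^ (-(1 / (1 - θ)))
          / (m * (1 - θ))
        = (α * θ) ^ (1 / (1 - θ)) / (1 - θ) * (k ^ (1 / (2 * (1 - θ)))) ^ 2
          * ((m : ℝ) ^ (-((2 - θ) / (2 - 2 * θ)))) ^ 2 := by
      rw [← Real.rpow_natCast (k ^ _), ← Real.rpow_natCast ((m : ℝ) ^ _), ← Real.rpow_mul hk.le,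
        ← Real.rpow_mul hm0.le]
      have f1 : 1 / (2 * (1 - θ)) * ((2 : ℕ) : ℝ) = 1 / (1 - θ) := by push_cast; field_simp
      have f2 : -((2 - θ) / (2 - 2 * θ)) * ((2 : ℕ) : ℝ) = -(1 / (1 - θ)) - 1 := by
        have : 2 - 2 * θ = 2 * (1 - θ) := by ring
        push_cast; rw [this]; field_simp; ring
      rw [f1, f2, Real.rpow_sub_one hm0.ne']
      field_simp
    rw [e3, Real.sqrt_mul (by positivity), Real.sqrt_mul (by positivity),
      Real.sqrt_sq (by positivity), Real.sqrt_sq (by positivity), ampConst]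
  · rw [c₃]
    have f3 : -θ / (1 - θ) = 1 + -(1 / (1 - θ)) := by field_simp; ring
    rw [f3, Real.rpow_add hm0, Real.rpow_one]
    ring

theorem log_le_mul_log {B x : ℝ} (hB : 1 ≤ B) (hx : 0 ≤ x) :
    Real.log (2 + B * x) ≤ (1 + Real.log B / Real.log 2) * Real.log (2 + x) := by
  have hlog2 : 0 < Real.log 2 := Real.log_pos (by norm_num)
  have h1 : Real.log (2 + B * x) ≤ Real.log B + Real.log (2 + x) := by
    rw [← Real.log_mul (by positivity) (by positivity)]
    exact Real.log_le_log (by positivity) (by nlinarith)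
  have h2 : Real.log 2 ≤ Real.log (2 + x) := Real.log_le_log (by norm_num) (by linarith)
  have h3 : Real.log B ≤ Real.log B / Real.log 2 * Real.log (2 + x) := by
    rw [div_mul_eq_mul_div, le_div_iff₀ hlog2]
    exact mul_le_mul_of_nonneg_left h2 (Real.log_nonneg hB)
  linarith

/-- The `B`-process with `A = αk`, `β = θ` and `X = Y`: the term `(A X^(β-2))^(-1/2)` is a constant
times `k^(-1/2) Y^(1-θ/2)`. The derivative decreases as `θ < 1`, so `2Y` gives the lower end of the
frequencies, and `Y ≥ 1/2` reduces the logarithm to `log(2 + k)`. -/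
theorem exists_first_transform {α θ : ℝ} (hα : 0 < α) (hθ₀ : 0 < θ) (hθ₁ : θ < 1) :
    ∃ C : ℝ, 0 < C ∧ ∃ ζ : ℂ, ‖ζ‖ = 1 ∧ ∀ (k : ℕ) (Y : ℝ), 1 ≤ k → 1 / 2 ≤ Y →
      ‖(∑ n ∈ Finset.Ioc ⌊Y⌋₊ ⌊2 * Y⌋₊, e (α * k * (n : ℝ) ^ θ))
          - ζ * (((ampConst α θ * (k : ℝ) ^ (1 / (2 * (1 - θ))) : ℝ) : ℂ)
              * ∑ m ∈ freqRange α θ k Y, dualTerm α θ k m)‖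
        ≤ C * ((k : ℝ) ^ (-(1 / 2) : ℝ) * Y ^ (1 - θ / 2) + Real.log (2 + k)) := by
  obtain ⟨C, hC, ζ, hζ, h⟩ := exists_bprocess hθ₀ hθ₁.ne
  set B := max 1 (α * 2 ^ (1 - θ)) with hB
  have hB1 : 1 ≤ B := le_max_left _ _
  set L := 1 + Real.log B / Real.log 2 with hL
  have hlog2 : 0 < Real.log 2 := Real.log_pos (by norm_num)
  have hL0 : 0 < L := by have := Real.log_nonneg hB1; positivity
  refine ⟨C * (α ^ (-(1 / 2) : ℝ) + L), by positivity, ζ, hζ, fun k Y hk hY => ?_⟩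
  have hY0 : 0 < Y := by linarith
  have hk0 : (0 : ℝ) < k := by exact_mod_cast hk
  have h1 := h (α * k) Y Y (2 * Y) (by positivity) hY0 le_rfl (by linarith) le_rfl
  have hle : α * k * θ * (2 * Y) ^ (θ - 1) ≤ α * k * θ * Y ^ (θ - 1) := by
    gcongr ?_ * ?_
    exact Real.rpow_le_rpow_of_nonpos hY0 (by linarith) (by linarith)
  rw [min_eq_right hle, max_eq_left hle] at h1
  have h2 : ∑ m ∈ Finset.Ico ⌈α * k * θ * (2 * Y) ^ (θ - 1)⌉₊ ⌈α * k * θ * Y ^ (θ - 1)⌉₊,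
        statTerm (α * k) θ m
      = ((ampConst α θ * (k : ℝ) ^ (1 / (2 * (1 - θ))) : ℝ) : ℂ)
        * ∑ m ∈ freqRange α θ k Y, dualTerm α θ k m := by
    rw [Finset.mul_sum, freqRange]
    refine Finset.sum_congr rfl fun m hm => statTerm_eq_dualTerm hα hθ₀ hθ₁ hk0 ?_
    exact lt_of_lt_of_le (Nat.ceil_pos.2 (by positivity)) (Finset.mem_Ico.1 hm).1
  rw [h2] at h1
  refine h1.trans ?_
  have e1 : (√(α * k * Y ^ (θ - 2)))⁻¹
      = α ^ (-(1 / 2) : ℝ) * ((k : ℝ) ^ (-(1 / 2) : ℝ) * Y ^ (1 - θ / 2)) := by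
    rw [Real.sqrt_eq_rpow, ← Real.rpow_neg (by positivity), Real.mul_rpow (by positivity)
      (by positivity), Real.mul_rpow hα.le hk0.le, ← Real.rpow_mul hY0.le, mul_assoc]
    congr 3; ring
  have e2 : Real.log (2 + α * k * Y ^ (θ - 1)) ≤ L * Real.log (2 + k) := by
    refine le_trans (Real.log_le_log (by positivity) ?_) (log_le_mul_log hB1 hk0.le)
    have : Y ^ (θ - 1) ≤ 2 ^ (1 - θ) := by
      calc Y ^ (θ - 1) ≤ (1 / 2 : ℝ) ^ (θ - 1) :=
            Real.rpow_le_rpow_of_nonpos (by norm_num) hY (by linarith)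
        _ = 2 ^ (1 - θ) := by
            rw [one_div, Real.inv_rpow (by norm_num), ← Real.rpow_neg (by norm_num), neg_sub]
    have h3 : α * k * Y ^ (θ - 1) ≤ α * 2 ^ (1 - θ) * k := by
      calc α * k * Y ^ (θ - 1) ≤ α * k * 2 ^ (1 - θ) := by gcongr
        _ = _ := by ring
    have h4 : α * 2 ^ (1 - θ) * k ≤ B * k := by gcongr; exact le_max_right _ _
    linarith
  rw [e1]
  have f1 : 0 ≤ Real.log (2 + k) := Real.log_nonneg (by linarith)
  have f2 : 0 ≤ (k : ℝ) ^ (-(1 / 2) : ℝ) * Y ^ (1 - θ / 2) := by positivity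
  have f3 : 0 < α ^ (-(1 / 2) : ℝ) := by positivity
  calc _ ≤ C * (α ^ (-(1 / 2) : ℝ) * ((k : ℝ) ^ (-(1 / 2) : ℝ) * Y ^ (1 - θ / 2))
        + L * Real.log (2 + k)) := by gcongr
    _ ≤ C * ((α ^ (-(1 / 2) : ℝ) + L) * ((k : ℝ) ^ (-(1 / 2) : ℝ) * Y ^ (1 - θ / 2)
        + Real.log (2 + k))) := by
      gcongr
      nlinarith [mul_nonneg f3.le f1, mul_nonneg hL0.le f2]
    _ = _ := by ring

/-- The full transformed sum. -/
noncomputable def dualSum (α θ : ℝ) (N k : ℕ) : ℂ :=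
  ∑ Y ∈ dyadic (N : ℝ), ∑ m ∈ freqRange α θ k Y, dualTerm α θ k m

theorem exists_sum_sub_dualSum_le {α θ : ℝ} (hα : 0 < α) (hθ₀ : 0 < θ) (hθ₁ : θ < 1) :
    ∃ C : ℝ, 0 < C ∧ ∃ ζ : ℂ, ‖ζ‖ = 1 ∧ ∀ N k : ℕ, 1 ≤ N → 1 ≤ k →
      ‖(∑ y ∈ Finset.Icc 1 N, e (α * (k : ℝ) * (y : ℝ) ^ θ))
          - ζ * (((ampConst α θ * (k : ℝ) ^ (1 / (2 * (1 - θ))) : ℝ) : ℂ) * dualSum α θ N k)‖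
        ≤ C * ((k : ℝ) ^ (-(1 / 2) : ℝ) * (N : ℝ) ^ (1 - θ / 2)
          + Real.log (2 + k) * (1 + Real.log N)) := by
  obtain ⟨C₁, hC₁, ζ, hζ, h₁⟩ := exists_first_transform hα hθ₀ hθ₁
  obtain ⟨C₂, hC₂, h₂⟩ := exists_sum_dyadic_rpow_le (s := 1 - θ / 2) (by linarith)
  refine ⟨C₁ * (C₂ + 3), by positivity, ζ, hζ, fun N k hN hk => ?_⟩
  have hN1 : (1 : ℝ) ≤ N := by exact_mod_cast hN
  have hk0 : (0 : ℝ) < k := by exact_mod_cast hk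
  have hd := sum_sum_dyadic hN1 (fun n : ℕ => e (α * (k : ℝ) * (n : ℝ) ^ θ))
  rw [Nat.floor_natCast] at hd
  rw [← hd, dualSum, Finset.mul_sum, Finset.mul_sum, ← Finset.sum_sub_distrib]
  refine (norm_sum_le _ _).trans ?_
  refine (Finset.sum_le_sum fun Y hY => h₁ k Y hk (half_le_of_mem_dyadic hN1 hY)).trans ?_
  rw [← Finset.mul_sum, Finset.sum_add_distrib, ← Finset.mul_sum, Finset.sum_const, nsmul_eq_mul]
  have h3 := h₂ N hN1
  have h4 := card_dyadic_le hN1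
  have f1 : 0 ≤ Real.log (2 + k) := Real.log_nonneg (by linarith)
  have f2 : 0 ≤ Real.log (N : ℝ) := Real.log_nonneg hN1
  have f3 : 0 < (k : ℝ) ^ (-(1 / 2) : ℝ) := by positivity
  have f4 : 0 < (N : ℝ) ^ (1 - θ / 2) := by positivity
  calc _ ≤ C₁ * ((k : ℝ) ^ (-(1 / 2) : ℝ) * (C₂ * (N : ℝ) ^ (1 - θ / 2))
        + 3 * (1 + Real.log N) * Real.log (2 + k)) := by gcongr
    _ ≤ C₁ * ((C₂ + 3) * ((k : ℝ) ^ (-(1 / 2) : ℝ) * (N : ℝ) ^ (1 - θ / 2)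
          + Real.log (2 + k) * (1 + Real.log N))) := by
      gcongr
      have g1 : 0 ≤ (k : ℝ) ^ (-(1 / 2) : ℝ) * (N : ℝ) ^ (1 - θ / 2) := by positivity
      have g2 : 0 ≤ C₂ * (Real.log (2 + k) * (1 + Real.log N)) := by positivity
      linarith
    _ = _ := by ring

end DyadicTransform

namespace DyadicTransform

/-! ### Expanding the square -/

/-- The part `m₁ < m₂` of the product of two transformed sums. -/
noncomputable def offDiag (α θ k Y₁ Y₂ : ℝ) : ℂ :=
  ∑ p ∈ (freqRange α θ k Y₁ ×ˢ freqRange α θ k Y₂).filter (fun p => p.1 < p.2),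
    dualTerm α θ k p.1 * (starRingEnd ℂ) (dualTerm α θ k p.2)

/-- The sum of all parts `m₁ < m₂`. -/
noncomputable def offDiagSum (α θ : ℝ) (N k : ℕ) : ℂ :=
  ∑ Y₁ ∈ dyadic (N : ℝ), ∑ Y₂ ∈ dyadic (N : ℝ), offDiag α θ k Y₁ Y₂

/-- The diagonal contribution. -/
noncomputable def diagSum (α θ : ℝ) (N k : ℕ) : ℝ :=
  ∑ Y ∈ dyadic (N : ℝ), ∑ m ∈ freqRange α θ k Y, (m : ℝ) ^ (-(1 / (1 - θ)) - 1)

/-- The phase derivative decreases in `y`, so blocks further right have smaller frequencies; the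
half-open ranges do not meet even for adjacent blocks. Hence equal frequencies occur only when `Y₁ =
Y₂`. -/
theorem freqRange_disjoint {α θ k X Y₁ Y₂ : ℝ} (hα : 0 < α) (hθ₀ : 0 < θ) (hθ₁ : θ < 1) (hk : 0 < k)
    (hX : 1 ≤ X) (h₁ : Y₁ ∈ dyadic X) (h₂ : Y₂ ∈ dyadic X) (hne : Y₁ ≠ Y₂) {m : ℕ}
    (hm₁ : m ∈ freqRange α θ k Y₁) (hm₂ : m ∈ freqRange α θ k Y₂) : False := by
  have key : ∀ Y Y' : ℝ, Y ∈ dyadic X → Y' ∈ dyadic X → Y < Y' → m ∈ freqRange α θ k Y →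
      m ∈ freqRange α θ k Y' → False := by
    intro Y Y' hY hY' hlt hm hm'
    have h2 := two_mul_le_of_mem_dyadic_of_lt hX hY hY' hlt
    have hY0 := half_le_of_mem_dyadic hX hY
    have a1 := (mem_freqRange.1 hm).1
    have a2 := (mem_freqRange.1 hm').2
    have : α * k * θ * Y' ^ (θ - 1) ≤ α * k * θ * (2 * Y) ^ (θ - 1) := by
      gcongr ?_ * ?_
      exact Real.rpow_le_rpow_of_nonpos (by linarith) h2 (by linarith)
    linarith
  rcases lt_or_gt_of_ne hne with h | h
  · exact key Y₁ Y₂ h₁ h₂ h hm₁ hm₂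
  · exact key Y₂ Y₁ h₂ h₁ h hm₂ hm₁

theorem dualTerm_mul_conj_self {α θ k : ℝ} (hθ₁ : θ < 1) {m : ℕ} (hm : 0 < m) :
    dualTerm α θ k m * (starRingEnd ℂ) (dualTerm α θ k m)
      = (((m : ℝ) ^ (-(1 / (1 - θ)) - 1) : ℝ) : ℂ) := by
  have hm0 : (0 : ℝ) < m := by exact_mod_cast hm
  have h1 : 0 < 1 - θ := by linarith
  rw [Complex.mul_conj', dualTerm, norm_mul, norm_e, mul_one, Complex.norm_real,
    Real.norm_of_nonneg (by positivity)]
  rw [← Complex.ofReal_pow, ← Real.rpow_natCast, ← Real.rpow_mul hm0.le]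
  congr 2
  have : 2 - 2 * θ = 2 * (1 - θ) := by ring
  push_cast; rw [this]; field_simp; ring

theorem pos_of_mem_freqRange {α θ k Y : ℝ} (hα : 0 < α) (hθ₀ : 0 < θ) (hk : 0 < k) (hY : 0 < Y)
    {m : ℕ} (hm : m ∈ freqRange α θ k Y) : 0 < m := by
  have h := (mem_freqRange.1 hm).1
  have : 0 < α * k * θ * (2 * Y) ^ (θ - 1) := by positivity
  exact_mod_cast this.trans_le h

/-- The pairs are split by `m₁ < m₂`, `m₁ = m₂`, `m₁ > m₂`. Swapping the two blocks makes the last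
part the conjugate of the first. -/
theorem norm_dualSum_sq {α θ : ℝ} (hα : 0 < α) (hθ₀ : 0 < θ) (hθ₁ : θ < 1) {N k : ℕ}
    (hN : 1 ≤ N) (hk : 1 ≤ k) :
    ((‖dualSum α θ N k‖ ^ 2 : ℝ) : ℂ) = (diagSum α θ N k : ℂ) + offDiagSum α θ N k
      + (starRingEnd ℂ) (offDiagSum α θ N k) := by
  have hN1 : (1 : ℝ) ≤ N := by exact_mod_cast hN
  have hk0 : (0 : ℝ) < k := by exact_mod_cast hk
  set u := dualTerm α θ (k : ℝ) with hu
  have hprod : ∀ Y₁ Y₂ : ℝ, (∑ m ∈ freqRange α θ k Y₁, u m)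
      * (starRingEnd ℂ) (∑ m ∈ freqRange α θ k Y₂, u m)
      = offDiag α θ k Y₁ Y₂ + (∑ p ∈ (freqRange α θ k Y₁ ×ˢ freqRange α θ k Y₂).filter
          (fun p => p.1 = p.2), u p.1 * (starRingEnd ℂ) (u p.2))
        + (starRingEnd ℂ) (offDiag α θ k Y₂ Y₁) := by
    intro Y₁ Y₂
    have e1 : (starRingEnd ℂ) (offDiag α θ k Y₂ Y₁)
        = ∑ p ∈ (freqRange α θ k Y₁ ×ˢ freqRange α θ k Y₂).filter (fun p => p.2 < p.1),
          u p.1 * (starRingEnd ℂ) (u p.2) := by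
      rw [offDiag, map_sum]
      refine Finset.sum_nbij' Prod.swap Prod.swap ?_ ?_ ?_ ?_ ?_
      · rintro ⟨a, b⟩ h
        simp only [Finset.mem_filter, Finset.mem_product, Prod.swap] at h ⊢
        exact ⟨⟨h.1.2, h.1.1⟩, h.2⟩
      · rintro ⟨a, b⟩ h
        simp only [Finset.mem_filter, Finset.mem_product, Prod.swap] at h ⊢
        exact ⟨⟨h.1.2, h.1.1⟩, h.2⟩
      · intro p _; simp
      · intro p _; simp
      · rintro ⟨a, b⟩ _
        simp [hu, mul_comm]
    rw [e1, map_sum, Finset.sum_mul_sum, ← Finset.sum_product', offDiag,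
      ← Finset.sum_filter_add_sum_filter_not _ (fun p : ℕ × ℕ => p.1 < p.2), add_assoc]
    congr 1
    rw [← Finset.sum_filter_add_sum_filter_not _ (fun p : ℕ × ℕ => p.1 = p.2),
      Finset.filter_filter, Finset.filter_filter]
    congr 1
    · refine Finset.sum_congr (Finset.filter_congr fun p _ => ?_) fun _ _ => rfl
      omega
    · refine Finset.sum_congr (Finset.filter_congr fun p _ => ?_) fun _ _ => rfl
      omega
  have hdiag : ∀ Y₁ ∈ dyadic (N : ℝ), ∑ Y₂ ∈ dyadic (N : ℝ),
      (∑ p ∈ (freqRange α θ k Y₁ ×ˢ freqRange α θ k Y₂).filter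
          (fun p => p.1 = p.2), u p.1 * (starRingEnd ℂ) (u p.2))
      = ((∑ m ∈ freqRange α θ k Y₁, (m : ℝ) ^ (-(1 / (1 - θ)) - 1) : ℝ) : ℂ) := by
    intro Y₁ hY₁
    rw [Finset.sum_eq_single_of_mem Y₁ hY₁]
    · rw [Complex.ofReal_sum]
      symm
      refine Finset.sum_nbij' (fun m => (m, m)) Prod.fst ?_ ?_ ?_ ?_ ?_
      · intro m hm; simp [hm]
      · rintro ⟨a, b⟩ h
        simp only [Finset.mem_filter, Finset.mem_product] at h
        exact h.1.1
      · intro m _; rfl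
      · rintro ⟨a, b⟩ h
        simp only [Finset.mem_filter, Finset.mem_product] at h
        simp [h.2]
      · intro m hm
        exact (dualTerm_mul_conj_self hθ₁ (pos_of_mem_freqRange hα hθ₀ hk0
          (by linarith [half_le_of_mem_dyadic hN1 hY₁]) hm)).symm
    · intro Y₂ hY₂ hne
      refine Finset.sum_eq_zero ?_
      rintro ⟨a, b⟩ h
      simp only [Finset.mem_filter, Finset.mem_product] at h
      obtain ⟨⟨ha, hb⟩, rfl⟩ := h
      exact (freqRange_disjoint hα hθ₀ hθ₁ hk0 hN1 hY₁ hY₂ hne.symm ha hb).elim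
  have hsw : (starRingEnd ℂ) (offDiagSum α θ N k)
      = ∑ Y₁ ∈ dyadic (N : ℝ), ∑ Y₂ ∈ dyadic (N : ℝ), (starRingEnd ℂ) (offDiag α θ k Y₂ Y₁) := by
    rw [offDiagSum, Finset.sum_comm, map_sum]
    exact Finset.sum_congr rfl fun _ _ => map_sum _ _ _
  rw [Complex.ofReal_pow, ← Complex.mul_conj', hsw, dualSum, map_sum, Finset.sum_mul_sum]
  simp_rw [← hu, hprod, Finset.sum_add_distrib]
  rw [Finset.sum_congr rfl hdiag, diagSum, offDiagSum, Complex.ofReal_sum]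
  ring

/-! ### The diagonal -/

theorem rpow_neg_sub_bounds {β x y : ℝ} (hβ : 0 < β) (hx : 0 < x) (hxy : x ≤ y) :
    β * y ^ (-β - 1) * (y - x) ≤ x ^ (-β) - y ^ (-β) ∧
      x ^ (-β) - y ^ (-β) ≤ β * x ^ (-β - 1) * (y - x) := by
  have hy : 0 < y := hx.trans_le hxy
  have hpos : ∀ z ∈ Set.Icc x y, 0 < z := fun z hz => hx.trans_le hz.1
  have hd : ∀ z ∈ Set.Icc x y, HasDerivAt (fun z : ℝ => -z ^ (-β)) (β * z ^ (-β - 1)) z :=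
    fun z hz => by
      refine (Real.hasDerivAt_rpow_const (p := -β) (Or.inl (hpos z hz).ne')).fun_neg.congr_deriv ?_
      ring
  have hc : ContinuousOn (fun z : ℝ => -z ^ (-β)) (Set.Icc x y) :=
    fun z hz => (hd z hz).continuousAt.continuousWithinAt
  have hdi : DifferentiableOn ℝ (fun z : ℝ => -z ^ (-β)) (interior (Set.Icc x y)) :=
    fun z hz => (hd z (interior_subset hz)).differentiableAt.differentiableWithinAt
  have h1 := (convex_Icc x y).mul_sub_le_image_sub_of_le_deriv hc hdi (C := β * y ^ (-β - 1))
    (fun z hz => by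
      rw [(hd z (interior_subset hz)).deriv]
      have := interior_subset hz
      gcongr ?_ * ?_
      exact Real.rpow_le_rpow_of_nonpos (hpos z this) this.2 (by linarith))
    x ⟨le_rfl, hxy⟩ y ⟨hxy, le_rfl⟩ hxy
  have h2 := (convex_Icc x y).image_sub_le_mul_sub_of_deriv_le hc hdi (C := β * x ^ (-β - 1))
    (fun z hz => by
      rw [(hd z (interior_subset hz)).deriv]
      have := interior_subset hz
      gcongr ?_ * ?_
      exact Real.rpow_le_rpow_of_nonpos hx this.1 (by linarith))
    x ⟨le_rfl, hxy⟩ y ⟨hxy, le_rfl⟩ hxy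
  constructor <;> linarith

/-- The function `β x^(-β-1)` is decreasing with antiderivative `-x^(-β)`. Comparison of sum and
integral by telescoping costs at most its largest value, taken at `lo`. -/
theorem abs_sum_rpow_neg_sub_le {β lo hi : ℝ} (hβ : 0 < β) (hlo : 0 < lo) (hle : lo ≤ hi) :
    |(∑ m ∈ Finset.Ico ⌈lo⌉₊ ⌈hi⌉₊, β * (m : ℝ) ^ (-β - 1)) - (lo ^ (-β) - hi ^ (-β))|
      ≤ β * lo ^ (-β - 1) := by
  set a := ⌈lo⌉₊ with ha
  set b := ⌈hi⌉₊ with hb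
  have ha1 : lo ≤ a := Nat.le_ceil lo
  have ha2 : (a : ℝ) < lo + 1 := Nat.ceil_lt_add_one hlo.le
  have hb1 : hi ≤ b := Nat.le_ceil hi
  have hb2 : (b : ℝ) < hi + 1 := Nat.ceil_lt_add_one (by linarith)
  have hab : a ≤ b := Nat.ceil_le_ceil hle
  have ha0 : 0 < a := Nat.ceil_pos.2 hlo
  have hanti : ∀ x y : ℝ, 0 < x → x ≤ y → y ^ (-β) ≤ x ^ (-β) := fun x y hx hxy =>
    Real.rpow_le_rpow_of_nonpos hx hxy (by linarith)
  rw [abs_le]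
  constructor
  · have h1 : ((a : ℝ) ^ (-β) - (b : ℝ) ^ (-β)) ≤ ∑ m ∈ Finset.Ico a b, β * (m : ℝ) ^ (-β - 1) := by
      have : (a : ℝ) ^ (-β) - (b : ℝ) ^ (-β)
          = ∑ m ∈ Finset.Ico a b, (((m : ℕ) : ℝ) ^ (-β) - ((m + 1 : ℕ) : ℝ) ^ (-β)) := by
        rw [← neg_inj, ← Finset.sum_neg_distrib]
        simp only [neg_sub]
        exact (Finset.sum_Ico_sub (fun m : ℕ => ((m : ℕ) : ℝ) ^ (-β)) hab).symm
      rw [this]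
      refine Finset.sum_le_sum fun m hm => ?_
      have hm0 : (0 : ℝ) < m := by exact_mod_cast lt_of_lt_of_le ha0 (Finset.mem_Ico.1 hm).1
      have := (rpow_neg_sub_bounds hβ hm0 (by linarith : (m : ℝ) ≤ m + 1)).2
      push_cast
      linarith
    have h2 := (rpow_neg_sub_bounds hβ hlo ha1).2
    have h3 : β * lo ^ (-β - 1) * (a - lo) ≤ β * lo ^ (-β - 1) * 1 := by
      gcongr; linarith
    have h4 := hanti hi b (by linarith) hb1
    linarith
  · rcases hab.eq_or_lt with h | h
    · rw [h, Finset.Ico_self, Finset.sum_empty]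
      have := hanti lo hi hlo hle
      have : 0 ≤ β * lo ^ (-β - 1) := by positivity
      linarith
    -- The first term is set aside and becomes the error: comparing it with the unit interval on its
    -- left would go below `lo`, possibly down to `0`.
    · rw [← Finset.insert_Ico_add_one_left_eq_Ico h, Finset.sum_insert (by simp)]
      have h1 : ∑ m ∈ Finset.Ico (a + 1) b, β * (m : ℝ) ^ (-β - 1)
          ≤ (a : ℝ) ^ (-β) - ((b - 1 : ℕ) : ℝ) ^ (-β) := by
        have : (a : ℝ) ^ (-β) - ((b - 1 : ℕ) : ℝ) ^ (-β)
            = ∑ m ∈ Finset.Ico (a + 1) b, (((m - 1 : ℕ) : ℝ) ^ (-β) - (m : ℝ) ^ (-β)) := by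
          have h5 := Finset.sum_Ico_sub (fun m : ℕ => ((m - 1 : ℕ) : ℝ) ^ (-β))
            (show a + 1 ≤ b from h)
          simp only [Nat.add_sub_cancel] at h5
          rw [← neg_inj, ← Finset.sum_neg_distrib, neg_sub]
          simp only [neg_sub]
          exact h5.symm
        rw [this]
        refine Finset.sum_le_sum fun m hm => ?_
        have hm1 := (Finset.mem_Ico.1 hm).1
        have e1 : ((m - 1 : ℕ) : ℝ) = m - 1 := by rw [Nat.cast_sub (by omega)]; simp
        have hm2 : ((a + 1 : ℕ) : ℝ) ≤ m := by exact_mod_cast hm1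
        push_cast at hm2
        have := (rpow_neg_sub_bounds hβ (by linarith : (0 : ℝ) < m - 1)
          (by linarith : (m : ℝ) - 1 ≤ m)).1
        rw [e1]
        linarith
      have h2 : β * (a : ℝ) ^ (-β - 1) ≤ β * lo ^ (-β - 1) := by
        gcongr ?_ * ?_
        exact Real.rpow_le_rpow_of_nonpos hlo ha1 (by linarith)
      have h3 := hanti lo a hlo ha1
      have e1 : ((b - 1 : ℕ) : ℝ) = b - 1 := by rw [Nat.cast_sub (by omega)]; simp
      have hb0 : ((a + 1 : ℕ) : ℝ) ≤ b := by exact_mod_cast h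
      push_cast at hb0
      have h4 := hanti (b - 1) hi (by linarith) (by linarith)
      rw [e1] at h1
      linarith

/-- The power `-1/(1-θ)` undoes the derivative: it sends `αθk y^(θ-1)` to `y/W`. The integral over
the frequencies of a block therefore gives `2Y - Y = Y` after normalisation. -/
theorem exists_diag_dyadic {α θ : ℝ} (hα : 0 < α) (hθ₀ : 0 < θ) (hθ₁ : θ < 1) :
    ∃ C : ℝ, 0 < C ∧ ∀ k Y : ℝ, 0 < k → 0 < Y →
      |ampConst α θ ^ 2 * k ^ (1 / (1 - θ))
          * (∑ m ∈ freqRange α θ k Y, (m : ℝ) ^ (-(1 / (1 - θ)) - 1)) - Y|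
        ≤ C * (Y ^ (2 - θ) / k) := by
  have h1 : 0 < 1 - θ := by linarith
  set β := 1 / (1 - θ) with hβ
  have hβ0 : 0 < β := by positivity
  have hβ1 : (θ - 1) * -β = 1 := by rw [hβ]; field_simp; ring
  refine ⟨β * 2 ^ (2 - θ) / (α * θ), by positivity, fun k Y hk hY => ?_⟩
  set W := (α * θ * k) ^ β with hW
  have hW0 : 0 < W := by positivity
  have hg : ∀ y, 0 < y → W * (α * k * θ * y ^ (θ - 1)) ^ (-β) = y := fun y hy => by
    have e1 : α * k * θ * y ^ (θ - 1) = (α * θ * k) * y ^ (θ - 1) := by ring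
    rw [e1, Real.mul_rpow (by positivity) (by positivity), ← Real.rpow_mul hy.le, hβ1, Real.rpow_one,
      Real.rpow_neg (by positivity), ← mul_assoc, mul_inv_cancel₀ hW0.ne', one_mul]
  set lo := α * k * θ * (2 * Y) ^ (θ - 1) with hlo
  set hi := α * k * θ * Y ^ (θ - 1) with hhi
  have hlo0 : 0 < lo := by positivity
  have hle : lo ≤ hi := by
    rw [hlo, hhi]; gcongr ?_ * ?_
    exact Real.rpow_le_rpow_of_nonpos hY (by linarith) (by linarith)
  have h := abs_sum_rpow_neg_sub_le hβ0 hlo0 hle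
  have hs : ampConst α θ ^ 2 * k ^ β = β * W := by
    rw [ampConst, Real.sq_sqrt (by positivity), hW, Real.mul_rpow (by positivity) hk.le, ← hβ,
      div_eq_mul_one_div, ← hβ]; ring
  have e1 : ampConst α θ ^ 2 * k ^ β * (∑ m ∈ freqRange α θ k Y, (m : ℝ) ^ (-β - 1)) - Y
      = W * ((∑ m ∈ Finset.Ico ⌈lo⌉₊ ⌈hi⌉₊, β * (m : ℝ) ^ (-β - 1)) - (lo ^ (-β) - hi ^ (-β))) := by
    rw [hs, freqRange, ← Finset.mul_sum, mul_sub, mul_sub, hg (2 * Y) (by positivity), hg Y hY]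
    ring
  rw [e1, abs_mul, abs_of_pos hW0]
  refine (mul_le_mul_of_nonneg_left h hW0.le).trans (le_of_eq ?_)
  rw [Real.rpow_sub_one hlo0.ne']
  have e2 : W * (β * (lo ^ (-β) / lo)) = β * (W * lo ^ (-β)) / lo := by ring
  have e3 : (2 : ℝ) ^ (2 - θ) * Y ^ (2 - θ) = (2 * Y) ^ (2 - θ) :=
    (Real.mul_rpow (by norm_num) hY.le).symm
  have e4 : (2 * Y) ^ (2 - θ) * (2 * Y) ^ (θ - 1) = 2 * Y := by
    rw [← Real.rpow_add (by positivity)]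
    have : 2 - θ + (θ - 1) = 1 := by ring
    rw [this, Real.rpow_one]
  have e5 : 0 < (2 * Y) ^ (θ - 1) := by positivity
  rw [e2, hg (2 * Y) (by positivity), hlo, div_mul_div_comm, mul_assoc β (2 ^ (2 - θ)), e3,
    div_eq_div_iff (by positivity) (by positivity)]
  linear_combination (- β * α * θ * k) * e4

/-- The block lengths add up to `N - N/2^J`, which is within `1` of `N`. -/
theorem exists_diagSum {α θ : ℝ} (hα : 0 < α) (hθ₀ : 0 < θ) (hθ₁ : θ < 1) :
    ∃ C : ℝ, 0 < C ∧ ∀ N k : ℕ, 1 ≤ N → 1 ≤ k →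
      |ampConst α θ ^ 2 * (k : ℝ) ^ (1 / (1 - θ)) * diagSum α θ N k - N|
        ≤ 1 + C * ((N : ℝ) ^ (2 - θ) / k) := by
  obtain ⟨C₁, hC₁, h₁⟩ := exists_diag_dyadic hα hθ₀ hθ₁
  obtain ⟨C₂, hC₂, h₂⟩ := exists_sum_dyadic_rpow_le (s := 2 - θ) (by linarith)
  refine ⟨C₁ * C₂, by positivity, fun N k hN hk => ?_⟩
  have hN1 : (1 : ℝ) ≤ N := by exact_mod_cast hN
  have hk0 : (0 : ℝ) < k := by exact_mod_cast hk
  have hsum : |(∑ Y ∈ dyadic (N : ℝ), Y) - N| ≤ 1 := by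
    rw [sum_dyadic hN1]
    have key : ∀ J : ℕ, ∑ j ∈ Finset.range J, (N : ℝ) / 2 ^ (j + 1) = N - N / 2 ^ J := by
      intro J
      induction J with
      | zero => simp
      | succ J ih => rw [Finset.sum_range_succ, ih, pow_succ]; field_simp; ring
    rw [key, Nat.floor_natCast]
    have h2 : N < 2 ^ (Nat.log 2 N + 1) := Nat.lt_pow_succ_log_self (by norm_num) N
    have h3 : (N : ℝ) < 2 ^ (Nat.log 2 N + 1) := by exact_mod_cast h2
    have h4 : (N : ℝ) / 2 ^ (Nat.log 2 N + 1) < 1 := by rw [div_lt_one (by positivity)]; exact h3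
    have h5 : (0 : ℝ) ≤ (N : ℝ) / 2 ^ (Nat.log 2 N + 1) := by positivity
    rw [abs_le]; constructor <;> linarith
  have hmain : |ampConst α θ ^ 2 * (k : ℝ) ^ (1 / (1 - θ)) * diagSum α θ N k
      - ∑ Y ∈ dyadic (N : ℝ), Y| ≤ C₁ * C₂ * ((N : ℝ) ^ (2 - θ) / k) := by
    rw [diagSum, Finset.mul_sum, ← Finset.sum_sub_distrib]
    refine (Finset.abs_sum_le_sum_abs _ _).trans ?_
    refine (Finset.sum_le_sum fun Y hY => h₁ k Y hk0
      (by linarith [half_le_of_mem_dyadic hN1 hY])).trans ?_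
    rw [← Finset.mul_sum, ← Finset.sum_div]
    refine (mul_le_mul_of_nonneg_left (div_le_div_of_nonneg_right (h₂ N hN1) hk0.le)
      hC₁.le).trans (le_of_eq ?_)
    ring
  have := abs_sub_le (ampConst α θ ^ 2 * (k : ℝ) ^ (1 / (1 - θ)) * diagSum α θ N k)
    (∑ Y ∈ dyadic (N : ℝ), Y) N
  linarith

end DyadicTransform

namespace DyadicTransform

/-! ### The second transform -/

theorem c₃_pos {α θ : ℝ} (hα : 0 < α) (hθ₀ : 0 < θ) (hθ₁ : θ < 1) : 0 < c₃ α θ := by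
  have : 1 < 1 / θ := by rw [lt_div_iff₀ hθ₀]; linarith
  have h2 : 0 < 1 / θ - 1 := by linarith
  unfold c₃
  positivity

theorem eta_pos {θ : ℝ} (hθ₀ : 0 < θ) (hθ₁ : θ < 1) {m₁ m₂ : ℕ} (hm : 0 < m₁) (h : m₁ < m₂) :
    0 < eta θ m₁ m₂ := by
  have h1 : 0 < 1 - θ := by linarith
  have hm0 : (0 : ℝ) < m₁ := by exact_mod_cast hm
  rw [eta, sub_pos]
  refine Real.rpow_lt_rpow_of_neg hm0 (by exact_mod_cast h) ?_
  rw [neg_div]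
  exact neg_lt_zero.2 (by positivity)

theorem eta_le_one {θ : ℝ} (hθ₀ : 0 < θ) (hθ₁ : θ < 1) {m₁ m₂ : ℕ} (hm : 0 < m₁) :
    eta θ m₁ m₂ ≤ 1 := by
  have h1 : 0 < 1 - θ := by linarith
  have hm0 : (1 : ℝ) ≤ m₁ := by exact_mod_cast hm
  have h2 : (m₁ : ℝ) ^ (-θ / (1 - θ)) ≤ 1 := by
    refine Real.rpow_le_one_of_one_le_of_nonpos hm0 ?_
    rw [neg_div]
    exact neg_nonpos.2 (by positivity)
  have h3 : (0 : ℝ) ≤ (m₂ : ℝ) ^ (-θ / (1 - θ)) := by positivity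
  rw [eta]; linarith

theorem min_one_mul_le_one_sub_rpow {σ t : ℝ} (hσ : 0 < σ) (ht₀ : 0 ≤ t) (ht₁ : t ≤ 1) :
    min 1 σ * (1 - t) ≤ 1 - t ^ σ := by
  rcases le_total 1 σ with h | h
  · rw [min_eq_left h, one_mul]
    have := Real.rpow_le_rpow_of_exponent_ge' ht₀ ht₁ zero_le_one h
    rw [Real.rpow_one] at this
    linarith
  · rw [min_eq_right h]
    have := rpow_one_add_le_one_add_mul_self (s := t - 1) (by linarith) hσ.le h
    rw [add_sub_cancel] at this
    linarith

/-- A small `η` makes the second phase nearly flat. The factor `(m₂ - m₁)/m₂` measures this loss for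
neighbouring frequencies. -/
theorem le_eta {θ : ℝ} (hθ₀ : 0 < θ) (hθ₁ : θ < 1) {m₁ m₂ : ℕ} (hm : 0 < m₁) (h : m₁ < m₂) :
    min 1 (θ / (1 - θ)) * ((m₁ : ℝ) ^ (-θ / (1 - θ)) * (((m₂ : ℝ) - m₁) / m₂)) ≤ eta θ m₁ m₂ := by
  have h1 : 0 < 1 - θ := by linarith
  have hm1 : (0 : ℝ) < m₁ := by exact_mod_cast hm
  have hlt : (m₁ : ℝ) < m₂ := by exact_mod_cast h
  have hm2 : (0 : ℝ) < m₂ := hm1.trans hlt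
  have hσ : 0 < θ / (1 - θ) := by positivity
  have key := min_one_mul_le_one_sub_rpow hσ (t := m₁ / m₂) (by positivity)
    ((div_le_one hm2).2 hlt.le)
  have e1 : 1 - (m₁ : ℝ) / m₂ = (m₂ - m₁) / m₂ := by field_simp
  have e2 : eta θ m₁ m₂ = (m₁ : ℝ) ^ (-θ / (1 - θ)) * (1 - ((m₁ : ℝ) / m₂) ^ (θ / (1 - θ))) := by
    rw [eta, Real.div_rpow hm1.le hm2.le, neg_div, Real.rpow_neg hm1.le, Real.rpow_neg hm2.le]
    have := Real.rpow_pos_of_pos hm1 (θ / (1 - θ))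
    field_simp
  rw [e1] at key
  rw [e2, mul_left_comm]
  gcongr

/-- For the exponent `1/(1-θ)` the stationary point is `((1-θ)ℓ/(c₃η))^(1/θ-1)`. Its amplitude and
phase are the source of `c₁` and `c₂`. -/
theorem statTerm_eq_innerTerm {α θ : ℝ} (hα : 0 < α) (hθ₀ : 0 < θ) (hθ₁ : θ < 1) {m₁ m₂ ℓ : ℕ}
    (hη : 0 < eta θ m₁ m₂) (hℓ : 0 < ℓ) :
    statTerm (c₃ α θ * eta θ m₁ m₂) (1 / (1 - θ)) ℓ = innerTerm α θ m₁ m₂ ℓ := by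
  have h1 : 0 < 1 - θ := by linarith
  have hc := c₃_pos hα hθ₀ hθ₁
  have hl : (0 : ℝ) < ℓ := by exact_mod_cast hℓ
  set η := eta θ m₁ m₂ with hηd
  set q := (1 - θ) / c₃ α θ with hq
  have hq0 : 0 < q := by positivity
  set r := (ℓ : ℝ) / η with hr
  have hr0 : 0 < r := by positivity
  have e1 : 1 / (1 / (1 - θ) - 1) = 1 / θ - 1 := by
    have : 1 / (1 - θ) - 1 = θ / (1 - θ) := by field_simp; ring
    rw [this]; field_simp
  have e2 : |1 / (1 - θ) - 1| = θ / (1 - θ) := by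
    have : 1 / (1 - θ) - 1 = θ / (1 - θ) := by field_simp; ring
    rw [this, abs_of_pos (by positivity)]
  have e3 : (ℓ : ℝ) / (c₃ α θ * η * (1 / (1 - θ))) = q * r := by
    rw [hq, hr]; field_simp
  have hpt : statPt (c₃ α θ * η) (1 / (1 - θ)) ℓ = q ^ (1 / θ - 1) * r ^ (1 / θ - 1) := by
    rw [statPt, e1, e3, Real.mul_rpow hq0.le hr0.le]
  rw [statTerm, innerTerm, hpt, e2, ← hηd, ← hr]
  congr 2
  · have f1 : q ^ (1 / θ - 1) * r ^ (1 / θ - 1) / (ℓ * (θ / (1 - θ)))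
        = (c₁ α θ / √η * r ^ (1 / (2 * θ) - 1)) ^ 2 := by
      have g : ∀ x : ℝ, 0 < x → x ^ (1 / θ - 1) = (x ^ (1 / (2 * θ) - 1)) ^ 2 * x := by
        intro x hx
        rw [← Real.rpow_natCast (x ^ _), ← Real.rpow_mul hx.le]
        nth_rewrite 3 [← Real.rpow_one x]
        rw [← Real.rpow_add hx]
        congr 1
        push_cast; field_simp; ring
      rw [c₁, ← hq, g q hq0, g r hr0, mul_pow, div_pow, mul_pow, div_pow, Real.sq_sqrt hη.le,
        Real.sq_sqrt (by positivity)]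
      have := Real.rpow_pos_of_pos hq0 (1 / (2 * θ) - 1)
      have := Real.rpow_pos_of_pos hr0 (1 / (2 * θ) - 1)
      nth_rewrite 2 [hq]
      nth_rewrite 2 [hr]
      field_simp
    have f2 : 0 ≤ c₁ α θ / √η * r ^ (1 / (2 * θ) - 1) := by
      rw [c₁, ← hq]; positivity
    rw [f1, Real.sqrt_sq f2]
  · rw [c₂, ← hq, hr, Real.div_rpow hl.le hη.le]
    have f1 : (ℓ : ℝ) ^ (1 / θ) = ℓ * (ℓ : ℝ) ^ (1 / θ - 1) := by
      rw [Real.rpow_sub_one hl.ne']; field_simp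
    have f2 : η ^ (1 - 1 / θ) = (η ^ (1 / θ - 1))⁻¹ := by
      rw [← Real.rpow_neg hη.le]; congr 1; ring
    have f3 : 1 / (1 / (1 - θ)) - 1 = -θ := by field_simp; ring
    rw [f1, f2, f3]
    ring

/-- Solved for `k`, the condition on the frequency gives the bounds that enter `K₁` and `K₂`. -/
theorem mem_freqRange_iff {α θ k Y : ℝ} (hα : 0 < α) (hθ₀ : 0 < θ) (hY : 0 < Y) {m : ℕ} :
    m ∈ freqRange α θ k Y ↔
      k ≤ m / (α * θ * (2 * Y) ^ (θ - 1)) ∧ m / (α * θ * Y ^ (θ - 1)) < k := by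
  rw [mem_freqRange, le_div_iff₀ (by positivity), div_lt_iff₀ (by positivity)]
  have e1 : α * k * θ * (2 * Y) ^ (θ - 1) = k * (α * θ * (2 * Y) ^ (θ - 1)) := by ring
  have e2 : α * k * θ * Y ^ (θ - 1) = k * (α * θ * Y ^ (θ - 1)) := by ring
  rw [e1, e2]

/-- A range free of `k`, needed to exchange the sum over `k` with the sum over pairs. -/
theorem freqRange_subset_mRange {α θ K k Y : ℝ} (hα : 0 < α) (hθ₀ : 0 < θ) (hY : 0 < Y)
    (h₁ : K ≤ k) (h₂ : k ≤ 2 * K) : freqRange α θ k Y ⊆ mRange α θ K Y := by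
  intro m hm
  rw [mem_freqRange] at hm
  rw [mem_mRange]
  have p1 : 0 < α * θ * (2 * Y) ^ (θ - 1) := by positivity
  have p2 : 0 < α * θ * Y ^ (θ - 1) := by positivity
  constructor
  · nlinarith
  · nlinarith

theorem dualTerm_mul_conj {α θ k : ℝ} (m₁ m₂ : ℕ) :
    dualTerm α θ k m₁ * (starRingEnd ℂ) (dualTerm α θ k m₂)
      = ((1 / ((m₁ : ℝ) * (m₂ : ℝ))) ^ ((2 - θ) / (2 - 2 * θ)) : ℝ)
        * e (c₃ α θ * eta θ m₁ m₂ * k ^ (1 / (1 - θ))) := by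
  have e1 : e (c₃ α θ * eta θ m₁ m₂ * k ^ (1 / (1 - θ)))
      = e (c₃ α θ * k ^ (1 / (1 - θ)) * (m₁ : ℝ) ^ (-θ / (1 - θ)))
        * (starRingEnd ℂ) (e (c₃ α θ * k ^ (1 / (1 - θ)) * (m₂ : ℝ) ^ (-θ / (1 - θ)))) := by
    rw [conj_e, ← e_add, eta]; congr 1; ring
  have e2 : (1 / ((m₁ : ℝ) * (m₂ : ℝ))) ^ ((2 - θ) / (2 - 2 * θ))
      = (m₁ : ℝ) ^ (-((2 - θ) / (2 - 2 * θ))) * (m₂ : ℝ) ^ (-((2 - θ) / (2 - 2 * θ))) := by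
    rw [one_div, Real.inv_rpow (by positivity), Real.mul_rpow (by positivity) (by positivity),
      mul_inv, Real.rpow_neg (by positivity), Real.rpow_neg (by positivity)]
  rw [dualTerm, dualTerm, map_mul, Complex.conj_ofReal, e1, e2, Complex.ofReal_mul]
  ring

theorem pos_of_mem_mRange {α θ K Y : ℝ} (hα : 0 < α) (hθ₀ : 0 < θ) (hK : 0 < K) (hY : 0 < Y)
    {m : ℕ} (hm : m ∈ mRange α θ K Y) : 0 < m := by
  have h := ((mem_mRange α θ K Y m).1 hm).1
  have : 0 < α * θ * K * (2 * Y) ^ (θ - 1) := by positivity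
  exact_mod_cast this.trans_le h

/-- For a fixed pair, the conditions on `k` amount to `K₁ < k ≤ K₂`; their half-open form matches
the floors exactly. -/
theorem sum_offDiag {α θ K Kt Y₁ Y₂ : ℝ} (hα : 0 < α) (hθ₀ : 0 < θ) (hK : 0 < K)
    (hY₁ : 0 < Y₁) (hY₂ : 0 < Y₂) (hKt : Kt ∈ Set.Icc K (2 * K)) :
    ∑ k ∈ Finset.Ioc ⌊K⌋₊ ⌊Kt⌋₊, offDiag α θ k Y₁ Y₂
      = ∑ p ∈ pairs α θ K Y₁ Y₂,
        ((1 / ((p.1 : ℝ) * (p.2 : ℝ))) ^ ((2 - θ) / (2 - 2 * θ)) : ℝ)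
          * ∑ k ∈ Finset.Ioc ⌊K₁ α θ K Y₁ Y₂ p.1 p.2⌋₊ ⌊K₂ α θ Kt Y₁ Y₂ p.1 p.2⌋₊,
            e (c₃ α θ * eta θ p.1 p.2 * (k : ℝ) ^ (1 / (1 - θ))) := by
  have hKt0 : 0 < Kt := hK.trans_le hKt.1
  simp_rw [offDiag, dualTerm_mul_conj, Finset.mul_sum]
  refine Finset.sum_comm' fun k p => ?_
  have h1 : 0 ≤ K₁ α θ K Y₁ Y₂ p.1 p.2 := hK.le.trans (le_max_left _ _)
  have h2 : 0 ≤ K₂ α θ Kt Y₁ Y₂ p.1 p.2 := by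
    unfold K₂
    refine le_min hKt0.le (le_min ?_ ?_) <;> positivity
  rw [Finset.mem_Ioc, Finset.mem_Ioc, Nat.floor_lt h1, Nat.le_floor_iff h2, Nat.floor_lt hK.le,
    Nat.le_floor_iff hKt0.le, pairs, Finset.mem_filter, Finset.mem_filter, Finset.mem_product,
    Finset.mem_product, mem_freqRange_iff hα hθ₀ hY₁, mem_freqRange_iff hα hθ₀ hY₂, K₁, K₂,
    max_lt_iff, max_lt_iff, le_min_iff, le_min_iff]
  constructor
  · rintro ⟨⟨a1, a2⟩, ⟨⟨b1, b2⟩, c1, c2⟩, hlt⟩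
    refine ⟨⟨⟨a1, b2, c2⟩, a2, b1, c1⟩, ⟨?_, ?_⟩, hlt⟩
    · exact freqRange_subset_mRange hα hθ₀ hY₁ a1.le (a2.trans hKt.2)
        ((mem_freqRange_iff hα hθ₀ hY₁).2 ⟨b1, b2⟩)
    · exact freqRange_subset_mRange hα hθ₀ hY₂ a1.le (a2.trans hKt.2)
        ((mem_freqRange_iff hα hθ₀ hY₂).2 ⟨c1, c2⟩)
  · rintro ⟨⟨⟨a1, b2, c2⟩, a2, b1, c1⟩, _, hlt⟩
    exact ⟨⟨a1, a2⟩, ⟨⟨b1, b2⟩, c1, c2⟩, hlt⟩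

/-- The error of the second transform. -/
noncomputable def pairErr (α θ K Y₁ Y₂ : ℝ) : ℝ :=
  ∑ p ∈ pairs α θ K Y₁ Y₂, (1 / ((p.1 : ℝ) * (p.2 : ℝ))) ^ ((2 - θ) / (2 - 2 * θ))
    * ((√(c₃ α θ * eta θ p.1 p.2 * K ^ (1 / (1 - θ) - 2)))⁻¹
      + Real.log (2 + c₃ α θ * eta θ p.1 p.2 * K ^ (1 / (1 - θ) - 1)))

/-- For each pair, the `B`-process with exponent `1/(1-θ) > 1` and coefficient `c₃η`. The derivative
now increases, so its values at `K₁` and `K₂` are `L` and `L̃`. The unimodular constant is common to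
all pairs and disappears in the norm. -/
theorem exists_norm_sum_offDiag_le {α θ : ℝ} (hα : 0 < α) (hθ₀ : 0 < θ) (hθ₁ : θ < 1) :
    ∃ C : ℝ, 0 < C ∧ ∀ K Y₁ Y₂ : ℝ, 0 < K → 0 < Y₁ → 0 < Y₂ → ∀ Kt ∈ Set.Icc K (2 * K),
      ‖∑ k ∈ Finset.Ioc ⌊K⌋₊ ⌊Kt⌋₊, offDiag α θ k Y₁ Y₂‖
        ≤ maxStilde α θ K Y₁ Y₂ + C * pairErr α θ K Y₁ Y₂ := by
  have h1 : 0 < 1 - θ := by linarith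
  have hσ : 1 / (1 - θ) - 1 = θ / (1 - θ) := by field_simp; ring
  have hσ0 : 0 < θ / (1 - θ) := by positivity
  obtain ⟨C, hC, ζ, hζ, h⟩ := exists_bprocess (β := 1 / (1 - θ)) (by positivity)
    (by intro h; rw [h] at hσ; linarith)
  refine ⟨C, hC, fun K Y₁ Y₂ hK hY₁ hY₂ Kt hKt => ?_⟩
  have hc := c₃_pos hα hθ₀ hθ₁
  have hmax : ‖Stilde α θ K Kt Y₁ Y₂‖ ≤ maxStilde α θ K Y₁ Y₂ :=
    (isGreatest_maxStilde hα hθ₀ hθ₁ hK hY₁ hY₂).2 ⟨Kt, hKt, rfl⟩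
  suffices hs : ‖(∑ k ∈ Finset.Ioc ⌊K⌋₊ ⌊Kt⌋₊, offDiag α θ k Y₁ Y₂) - ζ * Stilde α θ K Kt Y₁ Y₂‖
      ≤ C * pairErr α θ K Y₁ Y₂ by
    have := norm_add_le ((∑ k ∈ Finset.Ioc ⌊K⌋₊ ⌊Kt⌋₊, offDiag α θ k Y₁ Y₂)
      - ζ * Stilde α θ K Kt Y₁ Y₂) (ζ * Stilde α θ K Kt Y₁ Y₂)
    rw [sub_add_cancel, norm_mul, hζ, one_mul] at this
    linarith
  rw [sum_offDiag hα hθ₀ hK hY₁ hY₂ hKt, Stilde, Finset.mul_sum, ← Finset.sum_sub_distrib, pairErr,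
    Finset.mul_sum]
  refine norm_sum_le_of_le _ ?_
  rintro ⟨m₁, m₂⟩ hp
  rw [pairs, Finset.mem_filter, Finset.mem_product] at hp
  obtain ⟨⟨hp1, hp2⟩, hlt⟩ := hp
  dsimp only at hp1 hp2 hlt ⊢
  have hm1 := pos_of_mem_mRange hα hθ₀ hK hY₁ hp1
  have hη := eta_pos hθ₀ hθ₁ hm1 hlt
  set G : ℝ := (1 / ((m₁ : ℝ) * (m₂ : ℝ))) ^ ((2 - θ) / (2 - 2 * θ)) with hG
  have hG0 : 0 ≤ G := by positivity
  set A := c₃ α θ * eta θ m₁ m₂ with hA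
  have hA0 : 0 < A := by positivity
  set a := K₁ α θ K Y₁ Y₂ m₁ m₂ with ha
  set b := K₂ α θ Kt Y₁ Y₂ m₁ m₂ with hb
  have hKa : K ≤ a := le_max_left _ _
  have hbK : b ≤ 2 * K := (min_le_left _ _).trans hKt.2
  have hb0 : 0 ≤ b := by
    rw [hb, K₂]
    have : 0 < Kt := hK.trans_le hKt.1
    refine le_min this.le (le_min ?_ ?_) <;> positivity
  have hL : Llow α θ K Y₁ Y₂ m₁ m₂ = A * (1 / (1 - θ)) * a ^ (1 / (1 - θ) - 1) := by
    rw [Llow, hσ, ← ha, ← hA]; ring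
  have hU : Lup α θ Kt Y₁ Y₂ m₁ m₂ = A * (1 / (1 - θ)) * b ^ (1 / (1 - θ) - 1) := by
    rw [Lup, hσ, ← hb, ← hA]; ring
  have key : ‖(∑ k ∈ Finset.Ioc ⌊a⌋₊ ⌊b⌋₊, e (A * (k : ℝ) ^ (1 / (1 - θ))))
      - ζ * ∑ ℓ ∈ Finset.Ico ⌈Llow α θ K Y₁ Y₂ m₁ m₂⌉₊ ⌈Lup α θ Kt Y₁ Y₂ m₁ m₂⌉₊,
        innerTerm α θ m₁ m₂ ℓ‖
      ≤ C * ((√(A * K ^ (1 / (1 - θ) - 2)))⁻¹ + Real.log (2 + A * K ^ (1 / (1 - θ) - 1))) := by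
    rcases le_total a b with hab | hab
    · have ha0 : 0 ≤ a := hK.le.trans hKa
      have h3 := h A K a b hA0 hK hKa hab hbK
      have hmono : A * (1 / (1 - θ)) * a ^ (1 / (1 - θ) - 1)
          ≤ A * (1 / (1 - θ)) * b ^ (1 / (1 - θ) - 1) := by
        rw [hσ]
        gcongr
      rw [min_eq_left hmono, max_eq_right hmono] at h3
      rw [hL, hU]
      rw [Finset.sum_congr rfl fun ℓ hℓ => (statTerm_eq_innerTerm hα hθ₀ hθ₁ hη (?_)).symm]
      · exact h3
      · have : 0 < A * (1 / (1 - θ)) * a ^ (1 / (1 - θ) - 1) := by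
          have : 0 < a := hK.trans_le hKa
          positivity
        exact lt_of_lt_of_le (Nat.ceil_pos.2 this) (Finset.mem_Ico.1 hℓ).1
    -- For `K₂ ≤ K₁` both the original and the transformed sum are empty.
    · rw [Finset.Ioc_eq_empty_of_le (Nat.floor_le_floor hab), Finset.Ico_eq_empty_of_le]
      · simp only [Finset.sum_empty, mul_zero, sub_zero, norm_zero]
        have : 0 ≤ Real.log (2 + A * K ^ (1 / (1 - θ) - 1)) := by
          refine Real.log_nonneg ?_
          have : 0 < A * K ^ (1 / (1 - θ) - 1) := by positivity
          linarith
        positivity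
      · refine Nat.ceil_le_ceil ?_
        rw [hL, hU, hσ]
        gcongr
  have e1 : (G : ℂ) * (∑ k ∈ Finset.Ioc ⌊a⌋₊ ⌊b⌋₊, e (A * (k : ℝ) ^ (1 / (1 - θ))))
      - ζ * ((G : ℂ) * ∑ ℓ ∈ Finset.Ico ⌈Llow α θ K Y₁ Y₂ m₁ m₂⌉₊ ⌈Lup α θ Kt Y₁ Y₂ m₁ m₂⌉₊,
        innerTerm α θ m₁ m₂ ℓ)
      = G * ((∑ k ∈ Finset.Ioc ⌊a⌋₊ ⌊b⌋₊, e (A * (k : ℝ) ^ (1 / (1 - θ))))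
      - ζ * ∑ ℓ ∈ Finset.Ico ⌈Llow α θ K Y₁ Y₂ m₁ m₂⌉₊ ⌈Lup α θ Kt Y₁ Y₂ m₁ m₂⌉₊,
        innerTerm α θ m₁ m₂ ℓ) := by ring
  rw [e1, norm_mul, Complex.norm_real, Real.norm_of_nonneg hG0, mul_left_comm]
  exact mul_le_mul_of_nonneg_left key hG0

end DyadicTransform

namespace DyadicTransform

/-! ### The error of the second transform -/

theorem sum_one_div_mul_le (n : ℕ) :
    ∑ p ∈ (Finset.Icc 1 n ×ˢ Finset.Icc 1 n).filter (fun p : ℕ × ℕ => p.1 < p.2),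
      1 / ((p.1 : ℝ) * p.2) ≤ harm n ^ 2 := by
  have e1 : harm n = ∑ m ∈ Finset.Icc 1 n, 1 / (m : ℝ) := by
    rw [harm, Finset.range_eq_Ico, ← Finset.Ico_add_one_right_eq_Icc,
      ← Finset.sum_Ico_add' (fun m : ℕ => 1 / (m : ℝ)) 0 n 1]
    simp
  rw [e1, sq, Finset.sum_mul_sum, ← Finset.sum_product']
  refine (Finset.sum_le_sum_of_subset_of_nonneg (Finset.filter_subset _ _)
    fun _ _ _ => by positivity).trans (le_of_eq ?_)
  refine Finset.sum_congr rfl fun p _ => ?_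
  rw [one_div_mul_one_div]

/-- The involution `(m₁, m₂) ↦ (m₂ - m₁, m₂)` reduces this to `sum_one_div_mul_le`. -/
theorem sum_one_div_mul_sub_le (n : ℕ) :
    ∑ p ∈ (Finset.Icc 1 n ×ˢ Finset.Icc 1 n).filter (fun p : ℕ × ℕ => p.1 < p.2),
      1 / (((p.2 : ℝ) - p.1) * p.2) ≤ harm n ^ 2 := by
  refine le_trans (le_of_eq ?_) (sum_one_div_mul_le n)
  refine Finset.sum_nbij' (fun p => (p.2 - p.1, p.2)) (fun p => (p.2 - p.1, p.2)) ?_ ?_ ?_ ?_ ?_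
  · rintro ⟨a, b⟩ h
    simp only [Finset.mem_filter, Finset.mem_product, Finset.mem_Icc] at h ⊢
    omega
  · rintro ⟨a, b⟩ h
    simp only [Finset.mem_filter, Finset.mem_product, Finset.mem_Icc] at h ⊢
    omega
  · rintro ⟨a, b⟩ h
    simp only [Finset.mem_filter, Finset.mem_product, Finset.mem_Icc] at h ⊢
    ext
    · dsimp only; omega
    · rfl
  · rintro ⟨a, b⟩ h
    simp only [Finset.mem_filter, Finset.mem_product, Finset.mem_Icc] at h ⊢
    ext
    · dsimp only; omega
    · rfl
  · rintro ⟨a, b⟩ h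
    simp only [Finset.mem_filter, Finset.mem_product, Finset.mem_Icc] at h ⊢
    rw [Nat.cast_sub h.2.le]

/-- Dropping the root, as `y/(y-x) ≥ 1`, leaves `y/(x(y-x))`, which splits into partial fractions.
-/
theorem sqrt_div_sub_div_le {x y : ℝ} (hx : 0 < x) (hxy : x < y) :
    √(y / (y - x)) / x ≤ 1 / x + 1 / (y - x) := by
  have hd : 0 < y - x := by linarith
  have hy : 0 < y := hx.trans hxy
  have h1 : √(y / (y - x)) ≤ y / (y - x) := by
    rw [Real.sqrt_le_left (by positivity), sq]
    refine le_mul_of_one_le_left (by positivity) ?_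
    rw [one_le_div hd]; linarith
  refine (div_le_div_of_nonneg_right h1 hx.le).trans (le_of_eq ?_)
  field_simp
  ring

theorem le_of_mem_mRange {α θ K Y : ℝ} (hα : 0 < α) (hθ₀ : 0 < θ) (hθ₁ : θ < 1) (hK : 0 < K)
    (hY : 1 / 2 ≤ Y) {m : ℕ} (hm : m ∈ mRange α θ K Y) : (m : ℝ) ≤ 4 * α * θ * K := by
  have h := ((mem_mRange α θ K Y m).1 hm).2
  have h2 : Y ^ (θ - 1) ≤ 2 := by
    have h3 := Real.rpow_le_rpow_of_nonpos (by norm_num) hY (by linarith : θ - 1 ≤ 0)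
    have h4 : (1 / 2 : ℝ) ^ (θ - 1) = 2 ^ (1 - θ) := by
      rw [one_div, Real.inv_rpow (by norm_num), ← Real.rpow_neg (by norm_num), neg_sub]
    have h5 : (2 : ℝ) ^ (1 - θ) ≤ 2 ^ (1 : ℝ) :=
      Real.rpow_le_rpow_of_exponent_le (by norm_num) (by linarith)
    rw [Real.rpow_one] at h5
    linarith
  have h3 : 2 * α * θ * K * Y ^ (θ - 1) ≤ 2 * α * θ * K * 2 := by gcongr
  linarith

/-- The exponent is `-θ/(2(1-θ)) - 1`. The first power is estimated at the lower end of the range;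
`1/m` is kept for a harmonic sum. -/
theorem rpow_neg_le_of_mem_mRange {α θ K Y : ℝ} (hα : 0 < α) (hθ₀ : 0 < θ) (hθ₁ : θ < 1)
    (hK : 0 < K) (hY : 0 < Y) {m : ℕ} (hm : m ∈ mRange α θ K Y) :
    (m : ℝ) ^ (-((2 - θ) / (2 - 2 * θ))) ≤
      ((α * θ) ^ (-(θ / (2 * (1 - θ)))) * K ^ (-(θ / (2 * (1 - θ)))) * (2 * Y) ^ (θ / 2))
        * (1 / m) := by
  have h1 : 0 < 1 - θ := by linarith
  have hm0 : (0 : ℝ) < m := by exact_mod_cast pos_of_mem_mRange hα hθ₀ hK hY hm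
  have h := ((mem_mRange α θ K Y m).1 hm).1
  have e1 : -((2 - θ) / (2 - 2 * θ)) = -(θ / (2 * (1 - θ))) - 1 := by
    have : 2 - 2 * θ = 2 * (1 - θ) := by ring
    rw [this]; field_simp; ring
  have h2 : (m : ℝ) ^ (-(θ / (2 * (1 - θ))))
      ≤ (α * θ * K * (2 * Y) ^ (θ - 1)) ^ (-(θ / (2 * (1 - θ)))) :=
    Real.rpow_le_rpow_of_nonpos (by positivity) h (neg_nonpos.2 (by positivity))
  have e2 : (α * θ * K * (2 * Y) ^ (θ - 1)) ^ (-(θ / (2 * (1 - θ))))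
      = (α * θ) ^ (-(θ / (2 * (1 - θ)))) * K ^ (-(θ / (2 * (1 - θ)))) * (2 * Y) ^ (θ / 2) := by
    rw [Real.mul_rpow (by positivity) (by positivity), Real.mul_rpow (by positivity) hK.le,
      ← Real.rpow_mul (by positivity)]
    congr 2
    field_simp; ring
  rw [e1, Real.rpow_sub_one hm0.ne', div_eq_mul_one_div, ← e2]
  gcongr

/-- One term of the first part of the error. -/
theorem pair_sqrt_le {α θ K Y₁ Y₂ : ℝ} (hα : 0 < α) (hθ₀ : 0 < θ) (hθ₁ : θ < 1) (hK : 0 < K)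
    (hY₁ : 0 < Y₁) (hY₂ : 0 < Y₂) {m₁ m₂ : ℕ} (hm₁ : m₁ ∈ mRange α θ K Y₁)
    (hm₂ : m₂ ∈ mRange α θ K Y₂) (hlt : m₁ < m₂) :
    (1 / ((m₁ : ℝ) * (m₂ : ℝ))) ^ ((2 - θ) / (2 - 2 * θ))
        * (√(c₃ α θ * eta θ m₁ m₂ * K ^ (1 / (1 - θ) - 2)))⁻¹
      ≤ (√(c₃ α θ * min 1 (θ / (1 - θ))))⁻¹ * (α * θ) ^ (-(θ / (2 * (1 - θ))))
        * (K ^ (3 / 2 - 1 / (1 - θ)) * (2 * Y₂) ^ (θ / 2))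
        * (1 / ((m₁ : ℝ) * m₂) + 1 / (((m₂ : ℝ) - m₁) * m₂)) := by
  have h1 : 0 < 1 - θ := by linarith
  have hσ0 : 0 < θ / (1 - θ) := by positivity
  have hc := c₃_pos hα hθ₀ hθ₁
  have hpos := pos_of_mem_mRange hα hθ₀ hK hY₁ hm₁
  have hm1 : (0 : ℝ) < m₁ := by exact_mod_cast hpos
  have hltr : (m₁ : ℝ) < m₂ := by exact_mod_cast hlt
  have hm2 : (0 : ℝ) < m₂ := hm1.trans hltr
  have hd : (0 : ℝ) < (m₂ : ℝ) - m₁ := by linarith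
  set μ := min 1 (θ / (1 - θ)) with hμ
  have hμ0 : 0 < μ := lt_min one_pos hσ0
  have hη := le_eta hθ₀ hθ₁ hpos hlt
  rw [← hμ] at hη
  -- The amplitude contains `q/m₁`, while `1/√η` contributes `1/q`. They cancel, which is why `Y₁`
  -- is absent from the bound.
  set q : ℝ := (m₁ : ℝ) ^ (-(θ / (2 * (1 - θ)))) with hq
  have hq0 : 0 < q := by positivity
  set κ : ℝ := K ^ (1 / (2 * (1 - θ)) - 1) with hκ
  have hκ0 : 0 < κ := by positivity
  have eq1 : (m₁ : ℝ) ^ (-θ / (1 - θ)) = q ^ 2 := by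
    rw [hq, ← Real.rpow_natCast, ← Real.rpow_mul hm1.le]; congr 1; push_cast; field_simp
  have eκ : K ^ (1 / (1 - θ) - 2) = κ ^ 2 := by
    rw [hκ, ← Real.rpow_natCast, ← Real.rpow_mul hK.le]; congr 1; push_cast; field_simp
  have hsq : √(c₃ α θ * μ) * (q * κ * √(((m₂ : ℝ) - m₁) / m₂))
      ≤ √(c₃ α θ * eta θ m₁ m₂ * K ^ (1 / (1 - θ) - 2)) := by
    refine Real.le_sqrt_of_sq_le ?_
    rw [mul_pow, mul_pow, mul_pow, Real.sq_sqrt (by positivity), Real.sq_sqrt (by positivity), eκ]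
    rw [eq1] at hη
    calc c₃ α θ * μ * (q ^ 2 * κ ^ 2 * (((m₂ : ℝ) - m₁) / m₂))
        = c₃ α θ * (μ * (q ^ 2 * (((m₂ : ℝ) - m₁) / m₂))) * κ ^ 2 := by ring
      _ ≤ _ := by gcongr
  have hinv : (√(c₃ α θ * eta θ m₁ m₂ * K ^ (1 / (1 - θ) - 2)))⁻¹
      ≤ (√(c₃ α θ * μ))⁻¹ * (q⁻¹ * κ⁻¹ * √((m₂ : ℝ) / (m₂ - m₁))) := by
    refine (inv_anti₀ (by positivity) hsq).trans (le_of_eq ?_)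
    have : √((m₂ : ℝ) / (m₂ - m₁)) = (√(((m₂ : ℝ) - m₁) / m₂))⁻¹ := by
      rw [← Real.sqrt_inv, inv_div]
    rw [this, mul_inv, mul_inv, mul_inv]
  have e2 : (1 / ((m₁ : ℝ) * (m₂ : ℝ))) ^ ((2 - θ) / (2 - 2 * θ))
      = (m₁ : ℝ) ^ (-((2 - θ) / (2 - 2 * θ))) * (m₂ : ℝ) ^ (-((2 - θ) / (2 - 2 * θ))) := by
    rw [one_div, Real.inv_rpow (by positivity), Real.mul_rpow (by positivity) (by positivity),
      mul_inv, Real.rpow_neg (by positivity), Real.rpow_neg (by positivity)]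
  have e3 : (m₁ : ℝ) ^ (-((2 - θ) / (2 - 2 * θ))) = q * (1 / m₁) := by
    have e1 : -((2 - θ) / (2 - 2 * θ)) = -(θ / (2 * (1 - θ))) - 1 := by
      have : 2 - 2 * θ = 2 * (1 - θ) := by ring
      rw [this]; field_simp; ring
    rw [e1, Real.rpow_sub_one hm1.ne', hq, div_eq_mul_one_div]
  have hb := rpow_neg_le_of_mem_mRange hα hθ₀ hθ₁ hK hY₂ hm₂
  have eK : K ^ (3 / 2 - 1 / (1 - θ)) = K ^ (-(θ / (2 * (1 - θ)))) * κ⁻¹ := by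
    rw [hκ, ← Real.rpow_neg hK.le, ← Real.rpow_add hK]; congr 1; field_simp; ring
  rw [e2, e3]
  calc q * (1 / m₁) * (m₂ : ℝ) ^ (-((2 - θ) / (2 - 2 * θ)))
        * (√(c₃ α θ * eta θ m₁ m₂ * K ^ (1 / (1 - θ) - 2)))⁻¹
      ≤ q * (1 / m₁) * (((α * θ) ^ (-(θ / (2 * (1 - θ)))) * K ^ (-(θ / (2 * (1 - θ))))
          * (2 * Y₂) ^ (θ / 2)) * (1 / m₂))
        * ((√(c₃ α θ * μ))⁻¹ * (q⁻¹ * κ⁻¹ * √((m₂ : ℝ) / (m₂ - m₁)))) := by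
        gcongr
    _ = (√(c₃ α θ * μ))⁻¹ * (α * θ) ^ (-(θ / (2 * (1 - θ))))
        * ((K ^ (-(θ / (2 * (1 - θ)))) * κ⁻¹) * (2 * Y₂) ^ (θ / 2))
        * (√((m₂ : ℝ) / (m₂ - m₁)) / m₁ * (1 / m₂)) := by
        field_simp
    _ ≤ (√(c₃ α θ * μ))⁻¹ * (α * θ) ^ (-(θ / (2 * (1 - θ))))
        * ((K ^ (-(θ / (2 * (1 - θ)))) * κ⁻¹) * (2 * Y₂) ^ (θ / 2))
        * ((1 / m₁ + 1 / ((m₂ : ℝ) - m₁)) * (1 / m₂)) := by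
        have := sqrt_div_sub_div_le hm1 hltr
        gcongr
    _ = _ := by rw [eK]; field_simp

/-- One term of the second part of the error. -/
theorem pair_log_le {α θ K Y₁ Y₂ : ℝ} (hα : 0 < α) (hθ₀ : 0 < θ) (hθ₁ : θ < 1) (hK : 0 < K)
    (hY₁ : 0 < Y₁) (hY₂ : 0 < Y₂) {m₁ m₂ : ℕ} (hm₁ : m₁ ∈ mRange α θ K Y₁)
    (hm₂ : m₂ ∈ mRange α θ K Y₂) (hlt : m₁ < m₂) :
    (1 / ((m₁ : ℝ) * (m₂ : ℝ))) ^ ((2 - θ) / (2 - 2 * θ))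
        * Real.log (2 + c₃ α θ * eta θ m₁ m₂ * K ^ (1 / (1 - θ) - 1))
      ≤ ((α * θ) ^ (-(θ / (2 * (1 - θ))))) ^ 2
        * (K ^ (1 - 1 / (1 - θ)) * ((2 * Y₁) ^ (θ / 2) * (2 * Y₂) ^ (θ / 2)))
        * Real.log (2 + c₃ α θ * K ^ (1 / (1 - θ) - 1)) * (1 / ((m₁ : ℝ) * m₂)) := by
  have h1 : 0 < 1 - θ := by linarith
  have hc := c₃_pos hα hθ₀ hθ₁
  have hp1 := pos_of_mem_mRange hα hθ₀ hK hY₁ hm₁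
  have hp2 := pos_of_mem_mRange hα hθ₀ hK hY₂ hm₂
  have hm1 : (0 : ℝ) < m₁ := by exact_mod_cast hp1
  have hm2 : (0 : ℝ) < m₂ := by exact_mod_cast hp2
  have hb1 := rpow_neg_le_of_mem_mRange hα hθ₀ hθ₁ hK hY₁ hm₁
  have hb2 := rpow_neg_le_of_mem_mRange hα hθ₀ hθ₁ hK hY₂ hm₂
  have e2 : (1 / ((m₁ : ℝ) * (m₂ : ℝ))) ^ ((2 - θ) / (2 - 2 * θ))
      = (m₁ : ℝ) ^ (-((2 - θ) / (2 - 2 * θ))) * (m₂ : ℝ) ^ (-((2 - θ) / (2 - 2 * θ))) := by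
    rw [one_div, Real.inv_rpow (by positivity), Real.mul_rpow (by positivity) (by positivity),
      mul_inv, Real.rpow_neg (by positivity), Real.rpow_neg (by positivity)]
  have eK : K ^ (1 - 1 / (1 - θ)) = K ^ (-(θ / (2 * (1 - θ)))) * K ^ (-(θ / (2 * (1 - θ)))) := by
    rw [← Real.rpow_add hK]; congr 1; field_simp; ring
  set x := c₃ α θ * K ^ (1 / (1 - θ) - 1) with hx
  have hx0 : 0 < x := by positivity
  have hlog0 : 0 ≤ Real.log (2 + x) := Real.log_nonneg (by linarith)
  have hlog : Real.log (2 + c₃ α θ * eta θ m₁ m₂ * K ^ (1 / (1 - θ) - 1)) ≤ Real.log (2 + x) := by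
    have e3 : c₃ α θ * eta θ m₁ m₂ * K ^ (1 / (1 - θ) - 1) = eta θ m₁ m₂ * x := by rw [hx]; ring
    have h4 := eta_le_one hθ₀ hθ₁ hp1 (m₂ := m₂)
    have h6 := eta_pos hθ₀ hθ₁ hp1 hlt
    have h5 := mul_le_mul_of_nonneg_right h4 hx0.le
    rw [e3]
    exact Real.log_le_log (by positivity) (by linarith)
  rw [e2]
  calc (m₁ : ℝ) ^ (-((2 - θ) / (2 - 2 * θ))) * (m₂ : ℝ) ^ (-((2 - θ) / (2 - 2 * θ)))
        * Real.log (2 + c₃ α θ * eta θ m₁ m₂ * K ^ (1 / (1 - θ) - 1))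
      ≤ (m₁ : ℝ) ^ (-((2 - θ) / (2 - 2 * θ))) * (m₂ : ℝ) ^ (-((2 - θ) / (2 - 2 * θ)))
        * Real.log (2 + x) := by gcongr
    _ ≤ (((α * θ) ^ (-(θ / (2 * (1 - θ)))) * K ^ (-(θ / (2 * (1 - θ)))) * (2 * Y₁) ^ (θ / 2))
          * (1 / m₁)) * (((α * θ) ^ (-(θ / (2 * (1 - θ)))) * K ^ (-(θ / (2 * (1 - θ))))
          * (2 * Y₂) ^ (θ / 2)) * (1 / m₂)) * Real.log (2 + x) := by gcongr
    _ = _ := by rw [eK]; field_simp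

/-- The sums over pairs are at most `harm n ^ 2`, with `n` of order `K`, and cost two logarithms.
The logarithmic error of the `B`-process supplies the third; in the square-root part it is added
only for uniformity. -/
theorem exists_pairErr_le {α θ : ℝ} (hα : 0 < α) (hθ₀ : 0 < θ) (hθ₁ : θ < 1) :
    ∃ C : ℝ, 0 < C ∧ ∀ K Y₁ Y₂ : ℝ, 1 / 2 ≤ K → 1 / 2 ≤ Y₁ → 1 / 2 ≤ Y₂ →
      pairErr α θ K Y₁ Y₂ ≤ C * ((K ^ (3 / 2 - 1 / (1 - θ)) * Y₂ ^ (θ / 2)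
        + K ^ (1 - 1 / (1 - θ)) * (Y₁ ^ (θ / 2) * Y₂ ^ (θ / 2))) * Real.log (2 + K) ^ 3) := by
  have h1 : 0 < 1 - θ := by linarith
  have hc := c₃_pos hα hθ₀ hθ₁
  have hσ : 1 / (1 - θ) - 1 = θ / (1 - θ) := by field_simp; ring
  have hσ0 : 0 < θ / (1 - θ) := by positivity
  have hμ0 : 0 < min 1 (θ / (1 - θ)) := lt_min one_pos hσ0
  have hlog2 : 0 < Real.log 2 := Real.log_pos (by norm_num)
  set D₁ := (√(c₃ α θ * min 1 (θ / (1 - θ))))⁻¹ * (α * θ) ^ (-(θ / (2 * (1 - θ)))) with hD₁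
  set D₂ := ((α * θ) ^ (-(θ / (2 * (1 - θ))))) ^ 2 with hD₂
  have hD₁0 : 0 < D₁ := by positivity
  have hD₂0 : 0 < D₂ := by positivity
  set B₁ := 1 + 4 * α * θ with hB₁
  set B₂ := 1 + c₃ α θ with hB₂
  have hB₁1 : 1 ≤ B₁ := by rw [hB₁]; have : 0 < α * θ := by positivity
                           linarith
  have hB₂1 : 1 ≤ B₂ := by rw [hB₂]; linarith
  set L₁ := 1 / Real.log 2 + (1 + Real.log B₁ / Real.log 2) with hL₁
  set L₂ := (1 + Real.log B₂ / Real.log 2) * (θ / (1 - θ) + 2) with hL₂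
  have hB₁l := Real.log_nonneg hB₁1
  have hB₂l := Real.log_nonneg hB₂1
  have hL₁0 : 0 < L₁ := by positivity
  have hL₂0 : 0 < L₂ := by positivity
  refine ⟨(D₁ * 2 ^ (θ / 2) * 2 * (1 / Real.log 2) + D₂ * (2 ^ (θ / 2) * 2 ^ (θ / 2)) * L₂)
    * L₁ ^ 2, by positivity, fun K Y₁ Y₂ hK hY₁ hY₂ => ?_⟩
  have hK0 : 0 < K := by linarith
  have hY₁0 : 0 < Y₁ := by linarith
  have hY₂0 : 0 < Y₂ := by linarith
  set ℒ := Real.log (2 + K) with hℒ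
  have hℒ2 : Real.log 2 ≤ ℒ := Real.log_le_log (by norm_num) (by linarith)
  have hℒ0 : 0 < ℒ := hlog2.trans_le hℒ2
  have hone : 1 ≤ 1 / Real.log 2 * ℒ := by
    rw [one_div, ← div_eq_inv_mul, one_le_div hlog2]; exact hℒ2
  set n := ⌊4 * α * θ * K⌋₊ with hn
  have hH : harm n ≤ L₁ * ℒ := by
    have h2 : Real.log n ≤ Real.log (2 + B₁ * K) := by
      rcases Nat.eq_zero_or_pos n with h | h
      · rw [h]; simp only [Nat.cast_zero, Real.log_zero]
        exact Real.log_nonneg (by nlinarith)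
      · refine Real.log_le_log (by exact_mod_cast h) ?_
        have := Nat.floor_le (show 0 ≤ 4 * α * θ * K by positivity)
        rw [hB₁]; nlinarith
    have h3 := log_le_mul_log hB₁1 hK0.le
    have h4 := harm_le n
    rw [hL₁, add_mul]; linarith
  have hH0 := harm_nonneg n
  have hLg : Real.log (2 + c₃ α θ * K ^ (1 / (1 - θ) - 1)) ≤ L₂ * ℒ := by
    have hKp : 0 < K ^ (1 / (1 - θ) - 1) := by positivity
    have h2 : Real.log (2 + c₃ α θ * K ^ (1 / (1 - θ) - 1))
        ≤ Real.log (2 + B₂ * K ^ (1 / (1 - θ) - 1)) := by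
      refine Real.log_le_log (by positivity) ?_
      rw [hB₂]; nlinarith
    have h3 := log_le_mul_log hB₂1 hKp.le
    have h4 : Real.log (2 + K ^ (1 / (1 - θ) - 1)) ≤ (θ / (1 - θ) + 2) * ℒ := by
      rw [hℒ, ← Real.log_rpow (by positivity)]
      refine Real.log_le_log (by positivity) ?_
      rw [hσ, Real.rpow_add (by positivity), Real.rpow_two]
      have g1 : K ^ (θ / (1 - θ)) ≤ (2 + K) ^ (θ / (1 - θ)) := by gcongr; linarith
      have g2 : 1 ≤ (2 + K) ^ (θ / (1 - θ)) := Real.one_le_rpow (by linarith) hσ0.le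
      have g3 : 4 ≤ (2 + K) ^ 2 := by nlinarith only [hK0]
      have g4 : (2 + K) ^ (θ / (1 - θ)) * 4 ≤ (2 + K) ^ (θ / (1 - θ)) * (2 + K) ^ 2 :=
        mul_le_mul_of_nonneg_left g3 (by linarith)
      linarith only [g1, g2, g4]
    have : 0 ≤ 1 + Real.log B₂ / Real.log 2 := by positivity
    have g5 := mul_le_mul_of_nonneg_left h4 this
    rw [hL₂, mul_assoc]
    linarith only [h2, h3, g5]
  have hsub : pairs α θ K Y₁ Y₂ ⊆
      (Finset.Icc 1 n ×ˢ Finset.Icc 1 n).filter (fun p : ℕ × ℕ => p.1 < p.2) := by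
    refine Finset.filter_subset_filter _ (Finset.product_subset_product ?_ ?_)
    · intro m hm
      exact Finset.mem_Icc.2 ⟨pos_of_mem_mRange hα hθ₀ hK0 hY₁0 hm,
        Nat.le_floor (le_of_mem_mRange hα hθ₀ hθ₁ hK0 hY₁ hm)⟩
    · intro m hm
      exact Finset.mem_Icc.2 ⟨pos_of_mem_mRange hα hθ₀ hK0 hY₂0 hm,
        Nat.le_floor (le_of_mem_mRange hα hθ₀ hθ₁ hK0 hY₂ hm)⟩
  have hnn : ∀ p ∈ (Finset.Icc 1 n ×ˢ Finset.Icc 1 n).filter (fun p : ℕ × ℕ => p.1 < p.2),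
      0 ≤ 1 / (((p.2 : ℝ) - p.1) * p.2) := by
    intro p hp
    have : (p.1 : ℝ) < p.2 := by exact_mod_cast (Finset.mem_filter.1 hp).2
    have : 0 ≤ (p.2 : ℝ) - p.1 := by linarith
    positivity
  have s1 : ∑ p ∈ pairs α θ K Y₁ Y₂, 1 / ((p.1 : ℝ) * p.2) ≤ harm n ^ 2 :=
    (Finset.sum_le_sum_of_subset_of_nonneg hsub fun _ _ _ => by positivity).trans
      (sum_one_div_mul_le n)
  have s2 : ∑ p ∈ pairs α θ K Y₁ Y₂, 1 / (((p.2 : ℝ) - p.1) * p.2) ≤ harm n ^ 2 :=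
    (Finset.sum_le_sum_of_subset_of_nonneg hsub fun p hp _ => hnn p hp).trans
      (sum_one_div_mul_sub_le n)
  set T₁ := K ^ (3 / 2 - 1 / (1 - θ)) * Y₂ ^ (θ / 2) with hT₁
  set T₂ := K ^ (1 - 1 / (1 - θ)) * (Y₁ ^ (θ / 2) * Y₂ ^ (θ / 2)) with hT₂
  have hT₁0 : 0 < T₁ := by positivity
  have hT₂0 : 0 < T₂ := by positivity
  have eT₁ : K ^ (3 / 2 - 1 / (1 - θ)) * (2 * Y₂) ^ (θ / 2) = 2 ^ (θ / 2) * T₁ := by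
    rw [hT₁, Real.mul_rpow (by norm_num) hY₂0.le]; ring
  have eT₂ : K ^ (1 - 1 / (1 - θ)) * ((2 * Y₁) ^ (θ / 2) * (2 * Y₂) ^ (θ / 2))
      = 2 ^ (θ / 2) * 2 ^ (θ / 2) * T₂ := by
    rw [hT₂, Real.mul_rpow (by norm_num) hY₂0.le, Real.mul_rpow (by norm_num) hY₁0.le]; ring
  set Lg := Real.log (2 + c₃ α θ * K ^ (1 / (1 - θ) - 1)) with hLgd
  have hLg0 : 0 ≤ Lg := Real.log_nonneg (by
    have : 0 < c₃ α θ * K ^ (1 / (1 - θ) - 1) := by positivity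
    linarith)
  have hmain : pairErr α θ K Y₁ Y₂ ≤ D₁ * (2 ^ (θ / 2) * T₁) * (harm n ^ 2 + harm n ^ 2)
      + D₂ * (2 ^ (θ / 2) * 2 ^ (θ / 2) * T₂) * Lg * harm n ^ 2 := by
    rw [pairErr]
    calc _ ≤ ∑ p ∈ pairs α θ K Y₁ Y₂, (D₁ * (2 ^ (θ / 2) * T₁)
          * (1 / ((p.1 : ℝ) * p.2) + 1 / (((p.2 : ℝ) - p.1) * p.2))
          + D₂ * (2 ^ (θ / 2) * 2 ^ (θ / 2) * T₂) * Lg * (1 / ((p.1 : ℝ) * p.2))) := by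
          refine Finset.sum_le_sum fun p hp => ?_
          rw [pairs, Finset.mem_filter, Finset.mem_product] at hp
          have g1 := pair_sqrt_le hα hθ₀ hθ₁ hK0 hY₁0 hY₂0 hp.1.1 hp.1.2 hp.2
          have g2 := pair_log_le hα hθ₀ hθ₁ hK0 hY₁0 hY₂0 hp.1.1 hp.1.2 hp.2
          rw [eT₁] at g1
          rw [eT₂] at g2
          rw [mul_add]
          exact add_le_add g1 g2
      _ = D₁ * (2 ^ (θ / 2) * T₁) * ((∑ p ∈ pairs α θ K Y₁ Y₂, 1 / ((p.1 : ℝ) * p.2))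
            + ∑ p ∈ pairs α θ K Y₁ Y₂, 1 / (((p.2 : ℝ) - p.1) * p.2))
          + D₂ * (2 ^ (θ / 2) * 2 ^ (θ / 2) * T₂) * Lg
            * ∑ p ∈ pairs α θ K Y₁ Y₂, 1 / ((p.1 : ℝ) * p.2) := by
          rw [Finset.sum_add_distrib, ← Finset.mul_sum, ← Finset.mul_sum, Finset.sum_add_distrib]
      _ ≤ _ := by gcongr
  have hH2 : harm n ^ 2 ≤ L₁ ^ 2 * ℒ ^ 2 := by
    rw [← mul_pow]; exact pow_le_pow_left₀ hH0 hH 2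
  have hP1 : harm n ^ 2 + harm n ^ 2 ≤ 2 * (1 / Real.log 2) * L₁ ^ 2 * ℒ ^ 3 := by
    have : L₁ ^ 2 * ℒ ^ 2 * 1 ≤ L₁ ^ 2 * ℒ ^ 2 * (1 / Real.log 2 * ℒ) := by gcongr
    calc _ ≤ 2 * (L₁ ^ 2 * ℒ ^ 2 * 1) := by linarith
      _ ≤ 2 * (L₁ ^ 2 * ℒ ^ 2 * (1 / Real.log 2 * ℒ)) := by linarith
      _ = _ := by ring
  have hP2 : Lg * harm n ^ 2 ≤ L₂ * L₁ ^ 2 * ℒ ^ 3 := by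
    calc _ ≤ L₂ * ℒ * (L₁ ^ 2 * ℒ ^ 2) := by gcongr
      _ = _ := by ring
  have q1 : D₁ * (2 ^ (θ / 2) * T₁) * (harm n ^ 2 + harm n ^ 2)
      ≤ D₁ * (2 ^ (θ / 2) * T₁) * (2 * (1 / Real.log 2) * L₁ ^ 2 * ℒ ^ 3) :=
    mul_le_mul_of_nonneg_left hP1 (by positivity)
  have q2 : D₂ * (2 ^ (θ / 2) * 2 ^ (θ / 2) * T₂) * (Lg * harm n ^ 2)
      ≤ D₂ * (2 ^ (θ / 2) * 2 ^ (θ / 2) * T₂) * (L₂ * L₁ ^ 2 * ℒ ^ 3) :=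
    mul_le_mul_of_nonneg_left hP2 (by positivity)
  have r1 : 0 ≤ D₁ * 2 ^ (θ / 2) * 2 * (1 / Real.log 2) * L₁ ^ 2 * (T₂ * ℒ ^ 3) := by positivity
  have r2 : 0 ≤ D₂ * (2 ^ (θ / 2) * 2 ^ (θ / 2)) * L₂ * L₁ ^ 2 * (T₁ * ℒ ^ 3) := by positivity
  calc _ ≤ _ := hmain
    _ ≤ D₁ * (2 ^ (θ / 2) * T₁) * (2 * (1 / Real.log 2) * L₁ ^ 2 * ℒ ^ 3)
      + D₂ * (2 ^ (θ / 2) * 2 ^ (θ / 2) * T₂) * (L₂ * L₁ ^ 2 * ℒ ^ 3) := by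
        rw [mul_assoc _ Lg]; exact add_le_add q1 q2
    _ ≤ _ := by linarith only [r1, r2]

end DyadicTransform

namespace DyadicTransform

/-! ### Weighted sums of the off-diagonal part -/

/-- Abel summation. It requires a bound for all initial segments, which the maximum over `K̃` in
`maxStilde` provides. -/
theorem norm_sum_mul_le_of_partial_sum_le (w x : ℕ → ℂ) {a b : ℕ} (hab : a ≤ b) {B : ℝ}
    (hB : ∀ n, a ≤ n → n ≤ b → ‖∑ k ∈ Finset.Ioc a n, x k‖ ≤ B) :
    ‖∑ k ∈ Finset.Ioc a b, w k * x k‖ ≤ B * (‖w b‖ + ∑ k ∈ Finset.Ico a b, ‖w (k + 1) - w k‖) := by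
  have key : ∑ k ∈ Finset.Ioc a b, w k * x k = w b * (∑ k ∈ Finset.Ioc a b, x k)
      - ∑ k ∈ Finset.Ico a b, (w (k + 1) - w k) * ∑ j ∈ Finset.Ioc a k, x j := by
    clear hB
    induction b, hab using Nat.le_induction with
    | base => simp
    | succ n hn ih =>
      rw [← Finset.insert_Ioc_right_eq_Ioc_add_one hn, Finset.sum_insert (by simp),
        Finset.sum_insert (by simp), Finset.sum_Ico_succ_top hn, ih]
      ring
  rw [key, mul_add, Finset.mul_sum (s := Finset.Ico a b)]
  refine (norm_sub_le _ _).trans (add_le_add ?_ (norm_sum_le_of_le _ fun k hk => ?_))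
  · rw [norm_mul, mul_comm]
    exact mul_le_mul_of_nonneg_right (hB b hab le_rfl) (norm_nonneg _)
  · rw [norm_mul, mul_comm]
    have := Finset.mem_Ico.1 hk
    exact mul_le_mul_of_nonneg_right (hB k this.1 this.2.le) (norm_nonneg _)

/-- Product rule for differences: the last value, the variation of `v`, and the variation of the
increasing power contribute `V Z^β` each. -/
theorem norm_add_sum_norm_sub_mul_rpow_le {β V Z : ℝ} (hβ : 0 < β) {v : ℕ → ℂ}
    (hv : ∀ k, ‖v k‖ ≤ V) (hv' : ∀ n, ∑ k ∈ Finset.range n, ‖v (k + 1) - v k‖ ≤ V) {a b : ℕ}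
    (hab : a ≤ b) (hb : (b : ℝ) ≤ Z) :
    ‖v b * (((b : ℝ) ^ β : ℝ) : ℂ)‖ + ∑ k ∈ Finset.Ico a b,
      ‖v (k + 1) * ((((k + 1 : ℕ) : ℝ) ^ β : ℝ) : ℂ) - v k * (((k : ℝ) ^ β : ℝ) : ℂ)‖
      ≤ 3 * V * Z ^ β := by
  have hV : 0 ≤ V := (norm_nonneg _).trans (hv 0)
  have hle : ∀ k : ℕ, k ≤ b → (k : ℝ) ^ β ≤ Z ^ β := fun k hk => by
    have : (k : ℝ) ≤ b := by exact_mod_cast hk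
    exact Real.rpow_le_rpow (by positivity) (this.trans hb) hβ.le
  have hZ : 0 ≤ Z ^ β := (Real.rpow_nonneg (Nat.cast_nonneg b) β).trans (hle b le_rfl)
  have h1 : ‖v b * (((b : ℝ) ^ β : ℝ) : ℂ)‖ ≤ V * Z ^ β := by
    rw [norm_mul, Complex.norm_real, Real.norm_of_nonneg (by positivity)]
    exact mul_le_mul (hv b) (hle b le_rfl) (by positivity) hV
  have h2 : ∀ k ∈ Finset.Ico a b,
      ‖v (k + 1) * ((((k + 1 : ℕ) : ℝ) ^ β : ℝ) : ℂ) - v k * (((k : ℝ) ^ β : ℝ) : ℂ)‖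
        ≤ ‖v (k + 1) - v k‖ * Z ^ β + V * (((k + 1 : ℕ) : ℝ) ^ β - (k : ℝ) ^ β) := by
    intro k hk
    have hk' := (Finset.mem_Ico.1 hk).2
    have e1 : v (k + 1) * ((((k + 1 : ℕ) : ℝ) ^ β : ℝ) : ℂ) - v k * (((k : ℝ) ^ β : ℝ) : ℂ)
        = (v (k + 1) - v k) * ((((k + 1 : ℕ) : ℝ) ^ β : ℝ) : ℂ)
          + v k * ((((k + 1 : ℕ) : ℝ) ^ β - (k : ℝ) ^ β : ℝ) : ℂ) := by
      push_cast; ring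
    have h3 : (k : ℝ) ^ β ≤ ((k + 1 : ℕ) : ℝ) ^ β :=
      Real.rpow_le_rpow (by positivity) (by push_cast; linarith) hβ.le
    rw [e1]
    refine (norm_add_le _ _).trans ?_
    rw [norm_mul, norm_mul, Complex.norm_real, Complex.norm_real,
      Real.norm_of_nonneg (by positivity), Real.norm_of_nonneg (by linarith)]
    have h4 := mul_le_mul_of_nonneg_left (hle (k + 1) hk') (norm_nonneg (v (k + 1) - v k))
    have h5 := mul_le_mul_of_nonneg_right (hv k) (sub_nonneg.2 h3)
    linarith
  have h3 : ∑ k ∈ Finset.Ico a b, ‖v (k + 1) - v k‖ ≤ V := by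
    refine (Finset.sum_le_sum_of_subset_of_nonneg (t := Finset.range b) ?_
      fun _ _ _ => norm_nonneg _).trans (hv' b)
    intro k hk
    exact Finset.mem_range.2 (Finset.mem_Ico.1 hk).2
  have h4 := Finset.sum_le_sum h2
  rw [Finset.sum_add_distrib, ← Finset.sum_mul, ← Finset.mul_sum,
    Finset.sum_Ico_sub (fun k : ℕ => (k : ℝ) ^ β) hab] at h4
  have h5 := mul_le_mul_of_nonneg_right h3 hZ
  have h6 : V * ((b : ℝ) ^ β - (a : ℝ) ^ β) ≤ V * Z ^ β := by
    refine mul_le_mul_of_nonneg_left ?_ hV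
    have := hle b le_rfl
    have : 0 ≤ (a : ℝ) ^ β := by positivity
    linarith
  linarith

/-- The weight `k^(1/(1-θ))` costs a factor `K^(1/(1-θ))` by Abel summation, turning the exponents
`3/2 - 1/(1-θ)` and `1 - 1/(1-θ)` of `exists_pairErr_le` into `3/2` and `1`. -/
theorem exists_dyadic_offDiag_le {α θ : ℝ} (hα : 0 < α) (hθ₀ : 0 < θ) (hθ₁ : θ < 1) :
    ∃ C : ℝ, 0 < C ∧ ∀ K Y₁ Y₂ V : ℝ, 1 / 2 ≤ K → 1 / 2 ≤ Y₁ → 1 / 2 ≤ Y₂ → ∀ v : ℕ → ℂ,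
      (∀ k, ‖v k‖ ≤ V) → (∀ n, ∑ k ∈ Finset.range n, ‖v (k + 1) - v k‖ ≤ V) →
      ‖∑ k ∈ Finset.Ioc ⌊K⌋₊ ⌊2 * K⌋₊,
        v k * (((k : ℝ) ^ (1 / (1 - θ)) : ℝ) : ℂ) * offDiag α θ k Y₁ Y₂‖
        ≤ C * V * (K ^ (1 / (1 - θ)) * maxStilde α θ K Y₁ Y₂
          + (K ^ (3 / 2 : ℝ) * Y₂ ^ (θ / 2) + K * (Y₁ ^ (θ / 2) * Y₂ ^ (θ / 2)))
            * Real.log (2 + K) ^ 3) := by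
  have h1 : 0 < 1 - θ := by linarith
  obtain ⟨C₁, hC₁, h₁⟩ := exists_norm_sum_offDiag_le hα hθ₀ hθ₁
  obtain ⟨C₂, hC₂, h₂⟩ := exists_pairErr_le hα hθ₀ hθ₁
  set β := 1 / (1 - θ) with hβ
  have hβ0 : 0 < β := by positivity
  refine ⟨3 * 2 ^ β * (1 + C₁ * C₂), by positivity, fun K Y₁ Y₂ V hK hY₁ hY₂ v hv hv' => ?_⟩
  have hK0 : 0 < K := by linarith
  have hY₁0 : 0 < Y₁ := by linarith
  have hY₂0 : 0 < Y₂ := by linarith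
  have hV : 0 ≤ V := (norm_nonneg _).trans (hv 0)
  have hab : ⌊K⌋₊ ≤ ⌊2 * K⌋₊ := Nat.floor_le_floor (by linarith)
  have hb : ((⌊2 * K⌋₊ : ℕ) : ℝ) ≤ 2 * K := Nat.floor_le (by linarith)
  set B := maxStilde α θ K Y₁ Y₂ + C₁ * pairErr α θ K Y₁ Y₂ with hB
  have hBn : ∀ n, ⌊K⌋₊ ≤ n → n ≤ ⌊2 * K⌋₊ →
      ‖∑ k ∈ Finset.Ioc ⌊K⌋₊ n, offDiag α θ k Y₁ Y₂‖ ≤ B := by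
    intro n hn1 hn2
    have hn3 : (n : ℝ) ≤ 2 * K := le_trans (by exact_mod_cast hn2) hb
    -- The segment ending at `n` is reached with `K̃ = max K n`; the maximum is needed because `n =
    -- ⌊K⌋` can be below `K`.
    have := h₁ K Y₁ Y₂ hK0 hY₁0 hY₂0 (max K n) ⟨le_max_left _ _, max_le (by linarith) hn3⟩
    have hfl : ⌊max K n⌋₊ = n := by
      rcases le_total K n with h | h
      · rw [max_eq_right h, Nat.floor_natCast]
      · rw [max_eq_left h]
        exact le_antisymm hn1 (Nat.le_floor h)
    rwa [hfl] at this
  have hB0 : 0 ≤ B := (norm_nonneg _).trans (hBn _ le_rfl hab)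
  have h3 := norm_sum_mul_le_of_partial_sum_le (fun k => v k * (((k : ℝ) ^ β : ℝ) : ℂ))
    (fun k => offDiag α θ k Y₁ Y₂) hab hBn
  have h4 := norm_add_sum_norm_sub_mul_rpow_le hβ0 hv hv' hab hb
  refine h3.trans ((mul_le_mul_of_nonneg_left h4 hB0).trans ?_)
  rw [Real.mul_rpow (by norm_num) hK0.le]
  have h5 := h₂ K Y₁ Y₂ hK hY₁ hY₂
  have hl : 0 < Real.log (2 + K) := Real.log_pos (by linarith)
  have eK1 : K ^ (3 / 2 : ℝ) = K ^ β * K ^ (3 / 2 - β) := by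
    rw [← Real.rpow_add hK0]; congr 1; ring
  have eK2 : K = K ^ β * K ^ (1 - β) := by
    rw [← Real.rpow_add hK0]
    have : β + (1 - β) = 1 := by ring
    rw [this, Real.rpow_one]
  set T := (K ^ (3 / 2 - β) * Y₂ ^ (θ / 2) + K ^ (1 - β) * (Y₁ ^ (θ / 2) * Y₂ ^ (θ / 2)))
    * Real.log (2 + K) ^ 3 with hT
  have hT0 : 0 ≤ T := by positivity
  have e1 : (K ^ (3 / 2 : ℝ) * Y₂ ^ (θ / 2) + K * (Y₁ ^ (θ / 2) * Y₂ ^ (θ / 2)))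
      * Real.log (2 + K) ^ 3 = K ^ β * T := by
    rw [eK1]; nth_rewrite 3 [eK2]; rw [hT]; ring
  rw [e1]
  set M := maxStilde α θ K Y₁ Y₂ with hM
  have hM0 : 0 ≤ M :=
    (norm_nonneg _).trans ((isGreatest_maxStilde hα hθ₀ hθ₁ hK0 hY₁0 hY₂0).2
      ⟨K, ⟨le_rfl, by linarith⟩, rfl⟩)
  have h6 : B ≤ M + C₁ * (C₂ * T) := by
    rw [hB]; gcongr
  have h7 : M + C₁ * (C₂ * T) ≤ (1 + C₁ * C₂) * (M + T) := by
    have : 0 ≤ C₁ * C₂ * M := by positivity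
    linarith
  calc B * (3 * V * (2 ^ β * K ^ β)) ≤ ((1 + C₁ * C₂) * (M + T)) * (3 * V * (2 ^ β * K ^ β)) :=
        mul_le_mul_of_nonneg_right (h6.trans h7) (by positivity)
    _ = _ := by ring

theorem S_nonneg {α θ ε : ℝ} (hα : 0 < α) (hθ₀ : 0 < θ) (hθ₁ : θ < 1) (hε : 0 < ε) {N : ℕ}
    (hN : 1 ≤ N) : 0 ≤ S α θ ε N := by
  have hN1 : (1 : ℝ) ≤ N := by exact_mod_cast hN
  have hX1 : 1 ≤ (N : ℝ) ^ (1 + ε) := Real.one_le_rpow hN1 (by linarith)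
  refine mul_nonneg (by positivity) (Finset.sum_nonneg fun K hK => Finset.sum_nonneg fun Y₁ hY₁ =>
    Finset.sum_nonneg fun Y₂ hY₂ => ?_)
  have a1 := half_le_of_mem_dyadic hX1 hK
  have a2 := half_le_of_mem_dyadic hN1 hY₁
  have a3 := half_le_of_mem_dyadic hN1 hY₂
  exact mul_nonneg (Real.rpow_nonneg (by linarith) _) ((norm_nonneg _).trans
    ((isGreatest_maxStilde hα hθ₀ hθ₁ (by linarith) (by linarith) (by linarith)).2
      ⟨K, ⟨le_rfl, by linarith⟩, rfl⟩))

/-- Summation over all triples of blocks. Three logarithms come from each triple and three more from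
the number of triples. -/
theorem exists_weighted_offDiagSum_le {α θ ε : ℝ} (hα : 0 < α) (hθ₀ : 0 < θ) (hθ₁ : θ < 1)
    (hε₀ : 0 < ε) (hε₁ : ε < 1) :
    ∃ C : ℝ, 0 < C ∧ ∀ (N : ℕ) (V : ℝ), 1 ≤ N → ∀ v : ℕ → ℂ,
      (∀ k, ‖v k‖ ≤ V) → (∀ n, ∑ k ∈ Finset.range n, ‖v (k + 1) - v k‖ ≤ V) →
      ‖∑ k ∈ Finset.Icc 1 ⌊(N : ℝ) ^ (1 + ε)⌋₊,
        v k * (((k : ℝ) ^ (1 / (1 - θ)) : ℝ) : ℂ) * offDiagSum α θ N k‖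
        ≤ C * V * ((N : ℝ) ^ 2 * S α θ ε N
          + (N : ℝ) ^ (3 / 2 * (1 + ε) + θ / 2) * (1 + Real.log N) ^ 6) := by
  obtain ⟨C, hC, h⟩ := exists_dyadic_offDiag_le hα hθ₀ hθ₁
  have h1 : 0 < 1 - θ := by linarith
  set β := 1 / (1 - θ) with hβ
  -- `864 = 6 · 3 · 3 · 16`: the bounds for the numbers of blocks `K`, `Y₁`, `Y₂`, times the error
  -- constant of one triple.
  refine ⟨C * 864, by positivity, fun N V hN v hv hv' => ?_⟩
  have hN1 : (1 : ℝ) ≤ N := by exact_mod_cast hN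
  have hN0 : (0 : ℝ) < N := by linarith
  have hV : 0 ≤ V := (norm_nonneg _).trans (hv 0)
  set X := (N : ℝ) ^ (1 + ε) with hX
  have hX1 : 1 ≤ X := Real.one_le_rpow hN1 (by linarith)
  set ℓ := 1 + Real.log N with hℓ
  have hlog0 : 0 ≤ Real.log N := Real.log_nonneg hN1
  have hℓ1 : 1 ≤ ℓ := by rw [hℓ]; linarith
  have hlogX : Real.log X = (1 + ε) * Real.log N := Real.log_rpow hN0 _
  set P := (N : ℝ) ^ (3 / 2 * (1 + ε) + θ / 2) with hP
  have hP0 : 0 < P := by positivity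
  have hterm : ∀ K ∈ dyadic X, ∀ Y₁ ∈ dyadic (N : ℝ), ∀ Y₂ ∈ dyadic (N : ℝ),
      ‖∑ k ∈ Finset.Ioc ⌊K⌋₊ ⌊2 * K⌋₊, v k * (((k : ℝ) ^ β : ℝ) : ℂ) * offDiag α θ k Y₁ Y₂‖
        ≤ C * V * (K ^ ((2 - θ) / (1 - θ) - 1) * maxStilde α θ K Y₁ Y₂ + 16 * P * ℓ ^ 3) := by
    intro K hK Y₁ hY₁ Y₂ hY₂
    have a1 := half_le_of_mem_dyadic hX1 hK
    have a2 := half_le_of_mem_dyadic hN1 hY₁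
    have a3 := half_le_of_mem_dyadic hN1 hY₂
    have b1 := le_of_mem_dyadic hX1 hK
    have b2 := le_of_mem_dyadic hN1 hY₁
    have b3 := le_of_mem_dyadic hN1 hY₂
    have hK0 : 0 < K := by linarith
    have eβ : (2 - θ) / (1 - θ) - 1 = β := by rw [hβ]; field_simp; ring
    rw [eβ]
    refine (h K Y₁ Y₂ V a1 a2 a3 v hv hv').trans ?_
    have c1 : K ^ (3 / 2 : ℝ) ≤ X ^ (3 / 2 : ℝ) :=
      Real.rpow_le_rpow hK0.le (by linarith) (by norm_num)
    have c2 : Y₁ ^ (θ / 2) ≤ (N : ℝ) ^ (θ / 2) :=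
      Real.rpow_le_rpow (by linarith) (by linarith) (by positivity)
    have c3 : Y₂ ^ (θ / 2) ≤ (N : ℝ) ^ (θ / 2) :=
      Real.rpow_le_rpow (by linarith) (by linarith) (by positivity)
    have d1 : K ^ (3 / 2 : ℝ) * Y₂ ^ (θ / 2) ≤ P := by
      have e1 : P = X ^ (3 / 2 : ℝ) * (N : ℝ) ^ (θ / 2) := by
        rw [hX, ← Real.rpow_mul hN0.le, ← Real.rpow_add hN0, hP]; congr 1; ring
      have : 0 ≤ Y₂ ^ (θ / 2) := Real.rpow_nonneg (by linarith) _
      rw [e1]; gcongr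
    have d2 : K * (Y₁ ^ (θ / 2) * Y₂ ^ (θ / 2)) ≤ P := by
      have e1 : X * ((N : ℝ) ^ (θ / 2) * (N : ℝ) ^ (θ / 2)) ≤ P := by
        rw [hX, ← Real.rpow_add hN0, ← Real.rpow_add hN0, hP]
        exact Real.rpow_le_rpow_of_exponent_le hN1 (by linarith)
      refine le_trans ?_ e1
      have : 0 ≤ Y₂ ^ (θ / 2) := Real.rpow_nonneg (by linarith) _
      have : 0 ≤ Y₁ ^ (θ / 2) := Real.rpow_nonneg (by linarith) _
      have : K ≤ X := by linarith
      gcongr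
    have hl0 : 0 ≤ Real.log (2 + K) := Real.log_nonneg (by linarith)
    have d3 : Real.log (2 + K) ≤ 2 * ℓ := by
      have g1 : Real.log (2 + K) ≤ Real.log (3 * X) :=
        Real.log_le_log (by linarith) (by linarith)
      have g2 : Real.log 3 ≤ 2 := by
        have := Real.log_le_sub_one_of_pos (show (0 : ℝ) < 3 by norm_num)
        linarith
      rw [Real.log_mul (by norm_num) (by linarith), hlogX] at g1
      have g3 : (1 + ε) * Real.log N ≤ 2 * Real.log N :=
        mul_le_mul_of_nonneg_right (by linarith) hlog0
      rw [hℓ]; linarith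
    have d4 : Real.log (2 + K) ^ 3 ≤ 8 * ℓ ^ 3 := by
      calc _ ≤ (2 * ℓ) ^ 3 := pow_le_pow_left₀ hl0 d3 3
        _ = _ := by ring
    have d5 : (K ^ (3 / 2 : ℝ) * Y₂ ^ (θ / 2) + K * (Y₁ ^ (θ / 2) * Y₂ ^ (θ / 2)))
        * Real.log (2 + K) ^ 3 ≤ (P + P) * (8 * ℓ ^ 3) :=
      mul_le_mul (add_le_add d1 d2) d4 (by positivity) (by positivity)
    refine mul_le_mul_of_nonneg_left ?_ (by positivity)
    linarith
  have hsplit : ∑ k ∈ Finset.Icc 1 ⌊X⌋₊, v k * (((k : ℝ) ^ β : ℝ) : ℂ) * offDiagSum α θ N k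
      = ∑ K ∈ dyadic X, ∑ Y₁ ∈ dyadic (N : ℝ), ∑ Y₂ ∈ dyadic (N : ℝ),
        ∑ k ∈ Finset.Ioc ⌊K⌋₊ ⌊2 * K⌋₊,
          v k * (((k : ℝ) ^ β : ℝ) : ℂ) * offDiag α θ k Y₁ Y₂ := by
    rw [← sum_sum_dyadic hX1]
    refine Finset.sum_congr rfl fun K _ => ?_
    simp_rw [offDiagSum, Finset.mul_sum]
    rw [Finset.sum_comm]
    refine Finset.sum_congr rfl fun Y₁ _ => ?_
    rw [Finset.sum_comm]
  have hcard : ∑ K ∈ dyadic X, ∑ Y₁ ∈ dyadic (N : ℝ), ∑ Y₂ ∈ dyadic (N : ℝ), 16 * P * ℓ ^ 3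
      ≤ 864 * (P * ℓ ^ 6) := by
    simp_rw [Finset.sum_const, nsmul_eq_mul]
    have g1 : ((dyadic X).card : ℝ) ≤ 6 * ℓ := by
      have := card_dyadic_le hX1
      rw [hlogX] at this
      have g3 : (1 + ε) * Real.log N ≤ 2 * Real.log N :=
        mul_le_mul_of_nonneg_right (by linarith) hlog0
      rw [hℓ]; linarith
    have g2 : ((dyadic (N : ℝ)).card : ℝ) ≤ 3 * ℓ := card_dyadic_le hN1
    calc _ ≤ 6 * ℓ * (3 * ℓ * (3 * ℓ * (16 * P * ℓ ^ 3))) := by gcongr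
      _ = _ := by ring
  have hS : (N : ℝ) ^ 2 * S α θ ε N = ∑ K ∈ dyadic X, ∑ Y₁ ∈ dyadic (N : ℝ),
      ∑ Y₂ ∈ dyadic (N : ℝ), K ^ ((2 - θ) / (1 - θ) - 1) * maxStilde α θ K Y₁ Y₂ := by
    rw [S, ← mul_assoc, mul_one_div_cancel (by positivity), one_mul]
  have hS0 : 0 ≤ (N : ℝ) ^ 2 * S α θ ε N :=
    mul_nonneg (by positivity) (S_nonneg hα hθ₀ hθ₁ hε₀ hN)
  rw [hsplit]
  calc _ ≤ ∑ K ∈ dyadic X, ∑ Y₁ ∈ dyadic (N : ℝ), ∑ Y₂ ∈ dyadic (N : ℝ),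
        C * V * (K ^ ((2 - θ) / (1 - θ) - 1) * maxStilde α θ K Y₁ Y₂ + 16 * P * ℓ ^ 3) :=
        norm_sum_le_of_le _ fun K hK => norm_sum_le_of_le _ fun Y₁ hY₁ =>
          norm_sum_le_of_le _ fun Y₂ hY₂ => hterm K hK Y₁ hY₁ Y₂ hY₂
    _ = C * V * ((N : ℝ) ^ 2 * S α θ ε N + ∑ K ∈ dyadic X, ∑ Y₁ ∈ dyadic (N : ℝ),
        ∑ Y₂ ∈ dyadic (N : ℝ), 16 * P * ℓ ^ 3) := by
        rw [hS]
        simp only [← Finset.sum_add_distrib]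
        simp only [Finset.mul_sum _ _ (C * V)]
    _ ≤ C * V * (864 * ((N : ℝ) ^ 2 * S α θ ε N + P * ℓ ^ 6)) := by
        refine mul_le_mul_of_nonneg_left ?_ (by positivity)
        linarith
    _ = _ := by ring

end DyadicTransform

namespace DyadicTransform

open MeasureTheory Set intervalIntegral SchwartzMap

/-! ### Riemann sums of Schwartz functions -/

theorem integrable_norm_deriv (g : 𝓢(ℝ, ℂ)) : Integrable (fun x => ‖deriv g x‖) := by
  have := (derivCLM ℝ ℂ g).integrable (μ := volume)
  simpa only [derivCLM_apply] using this.norm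

theorem continuous_deriv_schwartz (g : 𝓢(ℝ, ℂ)) : Continuous (deriv g) := by
  have := (derivCLM ℝ ℂ g).continuous
  rwa [show (⇑(derivCLM ℝ ℂ g)) = deriv g from funext fun x => derivCLM_apply ℝ g x] at this

theorem norm_sub_le_integral_norm_deriv (g : 𝓢(ℝ, ℂ)) {a b : ℝ} (hab : a ≤ b) :
    ‖g b - g a‖ ≤ ∫ x in a..b, ‖deriv g x‖ := by
  rw [← integral_eq_sub_of_hasDerivAt (fun x _ => g.hasDerivAt x)
    ((continuous_deriv_schwartz g).intervalIntegrable a b)]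
  exact norm_integral_le_integral_norm hab

theorem sum_integral_norm_deriv_le (g : 𝓢(ℝ, ℂ)) {h : ℝ} (hh : 0 ≤ h) (n : ℕ) :
    ∑ k ∈ Finset.range n, ∫ x in ((k : ℕ) : ℝ) * h..((k + 1 : ℕ) : ℝ) * h, ‖deriv g x‖
      ≤ ∫ x, ‖deriv g x‖ := by
  rw [sum_integral_adjacent_intervals (a := fun k : ℕ => (k : ℝ) * h)
    (f := fun x => ‖deriv g x‖) fun k _ => (continuous_deriv_schwartz g).norm.intervalIntegrable _ _,
    integral_of_le (by push_cast; nlinarith [show (0 : ℝ) ≤ (n : ℝ) * h by positivity])]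
  exact setIntegral_le_integral (integrable_norm_deriv g)
    (Filter.Eventually.of_forall fun _ => norm_nonneg _)

/-- The total variation of the samples is bounded independently of the mesh, so the weights `𝓕 f
(k/N)` enter Abel summation uniformly in `N`. -/
theorem sum_norm_sub_le (g : 𝓢(ℝ, ℂ)) {h : ℝ} (hh : 0 ≤ h) (n : ℕ) :
    ∑ k ∈ Finset.range n, ‖g (((k + 1 : ℕ) : ℝ) * h) - g ((k : ℝ) * h)‖ ≤ ∫ x, ‖deriv g x‖ := by
  refine (Finset.sum_le_sum fun k _ => norm_sub_le_integral_norm_deriv g ?_).trans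
    (sum_integral_norm_deriv_le g hh n)
  push_cast; nlinarith

/-- On each cell the error is at most `h` times the variation of `g` there. -/
theorem norm_riemann_sum_sub_le (g : 𝓢(ℝ, ℂ)) {h : ℝ} (hh : 0 ≤ h) (n : ℕ) :
    ‖(h : ℂ) * (∑ k ∈ Finset.Icc 1 n, g ((k : ℝ) * h)) - ∫ x in (0 : ℝ)..(n : ℝ) * h, g x‖
      ≤ h * ∫ x, ‖deriv g x‖ := by
  have e1 : ∑ k ∈ Finset.Icc 1 n, g ((k : ℝ) * h)
      = ∑ k ∈ Finset.range n, g (((k + 1 : ℕ) : ℝ) * h) := by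
    rw [Finset.range_eq_Ico, ← Finset.Ico_add_one_right_eq_Icc,
      ← Finset.sum_Ico_add' (fun k : ℕ => g ((k : ℝ) * h)) 0 n 1]
  have e2 : ∫ x in (0 : ℝ)..(n : ℝ) * h, g x
      = ∑ k ∈ Finset.range n, ∫ x in ((k : ℕ) : ℝ) * h..((k + 1 : ℕ) : ℝ) * h, g x := by
    rw [sum_integral_adjacent_intervals (a := fun k : ℕ => (k : ℝ) * h) (f := g)
      fun k _ => g.continuous.intervalIntegrable _ _]
    simp
  rw [e1, e2, Finset.mul_sum, ← Finset.sum_sub_distrib]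
  refine le_trans ?_ (mul_le_mul_of_nonneg_left (sum_integral_norm_deriv_le g hh n) hh)
  rw [Finset.mul_sum]
  refine norm_sum_le_of_le _ fun k _ => ?_
  set a := (k : ℝ) * h with ha
  set b := ((k + 1 : ℕ) : ℝ) * h with hb
  have hba : b - a = h := by rw [ha, hb]; push_cast; ring
  have hab : a ≤ b := by linarith
  have e3 : (h : ℂ) * g b - ∫ x in a..b, g x = ∫ x in a..b, (g b - g x) := by
    rw [intervalIntegral.integral_sub (by simp) (g.continuous.intervalIntegrable _ _),
      intervalIntegral.integral_const, hba, Complex.real_smul]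
  rw [e3]
  have := norm_integral_le_of_norm_le_const (a := a) (b := b) (f := fun x => g b - g x)
    (C := ∫ x in a..b, ‖deriv g x‖) fun x hx => by
      rw [uIoc_of_le hab] at hx
      refine (norm_sub_le_integral_norm_deriv g hx.2).trans ?_
      exact integral_mono_interval hx.1.le hx.2 le_rfl
        (Filter.Eventually.of_forall fun _ => norm_nonneg _)
        ((continuous_deriv_schwartz g).norm.intervalIntegrable _ _)
  rwa [hba, abs_of_nonneg hh, mul_comm] at this

theorem norm_integral_Ioi_le (g : 𝓢(ℝ, ℂ)) {t : ℝ} (ht : 0 < t) (p : ℕ) :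
    ‖∫ x in Ioi t, g x‖ ≤ (∫ x, ‖x‖ ^ p * ‖g x‖) / t ^ p := by
  have hi := g.integrable_pow_mul volume p
  rw [le_div_iff₀ (by positivity)]
  calc ‖∫ x in Ioi t, g x‖ * t ^ p ≤ (∫ x in Ioi t, ‖g x‖) * t ^ p := by
        gcongr; exact norm_integral_le_integral_norm _
    _ = ∫ x in Ioi t, ‖g x‖ * t ^ p := (MeasureTheory.integral_mul_const _ _).symm
    _ ≤ ∫ x in Ioi t, ‖x‖ ^ p * ‖g x‖ := by
        refine setIntegral_mono_on (g.integrable.norm.mul_const _).integrableOn hi.integrableOn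
          measurableSet_Ioi fun x hx => ?_
        have hx' : t < x := hx
        rw [mul_comm, Real.norm_of_nonneg (by linarith : 0 ≤ x)]
        gcongr
    _ ≤ _ := setIntegral_le_integral hi (Filter.Eventually.of_forall fun _ => by positivity)

/-- Evenness identifies twice the half-line integral with the full one. The sum stops near `N^ε`,
beyond which the rapid decay of `g` leaves `O(1/N)`. -/
theorem exists_sum_even_schwartz (g : 𝓢(ℝ, ℂ)) (hg : Function.Even g) {ε : ℝ} (hε : 0 < ε) :
    ∃ C : ℝ, 0 < C ∧ ∀ N : ℕ, 1 ≤ N →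
      ‖2 / (N : ℂ) * (∑ k ∈ Finset.Icc 1 ⌊(N : ℝ) ^ (1 + ε)⌋₊, g ((k : ℝ) / (N : ℝ))) - ∫ x, g x‖
        ≤ C / N := by
  -- A moment of order `p` with `εp ≥ 1`, so that `(N^ε)^p ≥ N`.
  obtain ⟨p, hp⟩ := exists_nat_ge (1 / ε)
  have hp1 : 1 ≤ ε * p := by
    rw [div_le_iff₀ hε] at hp; linarith
  set I := ∫ x, ‖deriv g x‖ with hI
  have hI0 : 0 ≤ I := integral_nonneg fun _ => norm_nonneg _
  set J := ∫ x, ‖x‖ ^ p * ‖g x‖ with hJ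
  have hJ0 : 0 ≤ J := integral_nonneg fun _ => by positivity
  refine ⟨2 * I + 2 * (2 ^ p * J) + 1, by positivity, fun N hN => ?_⟩
  have hN1 : (1 : ℝ) ≤ N := by exact_mod_cast hN
  have hN0 : (0 : ℝ) < N := by linarith
  set n := ⌊(N : ℝ) ^ (1 + ε)⌋₊ with hn
  have hX1 : 1 ≤ (N : ℝ) ^ (1 + ε) := Real.one_le_rpow hN1 (by linarith)
  have hn1 : (N : ℝ) ^ (1 + ε) / 2 ≤ n := by
    have h1 := Nat.lt_floor_add_one ((N : ℝ) ^ (1 + ε))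
    have h2 : (1 : ℝ) ≤ n := by exact_mod_cast Nat.floor_pos.2 hX1
    rw [← hn] at h1
    linarith
  set t := (n : ℝ) * (1 / N) with ht
  have hNε : 0 < (N : ℝ) ^ ε := by positivity
  have ht1 : (N : ℝ) ^ ε / 2 ≤ t := by
    rw [ht, mul_one_div, le_div_iff₀ hN0]
    rw [Real.rpow_add hN0, Real.rpow_one] at hn1
    linarith
  have ht0 : 0 < t := by linarith
  have htail : ‖∫ x in Ioi t, g x‖ ≤ 2 ^ p * J / N := by
    refine (norm_integral_Ioi_le g ht0 p).trans ?_
    rw [← hJ, div_le_div_iff₀ (by positivity) hN0]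
    have h1 : (N : ℝ) ≤ ((N : ℝ) ^ ε) ^ p := by
      rw [← Real.rpow_natCast, ← Real.rpow_mul hN0.le]
      calc (N : ℝ) = (N : ℝ) ^ (1 : ℝ) := (Real.rpow_one _).symm
        _ ≤ _ := Real.rpow_le_rpow_of_exponent_le hN1 hp1
    have h2 : ((N : ℝ) ^ ε) ^ p ≤ (2 * t) ^ p := pow_le_pow_left₀ hNε.le (by linarith) p
    calc J * N ≤ J * (2 * t) ^ p := by gcongr; linarith
      _ = _ := by rw [mul_pow]; ring
  have hR := norm_riemann_sum_sub_le g (h := 1 / N) (by positivity) n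
  rw [← hI, ← ht] at hR
  have hsplit : ∫ x, g x = 2 * ((∫ x in (0 : ℝ)..t, g x) + ∫ x in Ioi t, g x) := by
    have hi := g.integrable (μ := volume)
    rw [integral_interval_add_Ioi hi.integrableOn hi.integrableOn,
      ← integral_Iic_add_Ioi (b := 0) hi.integrableOn hi.integrableOn]
    have : ∫ x in Iic (0 : ℝ), g x = ∫ x in Ioi (0 : ℝ), g x := by
      have h1 := integral_comp_neg_Iic (0 : ℝ) g
      rw [neg_zero] at h1
      rw [← h1]
      exact integral_congr_ae (Filter.Eventually.of_forall fun x => (hg x).symm)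
    rw [this]; ring
  have e1 : 2 / (N : ℂ) * (∑ k ∈ Finset.Icc 1 n, g ((k : ℝ) / (N : ℝ))) - ∫ x, g x
      = 2 * (((1 / (N : ℝ) : ℝ) : ℂ) * (∑ k ∈ Finset.Icc 1 n, g ((k : ℝ) * (1 / N)))
        - ∫ x in (0 : ℝ)..t, g x) - 2 * ∫ x in Ioi t, g x := by
    rw [hsplit]
    simp_rw [mul_one_div]
    push_cast
    ring
  rw [e1]
  refine (norm_sub_le _ _).trans ?_
  rw [norm_mul, norm_mul, Complex.norm_ofNat]
  have e2 : (2 * I + 2 * (2 ^ p * J) + 1) / (N : ℝ)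
      = 2 * (1 / N * I) + 2 * (2 ^ p * J / N) + 1 / N := by ring
  rw [e2]
  have : 0 < 1 / (N : ℝ) := by positivity
  linarith

/-- What is needed about the weights `𝓕 f (k / N)`. -/
theorem exists_fourier_weights {f : ℝ → ℂ} (hf : ContDiff ℝ ∞ f) (hs : HasCompactSupport f)
    (he : Function.Even f) {ε : ℝ} (hε : 0 < ε) :
    ∃ V : ℝ, 0 < V ∧ ∀ N : ℕ, 1 ≤ N →
      (∀ k : ℕ, ‖𝓕 f ((k : ℝ) / (N : ℝ))‖ ≤ V) ∧
      (∀ n : ℕ, ∑ k ∈ Finset.range n,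
        ‖𝓕 f (((k + 1 : ℕ) : ℝ) / (N : ℝ)) - 𝓕 f ((k : ℝ) / (N : ℝ))‖ ≤ V) ∧
      ‖2 / (N : ℂ) * (∑ k ∈ Finset.Icc 1 ⌊(N : ℝ) ^ (1 + ε)⌋₊, 𝓕 f ((k : ℝ) / (N : ℝ))) - f 0‖
        ≤ V / N := by
  set φ : 𝓢(ℝ, ℂ) := hs.toSchwartzMap hf with hφ
  set g : 𝓢(ℝ, ℂ) := 𝓕 φ with hg
  have hgf : ∀ x, g x = 𝓕 f x := fun x => rfl
  have heven : Function.Even g := by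
    intro x
    have h1 : 𝓕⁻ f = 𝓕 f := by
      rw [Real.fourierInv_eq_fourier_comp_neg]
      congr 1
      exact funext he
    rw [hgf, hgf, ← Real.fourierInv_eq_fourier_neg, h1]
  -- Fourier inversion at the origin.
  have hint : ∫ x, g x = f 0 := by
    have h1 : 𝓕⁻ g = φ := FourierTransform.fourierInv_fourier_eq φ
    have h2 : (𝓕⁻ g) 0 = f 0 := by rw [h1]; rfl
    rw [← h2, fourierInv_coe, Real.fourierInv_eq]
    simp
  obtain ⟨C, hC, h⟩ := exists_sum_even_schwartz g heven hε
  obtain ⟨D, hD⟩ : ∃ D : ℝ, ∀ x, ‖g x‖ ≤ D :=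
    ⟨_, fun x => g.toBoundedContinuousFunction.norm_coe_le_norm x⟩
  have hD0 : 0 ≤ D := (norm_nonneg _).trans (hD 0)
  set I := ∫ x, ‖deriv g x‖ with hI
  have hI0 : 0 ≤ I := integral_nonneg fun _ => norm_nonneg _
  refine ⟨C + D + I, by positivity, fun N hN => ⟨fun k => ?_, fun n => ?_, ?_⟩⟩
  · rw [← hgf]; linarith [hD ((k : ℝ) / N)]
  · have := sum_norm_sub_le g (h := 1 / N) (by positivity) n
    simp only [mul_one_div] at this
    simp_rw [← hgf]
    linarith
  · have := h N hN
    simp_rw [← hgf]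
    rw [hint] at this
    refine this.trans ?_
    gcongr
    linarith

end DyadicTransform

namespace DyadicTransform

/-! ### Assembling the asymptotic formula -/

theorem exists_one_add_log_pow_le (n : ℕ) {δ : ℝ} (hδ : 0 < δ) :
    ∃ C : ℝ, 0 < C ∧ ∀ N : ℕ, 1 ≤ N → (1 + Real.log N) ^ n ≤ C * (N : ℝ) ^ δ := by
  set τ := δ / (n + 1) with hτ
  have hτ0 : 0 < τ := by positivity
  refine ⟨(1 + 1 / τ) ^ n, by positivity, fun N hN => ?_⟩
  have hN1 : (1 : ℝ) ≤ N := by exact_mod_cast hN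
  have hN0 : (0 : ℝ) < N := by linarith
  have h1 := Real.log_le_rpow_div hN0.le hτ0
  have h2 : 1 ≤ (N : ℝ) ^ τ := Real.one_le_rpow hN1 hτ0.le
  have h3 := Real.log_nonneg hN1
  have h4 : 1 + Real.log N ≤ (1 + 1 / τ) * (N : ℝ) ^ τ := by
    rw [add_mul, one_mul, one_div, ← div_eq_inv_mul]; linarith
  calc _ ≤ ((1 + 1 / τ) * (N : ℝ) ^ τ) ^ n := pow_le_pow_left₀ (by linarith) h4 n
    _ = (1 + 1 / τ) ^ n * (N : ℝ) ^ (τ * n) := by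
        rw [mul_pow, ← Real.rpow_natCast ((N : ℝ) ^ τ), ← Real.rpow_mul hN0.le]
    _ ≤ _ := by
        refine mul_le_mul_of_nonneg_left (Real.rpow_le_rpow_of_exponent_le hN1 ?_) (by positivity)
        rw [hτ, div_mul_eq_mul_div, div_le_iff₀ (by positivity)]
        nlinarith

theorem exists_rpow_mul_log_pow_le (n : ℕ) {p q : ℝ} (hpq : p < q) :
    ∃ C : ℝ, 0 < C ∧ ∀ N : ℕ, 1 ≤ N →
      (N : ℝ) ^ p * (1 + Real.log N) ^ n ≤ C * (N : ℝ) ^ q := by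
  obtain ⟨C, hC, h⟩ := exists_one_add_log_pow_le n (sub_pos.2 hpq)
  refine ⟨C, hC, fun N hN => ?_⟩
  have hN0 : (0 : ℝ) < N := by exact_mod_cast hN
  calc _ ≤ (N : ℝ) ^ p * (C * (N : ℝ) ^ (q - p)) := by
        gcongr; exact h N hN
    _ = C * ((N : ℝ) ^ p * (N : ℝ) ^ (q - p)) := by ring
    _ = _ := by rw [← Real.rpow_add hN0]; congr 2; ring

/-- The main term of the first transform, without its unimodular factor. -/
noncomputable def mainTerm (α θ : ℝ) (N k : ℕ) : ℂ :=
  ((ampConst α θ * (k : ℝ) ^ (1 / (2 * (1 - θ))) : ℝ) : ℂ) * dualSum α θ N k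

theorem norm_mainTerm_sq {α θ : ℝ} (hα : 0 < α) (hθ₀ : 0 < θ) (hθ₁ : θ < 1) {N k : ℕ}
    (hN : 1 ≤ N) (hk : 1 ≤ k) :
    ((‖mainTerm α θ N k‖ ^ 2 : ℝ) : ℂ)
      = ((ampConst α θ ^ 2 * (k : ℝ) ^ (1 / (1 - θ)) * diagSum α θ N k : ℝ) : ℂ)
        + ((ampConst α θ ^ 2 : ℝ) : ℂ) * ((((k : ℝ) ^ (1 / (1 - θ)) : ℝ) : ℂ) * offDiagSum α θ N k)
        + ((ampConst α θ ^ 2 : ℝ) : ℂ) * (starRingEnd ℂ)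
          ((((k : ℝ) ^ (1 / (1 - θ)) : ℝ) : ℂ) * offDiagSum α θ N k) := by
  have h1 : 0 < 1 - θ := by linarith
  have e1 : (ampConst α θ * (k : ℝ) ^ (1 / (2 * (1 - θ)))) ^ 2
      = ampConst α θ ^ 2 * (k : ℝ) ^ (1 / (1 - θ)) := by
    rw [mul_pow, ← Real.rpow_natCast ((k : ℝ) ^ _), ← Real.rpow_mul (by positivity)]
    congr 2; push_cast; field_simp
  rw [mainTerm, norm_mul, Complex.norm_real, mul_pow, Real.norm_eq_abs, sq_abs, e1,
    Complex.ofReal_mul, norm_dualSum_sq hα hθ₀ hθ₁ hN hk, map_mul, Complex.conj_ofReal]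
  push_cast
  ring

theorem sum_one_div_floor_le {N : ℕ} (hN : 1 ≤ N) {ε : ℝ} (hε₀ : 0 < ε) (hε₁ : ε < 1) :
    ∑ k ∈ Finset.Icc 1 ⌊(N : ℝ) ^ (1 + ε)⌋₊, 1 / (k : ℝ) ≤ 2 * (1 + Real.log N) := by
  have hN1 : (1 : ℝ) ≤ N := by exact_mod_cast hN
  have hN0 : (0 : ℝ) < N := by linarith
  have hX1 : 1 ≤ (N : ℝ) ^ (1 + ε) := Real.one_le_rpow hN1 (by linarith)
  have h := harmonic_floor_le_one_add_log _ hX1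
  rw [Real.log_rpow hN0, harmonic_eq_sum_Icc] at h
  push_cast at h
  simp_rw [one_div]
  have := Real.log_nonneg hN1
  nlinarith

/-- The diagonal gives `N` for each `k`, up to `1 + O(N^(2-θ)/k)`; the rest is off-diagonal. The
weights are left general because two choices are needed: `𝓕 f (k/N)` for the asymptotics, and `1`
for the second moment. -/
theorem exists_weighted_mainTerm_sub_le {α θ ε : ℝ} (hα : 0 < α) (hθ₀ : 0 < θ) (hθ₁ : θ < 1)
    (hε₀ : 0 < ε) (hε₁ : ε < 1) :
    ∃ C : ℝ, 0 < C ∧ ∀ (N : ℕ) (V : ℝ), 1 ≤ N → ∀ v : ℕ → ℂ,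
      (∀ k, ‖v k‖ ≤ V) → (∀ n, ∑ k ∈ Finset.range n, ‖v (k + 1) - v k‖ ≤ V) →
      ‖(∑ k ∈ Finset.Icc 1 ⌊(N : ℝ) ^ (1 + ε)⌋₊, v k * ((‖mainTerm α θ N k‖ ^ 2 : ℝ) : ℂ))
          - N * ∑ k ∈ Finset.Icc 1 ⌊(N : ℝ) ^ (1 + ε)⌋₊, v k‖
        ≤ C * V * ((N : ℝ) ^ 2 * S α θ ε N
          + (N : ℝ) ^ (3 / 2 * (1 + ε) + θ / 2) * (1 + Real.log N) ^ 6
          + (N : ℝ) ^ (1 + ε) + (N : ℝ) ^ (2 - θ) * (1 + Real.log N)) := by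
  obtain ⟨C₁, hC₁, h₁⟩ := exists_diagSum hα hθ₀ hθ₁
  obtain ⟨C₂, hC₂, h₂⟩ := exists_weighted_offDiagSum_le hα hθ₀ hθ₁ hε₀ hε₁
  set κ := ampConst α θ ^ 2 with hκ
  have hκ0 : 0 ≤ κ := sq_nonneg _
  refine ⟨1 + 2 * C₁ + 2 * κ * C₂, by positivity, fun N V hN v hv hv' => ?_⟩
  have hN1 : (1 : ℝ) ≤ N := by exact_mod_cast hN
  have hV : 0 ≤ V := (norm_nonneg _).trans (hv 0)
  have hlog := Real.log_nonneg hN1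
  have hX0 : 0 ≤ (N : ℝ) ^ (1 + ε) := by positivity
  set n := ⌊(N : ℝ) ^ (1 + ε)⌋₊ with hn
  have hn' : (n : ℝ) ≤ (N : ℝ) ^ (1 + ε) := Nat.floor_le hX0
  set d : ℕ → ℝ := fun k => κ * (k : ℝ) ^ (1 / (1 - θ)) * diagSum α θ N k - N with hd
  set o : ℕ → ℂ := fun k => (((k : ℝ) ^ (1 / (1 - θ)) : ℝ) : ℂ) * offDiagSum α θ N k with ho
  have hsplit : (∑ k ∈ Finset.Icc 1 n, v k * ((‖mainTerm α θ N k‖ ^ 2 : ℝ) : ℂ))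
      - N * ∑ k ∈ Finset.Icc 1 n, v k
      = (∑ k ∈ Finset.Icc 1 n, v k * (d k : ℂ)) + (κ : ℂ) * (∑ k ∈ Finset.Icc 1 n, v k * o k)
        + (κ : ℂ) * (starRingEnd ℂ) (∑ k ∈ Finset.Icc 1 n, (starRingEnd ℂ) (v k) * o k) := by
    rw [map_sum, Finset.mul_sum, Finset.mul_sum, Finset.mul_sum, ← Finset.sum_sub_distrib,
      ← Finset.sum_add_distrib, ← Finset.sum_add_distrib]
    refine Finset.sum_congr rfl fun k hk => ?_
    rw [norm_mainTerm_sq hα hθ₀ hθ₁ hN (Finset.mem_Icc.1 hk).1,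
      map_mul _ ((starRingEnd ℂ) (v k)), Complex.conj_conj]
    simp only [hd, ho, hκ]
    push_cast
    ring
  have hb : ∀ w : ℕ → ℂ, (∀ k, ‖w k‖ ≤ V) → (∀ m, ∑ k ∈ Finset.range m, ‖w (k + 1) - w k‖ ≤ V) →
      ‖∑ k ∈ Finset.Icc 1 n, w k * o k‖ ≤ C₂ * V * ((N : ℝ) ^ 2 * S α θ ε N
        + (N : ℝ) ^ (3 / 2 * (1 + ε) + θ / 2) * (1 + Real.log N) ^ 6) := by
    intro w hw hw'
    simp only [ho, ← mul_assoc]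
    exact h₂ N V hN w hw hw'
  have hb1 := hb v hv hv'
  -- The part `m₁ > m₂` is the conjugate of a sum with conjugated weights, which have the same size
  -- and variation.
  have hb2 := hb (fun k => (starRingEnd ℂ) (v k)) (fun k => by rw [RCLike.norm_conj]; exact hv k)
    (fun m => by
      simp_rw [← map_sub, RCLike.norm_conj]
      exact hv' m)
  have hdiag : ‖∑ k ∈ Finset.Icc 1 n, v k * (d k : ℂ)‖
      ≤ V * ((N : ℝ) ^ (1 + ε) + C₁ * ((N : ℝ) ^ (2 - θ) * (2 * (1 + Real.log N)))) := by
    calc _ ≤ ∑ k ∈ Finset.Icc 1 n, V * (1 + C₁ * ((N : ℝ) ^ (2 - θ) * (1 / k))) := by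
          refine norm_sum_le_of_le _ fun k hk => ?_
          rw [norm_mul, Complex.norm_real, mul_one_div]
          exact mul_le_mul (hv k) (h₁ N k hN (Finset.mem_Icc.1 hk).1) (norm_nonneg _) hV
      _ = V * (n + C₁ * ((N : ℝ) ^ (2 - θ) * ∑ k ∈ Finset.Icc 1 n, 1 / (k : ℝ))) := by
          rw [← Finset.mul_sum, Finset.sum_add_distrib, ← Finset.mul_sum, ← Finset.mul_sum]
          simp
      _ ≤ _ := by
          have := sum_one_div_floor_le hN hε₀ hε₁
          gcongr
  rw [hsplit]
  refine (norm_add₃_le).trans ?_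
  rw [norm_mul, norm_mul, RCLike.norm_conj, Complex.norm_real, Real.norm_of_nonneg hκ0]
  have hS := S_nonneg hα hθ₀ hθ₁ hε₀ hN
  set s := (N : ℝ) ^ 2 * S α θ ε N
    + (N : ℝ) ^ (3 / 2 * (1 + ε) + θ / 2) * (1 + Real.log N) ^ 6 with hs
  have hs0 : 0 ≤ s := by positivity
  set x := (N : ℝ) ^ (1 + ε)
  set y := (N : ℝ) ^ (2 - θ) * (1 + Real.log N) with hy
  have hy0 : 0 ≤ y := by positivity
  have a1 := mul_le_mul_of_nonneg_left hb1 hκ0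
  have a2 := mul_le_mul_of_nonneg_left hb2 hκ0
  calc _ ≤ V * (x + C₁ * (2 * y)) + κ * (C₂ * V * s) + κ * (C₂ * V * s) := by
        refine add_le_add (add_le_add (hdiag.trans (le_of_eq ?_)) a1) a2
        rw [hy]; ring
    _ ≤ (1 + 2 * C₁ + 2 * κ * C₂) * V * (s + x + y) := by
        have b1 : 0 ≤ V * s := by positivity
        have b2 : 0 ≤ C₁ * V * s := by positivity
        have b3 : 0 ≤ C₁ * V * x := by positivity
        have b4 : 0 ≤ κ * C₂ * V * x := by positivity
        have b5 : 0 ≤ κ * C₂ * V * y := by positivity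
        have b6 : 0 ≤ V * y := by positivity
        linarith only [b1, b2, b3, b4, b5, b6]

/-- The squared error `N^(2-θ)/k` sums to `N^(2-θ) log N`. The logarithmic part adds up to `N^(1+ε)
log⁴ N`, which is smaller since `1 + ε < 2 - θ`. -/
theorem exists_sum_error_sq_le {α θ ε : ℝ} (hα : 0 < α) (hθ₀ : 0 < θ) (hε₀ : 0 < ε)
    (hθε : θ + ε < 1) :
    ∃ C : ℝ, 0 < C ∧ ∃ ζ : ℂ, ‖ζ‖ = 1 ∧ ∀ N : ℕ, 1 ≤ N →
      ∑ k ∈ Finset.Icc 1 ⌊(N : ℝ) ^ (1 + ε)⌋₊,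
        ‖(∑ y ∈ Finset.Icc 1 N, e (α * (k : ℝ) * (y : ℝ) ^ θ)) - ζ * mainTerm α θ N k‖ ^ 2
        ≤ C * ((N : ℝ) ^ (2 - θ) * (1 + Real.log N)) := by
  obtain ⟨C₁, hC₁, ζ, hζ, h₁⟩ := exists_sum_sub_dualSum_le hα hθ₀ (by linarith)
  obtain ⟨C₂, hC₂, h₂⟩ := exists_rpow_mul_log_pow_le 4 (show 1 + ε < 2 - θ by linarith)
  refine ⟨2 * C₁ ^ 2 * (2 + 4 * C₂), by positivity, ζ, hζ, fun N hN => ?_⟩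
  have hN1 : (1 : ℝ) ≤ N := by exact_mod_cast hN
  have hN0 : (0 : ℝ) < N := by linarith
  have hlog := Real.log_nonneg hN1
  set ℓ := 1 + Real.log N with hℓ
  have hℓ1 : 1 ≤ ℓ := by rw [hℓ]; linarith
  set n := ⌊(N : ℝ) ^ (1 + ε)⌋₊ with hn
  have hn' : (n : ℝ) ≤ (N : ℝ) ^ (1 + ε) := Nat.floor_le (by positivity)
  have hterm : ∀ k ∈ Finset.Icc 1 n,
      ‖(∑ y ∈ Finset.Icc 1 N, e (α * (k : ℝ) * (y : ℝ) ^ θ)) - ζ * mainTerm α θ N k‖ ^ 2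
        ≤ 2 * C₁ ^ 2 * ((N : ℝ) ^ (2 - θ) * (1 / k) + 4 * ℓ ^ 4) := by
    intro k hk
    rw [Finset.mem_Icc] at hk
    have hk0 : (0 : ℝ) < k := by exact_mod_cast hk.1
    have hkn : (k : ℝ) ≤ n := by exact_mod_cast hk.2
    have hkl0 : 0 ≤ Real.log (2 + k) := Real.log_nonneg (by linarith)
    have hkl : Real.log (2 + k) ≤ 2 * ℓ := by
      have g0 : (N : ℝ) ^ (1 + ε) ≤ (N : ℝ) ^ (2 : ℝ) :=
        Real.rpow_le_rpow_of_exponent_le hN1 (by linarith)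
      have g1 : (1 : ℝ) ≤ (N : ℝ) ^ (2 : ℝ) := Real.one_le_rpow hN1 (by norm_num)
      have g2 : Real.log (2 + k) ≤ Real.log (3 * (N : ℝ) ^ (2 : ℝ)) :=
        Real.log_le_log (by linarith) (by linarith)
      have g3 : Real.log 3 ≤ 2 := by
        have := Real.log_le_sub_one_of_pos (show (0 : ℝ) < 3 by norm_num)
        linarith
      rw [Real.log_mul (by norm_num) (by positivity), Real.log_rpow hN0] at g2
      rw [hℓ]; linarith
    have h3 := h₁ N k hN hk.1
    rw [← mainTerm] at h3
    set x := (k : ℝ) ^ (-(1 / 2) : ℝ) * (N : ℝ) ^ (1 - θ / 2) with hx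
    have hx2 : x ^ 2 = (N : ℝ) ^ (2 - θ) * (1 / k) := by
      rw [hx, mul_pow, ← Real.rpow_natCast ((k : ℝ) ^ _), ← Real.rpow_natCast ((N : ℝ) ^ _),
        ← Real.rpow_mul hk0.le, ← Real.rpow_mul hN0.le, mul_comm]
      congr 1
      · congr 1; push_cast; ring
      · have : -(1 / 2) * ((2 : ℕ) : ℝ) = -1 := by norm_num
        rw [this, Real.rpow_neg_one, one_div]
    have h4 : Real.log (2 + k) * (1 + Real.log N) ≤ 2 * ℓ ^ 2 := by
      have := mul_le_mul_of_nonneg_right hkl (by linarith : (0 : ℝ) ≤ ℓ)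
      rw [← hℓ]; linarith
    have h5 : 0 ≤ Real.log (2 + k) * (1 + Real.log N) := by positivity
    have hx0 : 0 ≤ x := by positivity
    calc _ ≤ (C₁ * (x + 2 * ℓ ^ 2)) ^ 2 := by
          refine pow_le_pow_left₀ (norm_nonneg _) (h3.trans ?_) 2
          gcongr
      _ = C₁ ^ 2 * (x + 2 * ℓ ^ 2) ^ 2 := by ring
      _ ≤ C₁ ^ 2 * (2 * (x ^ 2 + (2 * ℓ ^ 2) ^ 2)) := by
          gcongr; exact add_sq_le
      _ = _ := by rw [hx2]; ring
  refine (Finset.sum_le_sum hterm).trans ?_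
  rw [← Finset.mul_sum, Finset.sum_add_distrib, ← Finset.mul_sum, Finset.sum_const, nsmul_eq_mul,
    Nat.card_Icc, Nat.add_sub_cancel]
  have h6 := sum_one_div_floor_le hN hε₀ (by linarith)
  have h7 := h₂ N hN
  have h8 : (n : ℝ) * (4 * ℓ ^ 4) ≤ 4 * C₂ * ((N : ℝ) ^ (2 - θ) * ℓ) := by
    have : (N : ℝ) ^ (2 - θ) * 1 ≤ (N : ℝ) ^ (2 - θ) * ℓ := by gcongr
    calc (n : ℝ) * (4 * ℓ ^ 4) ≤ (N : ℝ) ^ (1 + ε) * (4 * ℓ ^ 4) := by gcongr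
      _ = 4 * ((N : ℝ) ^ (1 + ε) * ℓ ^ 4) := by ring
      _ ≤ 4 * (C₂ * (N : ℝ) ^ (2 - θ)) := by gcongr
      _ = 4 * C₂ * ((N : ℝ) ^ (2 - θ) * 1) := by ring
      _ ≤ _ := by gcongr
  calc _ ≤ 2 * C₁ ^ 2 * ((N : ℝ) ^ (2 - θ) * (2 * ℓ) + 4 * C₂ * ((N : ℝ) ^ (2 - θ) * ℓ)) := by
        gcongr
    _ = _ := by ring

/-- AM-GM with a free parameter for the cross term, in place of the Cauchy-Schwarz inequality for
the sum over `k`. -/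
theorem abs_norm_sq_sub_norm_sq_le {z a ζ : ℂ} (hζ : ‖ζ‖ = 1) {r : ℝ} (hr : 0 < r) :
    |‖z‖ ^ 2 - ‖a‖ ^ 2| ≤ r * ‖a‖ ^ 2 + (r⁻¹ + 1) * ‖z - ζ * a‖ ^ 2 := by
  have h1 : ‖ζ * a‖ = ‖a‖ := by rw [norm_mul, hζ, one_mul]
  have h2 : |‖z‖ - ‖a‖| ≤ ‖z - ζ * a‖ := by
    rw [← h1]; exact abs_norm_sub_norm_le _ _
  set d := ‖z - ζ * a‖
  obtain ⟨h3, h4⟩ := abs_le.1 h2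
  have hd : 0 ≤ d := norm_nonneg _
  have ha : 0 ≤ ‖a‖ := norm_nonneg _
  have hz : 0 ≤ ‖z‖ := norm_nonneg _
  have h5 : 2 * ‖a‖ * d ≤ r * ‖a‖ ^ 2 + r⁻¹ * d ^ 2 := by
    have h6 : 0 ≤ r⁻¹ * (r * ‖a‖ - d) ^ 2 := by positivity
    have h7 : r⁻¹ * (r * ‖a‖ - d) ^ 2 = r * ‖a‖ ^ 2 - 2 * ‖a‖ * d + r⁻¹ * d ^ 2 := by
      field_simp; ring
    linarith
  have h8 : |‖z‖ ^ 2 - ‖a‖ ^ 2| ≤ d * (2 * ‖a‖ + d) := by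
    have : ‖z‖ ^ 2 - ‖a‖ ^ 2 = (‖z‖ - ‖a‖) * (‖z‖ + ‖a‖) := by ring
    rw [this, abs_mul, abs_of_nonneg (by positivity : 0 ≤ ‖z‖ + ‖a‖)]
    exact mul_le_mul h2 (by linarith) (by positivity) hd
  linarith

theorem exists_second_moment_asymptotic {α θ ε : ℝ} (hα : 0 < α) (hε : 0 < ε) (hθ₁ : 3 * ε < θ)
    (hθ₂ : θ < 1 - 3 * ε) {f : ℝ → ℂ} (hf : ContDiff ℝ ∞ f) (hs : HasCompactSupport f)
    (he : Function.Even f) :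
    ∃ C : ℝ, 0 < C ∧ ∀ N : ℕ, 1 ≤ N →
      ‖2 / (N : ℂ) ^ 2 * (∑ k ∈ Finset.Icc 1 ⌊(N : ℝ) ^ (1 + ε)⌋₊, 𝓕 f ((k : ℝ) / (N : ℝ)) *
          ((‖∑ y ∈ Finset.Icc 1 N, e (α * (k : ℝ) * (y : ℝ) ^ θ)‖ ^ 2 : ℝ) : ℂ)) - f 0‖
        ≤ C * ((1 + Real.log N) * ((N : ℝ) ^ (-θ / 2 + ε / 2)
          + (N : ℝ) ^ (-1 / 4 + θ / 4 + 3 * ε / 4)) + S α θ ε N) := by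
  have hθ0 : 0 < θ := by linarith
  have hθ1 : θ < 1 := by linarith
  have hε1 : ε < 1 := by linarith
  obtain ⟨V, hV, hw⟩ := exists_fourier_weights hf hs he hε
  obtain ⟨C₁, hC₁, h₁⟩ := exists_weighted_mainTerm_sub_le hα hθ0 hθ1 hε hε1
  obtain ⟨C₂, hC₂, ζ, hζ, h₂⟩ := exists_sum_error_sq_le hα hθ0 hε (by linarith : θ + ε < 1)
  -- Less `2`, the left exponent is twice the negative number `-1/4 + θ/4 + 3ε/4`, so there is room
  -- for six logarithms.
  obtain ⟨C₃, hC₃, h₃⟩ := exists_rpow_mul_log_pow_le 6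
    (show 3 / 2 * (1 + ε) + θ / 2 < 2 + (-1 / 4 + θ / 4 + 3 * ε / 4) by linarith)
  set D := C₁ * (3 + C₃) with hD
  have hD0 : 0 < D := by positivity
  refine ⟨2 * (V * ((1 + D) + 2 * C₂)) + 2 * (D * V) + V, by positivity, fun N hN => ?_⟩
  obtain ⟨hv, hv', hfin⟩ := hw N hN
  have hN1 : (1 : ℝ) ≤ N := by exact_mod_cast hN
  have hN0 : (0 : ℝ) < N := by linarith
  have hlog := Real.log_nonneg hN1
  set ℓ := 1 + Real.log N with hℓ
  have hℓ1 : 1 ≤ ℓ := by rw [hℓ]; linarith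
  set R₁ := (N : ℝ) ^ (-θ / 2 + ε / 2) with hR₁
  set R₂ := (N : ℝ) ^ (-1 / 4 + θ / 4 + 3 * ε / 4) with hR₂
  have hR₁0 : 0 < R₁ := by positivity
  have hR₂0 : 0 < R₂ := by positivity
  have hS := S_nonneg hα hθ0 hθ1 hε hN
  set R := ℓ * (R₁ + R₂) + S α θ ε N with hR
  set n := ⌊(N : ℝ) ^ (1 + ε)⌋₊ with hn
  have hn' : (n : ℝ) ≤ (N : ℝ) ^ (1 + ε) := Nat.floor_le (by positivity)
  have hsq : (N : ℝ) ^ (2 : ℝ) = (N : ℝ) ^ 2 := Real.rpow_two _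
  have hR₁R : R₁ ≤ R := by
    have a1 : 1 * R₁ ≤ ℓ * R₁ := by gcongr
    have a2 : 0 ≤ ℓ * R₂ := by positivity
    rw [hR]; linarith
  have hR₁ℓ : R₁ * ℓ ≤ R := by
    have a2 : 0 ≤ ℓ * R₂ := by positivity
    rw [hR]; linarith
  have hR₂R : R₂ ≤ R := by
    have a1 : 1 * R₂ ≤ ℓ * R₂ := by gcongr
    have a2 : 0 ≤ ℓ * R₁ := by positivity
    rw [hR]; linarith
  have hSR : S α θ ε N ≤ R := by
    have a2 : 0 ≤ ℓ * (R₁ + R₂) := by positivity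
    rw [hR]; linarith
  have hR0 : 0 < R := hR₁0.trans_le hR₁R
  have hpow : ∀ p : ℝ, p ≤ 2 + (-θ / 2 + ε / 2) → (N : ℝ) ^ p ≤ (N : ℝ) ^ 2 * R₁ := by
    intro p hp
    rw [hR₁, ← hsq, ← Real.rpow_add hN0]
    exact Real.rpow_le_rpow_of_exponent_le hN1 hp
  have hN2 : (0 : ℝ) < (N : ℝ) ^ 2 := by positivity
  -- the total error of the weighted main term
  have hmain : ∀ (W : ℝ) (v : ℕ → ℂ), (∀ k, ‖v k‖ ≤ W) →
      (∀ m, ∑ k ∈ Finset.range m, ‖v (k + 1) - v k‖ ≤ W) →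
      ‖(∑ k ∈ Finset.Icc 1 n, v k * ((‖mainTerm α θ N k‖ ^ 2 : ℝ) : ℂ))
        - N * ∑ k ∈ Finset.Icc 1 n, v k‖ ≤ D * W * ((N : ℝ) ^ 2 * R) := by
    intro W v hv hv'
    have hW : 0 ≤ W := (norm_nonneg _).trans (hv 0)
    refine (h₁ N W hN v hv hv').trans ?_
    have b1 : (N : ℝ) ^ 2 * S α θ ε N ≤ (N : ℝ) ^ 2 * R := by gcongr
    have b2 : (N : ℝ) ^ (3 / 2 * (1 + ε) + θ / 2) * ℓ ^ 6 ≤ C₃ * ((N : ℝ) ^ 2 * R) := by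
      refine (h₃ N hN).trans ?_
      rw [Real.rpow_add hN0, hsq, ← hR₂]
      gcongr
    have b3 : (N : ℝ) ^ (1 + ε) ≤ (N : ℝ) ^ 2 * R :=
      (hpow _ (by linarith)).trans (by gcongr)
    have b4 : (N : ℝ) ^ (2 - θ) * ℓ ≤ (N : ℝ) ^ 2 * R := by
      calc _ ≤ (N : ℝ) ^ 2 * R₁ * ℓ := by
            gcongr; exact hpow _ (by linarith)
        _ = (N : ℝ) ^ 2 * (R₁ * ℓ) := by ring
        _ ≤ _ := by gcongr
    calc _ ≤ C₁ * W * ((N : ℝ) ^ 2 * R + C₃ * ((N : ℝ) ^ 2 * R) + (N : ℝ) ^ 2 * R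
          + (N : ℝ) ^ 2 * R) := by gcongr
      _ = _ := by rw [hD]; ring
  -- the second moment of the main term
  have hsecond : ∑ k ∈ Finset.Icc 1 n, ‖mainTerm α θ N k‖ ^ 2
      ≤ (N : ℝ) ^ (2 + ε) + D * ((N : ℝ) ^ 2 * R) := by
    -- Constant weights have no variation, so `W = 1` is admissible.
    have h4 := hmain 1 (fun _ => 1) (fun _ => by simp) (fun _ => by simp)
    simp only [one_mul, mul_one, Finset.sum_const, nsmul_eq_mul, Nat.card_Icc,
      Nat.add_sub_cancel] at h4
    have h5 : ((∑ k ∈ Finset.Icc 1 n, ((‖mainTerm α θ N k‖ ^ 2 : ℝ) : ℂ)) - N * n)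
        = (((∑ k ∈ Finset.Icc 1 n, ‖mainTerm α θ N k‖ ^ 2) - N * n : ℝ) : ℂ) := by
      push_cast; rfl
    rw [h5, Complex.norm_real] at h4
    have h6 := (le_abs_self _).trans h4
    have h7 : (N : ℝ) * n ≤ (N : ℝ) ^ (2 + ε) := by
      have : (N : ℝ) ^ (2 + ε) = N * (N : ℝ) ^ (1 + ε) := by
        nth_rewrite 2 [← Real.rpow_one (N : ℝ)]
        rw [← Real.rpow_add hN0]; congr 1; ring
      rw [this]; gcongr
    linarith
  -- the error of the first transform
  set Z : ℕ → ℂ := fun k => ∑ y ∈ Finset.Icc 1 N, e (α * (k : ℝ) * (y : ℝ) ^ θ) with hZ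
  have hcross : ∑ k ∈ Finset.Icc 1 n, |‖Z k‖ ^ 2 - ‖mainTerm α θ N k‖ ^ 2|
      ≤ ((1 + D) + 2 * C₂) * ((N : ℝ) ^ 2 * R) := by
    -- This balances `r N^(2+ε)` against `r⁻¹ N^(2-θ)`; both equal `N^(2-θ/2+ε/2)`.
    set r := (N : ℝ) ^ (-θ / 2 - ε / 2) with hr
    have hr0 : 0 < r := by positivity
    have hr1 : r ≤ 1 := Real.rpow_le_one_of_one_le_of_nonpos hN1 (by linarith)
    have hri : 1 ≤ r⁻¹ := (one_le_inv₀ hr0).2 hr1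
    have a1 : r * (N : ℝ) ^ (2 + ε) ≤ (N : ℝ) ^ 2 * R := by
      rw [hr, ← Real.rpow_add hN0]
      exact (hpow _ (by linarith)).trans (by gcongr)
    have a2 : r⁻¹ * ((N : ℝ) ^ (2 - θ) * ℓ) ≤ (N : ℝ) ^ 2 * R := by
      rw [hr, ← Real.rpow_neg hN0.le, ← mul_assoc, ← Real.rpow_add hN0]
      calc _ ≤ (N : ℝ) ^ 2 * R₁ * ℓ := by
            gcongr; exact hpow _ (by linarith)
        _ = (N : ℝ) ^ 2 * (R₁ * ℓ) := by ring
        _ ≤ _ := by gcongr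
    have a3 : r * (D * ((N : ℝ) ^ 2 * R)) ≤ D * ((N : ℝ) ^ 2 * R) :=
      mul_le_of_le_one_left (by positivity) hr1
    calc _ ≤ ∑ k ∈ Finset.Icc 1 n, (r * ‖mainTerm α θ N k‖ ^ 2
          + (r⁻¹ + 1) * ‖Z k - ζ * mainTerm α θ N k‖ ^ 2) :=
          Finset.sum_le_sum fun k _ => abs_norm_sq_sub_norm_sq_le hζ hr0
      _ = r * (∑ k ∈ Finset.Icc 1 n, ‖mainTerm α θ N k‖ ^ 2)
          + (r⁻¹ + 1) * ∑ k ∈ Finset.Icc 1 n, ‖Z k - ζ * mainTerm α θ N k‖ ^ 2 := by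
          rw [Finset.sum_add_distrib, ← Finset.mul_sum, ← Finset.mul_sum]
      _ ≤ r * ((N : ℝ) ^ (2 + ε) + D * ((N : ℝ) ^ 2 * R))
          + (r⁻¹ + r⁻¹) * (C₂ * ((N : ℝ) ^ (2 - θ) * ℓ)) := by
          have h4 := h₂ N hN
          gcongr
      _ = r * (N : ℝ) ^ (2 + ε) + r * (D * ((N : ℝ) ^ 2 * R))
          + 2 * C₂ * (r⁻¹ * ((N : ℝ) ^ (2 - θ) * ℓ)) := by ring
      _ ≤ (N : ℝ) ^ 2 * R + D * ((N : ℝ) ^ 2 * R) + 2 * C₂ * ((N : ℝ) ^ 2 * R) := by gcongr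
      _ = _ := by ring
  set v : ℕ → ℂ := fun k => 𝓕 f ((k : ℝ) / (N : ℝ)) with hvd
  have hT1 : ‖∑ k ∈ Finset.Icc 1 n, v k * ((‖Z k‖ ^ 2 - ‖mainTerm α θ N k‖ ^ 2 : ℝ) : ℂ)‖
      ≤ V * (((1 + D) + 2 * C₂) * ((N : ℝ) ^ 2 * R)) := by
    refine le_trans ?_ (mul_le_mul_of_nonneg_left hcross hV.le)
    rw [Finset.mul_sum]
    refine norm_sum_le_of_le _ fun k _ => ?_
    rw [norm_mul, Complex.norm_real, Real.norm_eq_abs]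
    exact mul_le_mul_of_nonneg_right (hv k) (abs_nonneg _)
  have hT2 := hmain V v hv hv'
  have hNc : (N : ℂ) ≠ 0 := by exact_mod_cast hN0.ne'
  have hdecomp : 2 / (N : ℂ) ^ 2 * (∑ k ∈ Finset.Icc 1 n, v k * ((‖Z k‖ ^ 2 : ℝ) : ℂ)) - f 0
      = 2 / (N : ℂ) ^ 2
          * (∑ k ∈ Finset.Icc 1 n, v k * ((‖Z k‖ ^ 2 - ‖mainTerm α θ N k‖ ^ 2 : ℝ) : ℂ))
        + 2 / (N : ℂ) ^ 2
          * ((∑ k ∈ Finset.Icc 1 n, v k * ((‖mainTerm α θ N k‖ ^ 2 : ℝ) : ℂ))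
            - N * ∑ k ∈ Finset.Icc 1 n, v k)
        + (2 / (N : ℂ) * (∑ k ∈ Finset.Icc 1 n, v k) - f 0) := by
    simp_rw [Complex.ofReal_sub, mul_sub, Finset.sum_sub_distrib]
    field_simp
    ring
  have hcoef : ‖2 / (N : ℂ) ^ 2‖ = 2 / (N : ℝ) ^ 2 := by
    rw [norm_div, norm_pow, Complex.norm_natCast, Complex.norm_ofNat]
  rw [hdecomp]
  refine norm_add₃_le.trans ?_
  rw [norm_mul, norm_mul, hcoef]
  have g1 : 2 / (N : ℝ) ^ 2 * (V * (((1 + D) + 2 * C₂) * ((N : ℝ) ^ 2 * R)))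
      = 2 * (V * ((1 + D) + 2 * C₂)) * R := by field_simp
  have g2 : 2 / (N : ℝ) ^ 2 * (D * V * ((N : ℝ) ^ 2 * R)) = 2 * (D * V) * R := by field_simp
  have g3 : V / N ≤ V * R := by
    have : (N : ℝ)⁻¹ ≤ R₁ := by
      rw [← Real.rpow_neg_one]
      exact Real.rpow_le_rpow_of_exponent_le hN1 (by linarith)
    rw [div_eq_mul_inv]
    exact mul_le_mul_of_nonneg_left (this.trans hR₁R) hV.le
  have g4 : (0 : ℝ) ≤ 2 / (N : ℝ) ^ 2 := by positivity
  have k1 := mul_le_mul_of_nonneg_left hT1 g4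
  have k2 := mul_le_mul_of_nonneg_left hT2 g4
  rw [g1] at k1
  rw [g2] at k2
  have k3 := hfin.trans g3
  calc _ ≤ 2 * (V * ((1 + D) + 2 * C₂)) * R + 2 * (D * V) * R + V * R :=
        add_le_add (add_le_add k1 k2) k3
    _ = _ := by ring

end DyadicTransform

theorem proposition2 (α θ ε : ℝ) (hα : 0 < α) (hε : 0 < ε) (hθ₁ : 3 * ε < θ)
    (hθ₂ : θ < 1 - 3 * ε)
    (f : ℝ → ℂ) (hf_smooth : ContDiff ℝ ∞ f) (hf_supp : HasCompactSupport f)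
    (hf_even : Function.Even f) :
    (fun N : ℕ =>
        2 / (N : ℂ) ^ 2 *
          ∑ k ∈ Finset.Icc 1 ⌊(N : ℝ) ^ (1 + ε)⌋₊,
            𝓕 f ((k : ℝ) / (N : ℝ)) *
              ((‖∑ y ∈ Finset.Icc 1 N, DyadicTransform.e (α * (k : ℝ) * (y : ℝ) ^ θ)‖ ^ 2 : ℝ) : ℂ)
          - f 0)
      =O[atTop]
    (fun N : ℕ =>
        (N : ℝ) ^ (-θ / 2 + ε / 2) * Real.log N
          + (N : ℝ) ^ (-1 / 4 + θ / 4 + 3 * ε / 4) * Real.log N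
          + DyadicTransform.S α θ ε N) := by
  obtain ⟨C, hC, h⟩ := DyadicTransform.exists_second_moment_asymptotic hα hε hθ₁ hθ₂ hf_smooth
    hf_supp hf_even
  refine IsBigO.of_bound (2 * C) ?_
  -- As `3 > exp 1`, here `log N ≥ 1`, so `1 + log N ≤ 2 log N`; this is the factor `2` in the
  -- constant.
  filter_upwards [eventually_ge_atTop 3] with N hN
  have hN3 : (3 : ℝ) ≤ N := by exact_mod_cast hN
  have hlog : 1 ≤ Real.log N := by
    rw [Real.le_log_iff_exp_le (by linarith)]
    linarith [Real.exp_one_lt_d9]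
  have hS := DyadicTransform.S_nonneg (N := N) hα (by linarith : 0 < θ) (by linarith : θ < 1) hε
    (by omega)
  set R₁ := (N : ℝ) ^ (-θ / 2 + ε / 2)
  set R₂ := (N : ℝ) ^ (-1 / 4 + θ / 4 + 3 * ε / 4)
  have hR : 0 < R₁ + R₂ := by positivity
  have key : (1 + Real.log N) * (R₁ + R₂) + DyadicTransform.S α θ ε N
      ≤ 2 * (R₁ * Real.log N + R₂ * Real.log N + DyadicTransform.S α θ ε N) := by
    have := mul_le_mul_of_nonneg_right hlog hR.le
    linarith
  refine (h N (by omega)).trans ((mul_le_mul_of_nonneg_left key hC.le).trans ?_)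
  rw [← mul_assoc, mul_comm C 2]
  exact mul_le_mul_of_nonneg_left (Real.le_norm_self _) (by positivity)
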